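/- **Setting.** Let $\tilde D\subset D\subset B$ be real Banach spaces with $\|\cdot\|_{\tilde D}\ge\|\cdot\|_D\ge\|\cdot\|_B$, $D$ dense in $B$ and $\tilde D$ dense in $D$ (each in the norm of the larger space), so that $B^\star\subset D^\star$, and functionals on $D$ restrict to $\tilde D$. Let $M\subset B^\star$ be bounded, and closed in the norms of both $B^\star$ and $D^\star$. Let $r>0$, and let $\mathcal C$ be the set of all curves $\xi_\cdot:[0,r]\to M$ that are continuous in the norm of $D^\star$. Let $I\subset\mathbb R$ be an interval; all derivatives in $\alpha$ are taken within $I$. For each $\alpha\in I$ let $A^\alpha[\xi]:D\to B$, $\xi\in D^\star$, be bounded linear operators with the following properties. For a bounded $T:D\to B$ we write $\|T\|_{\tilde D\to D}\le C$ if $T$ maps $\tilde D$ to $D$ with norm at most $C$. *Assumptions for each fixed $\alpha\in I$ (the constants may depend on $\alpha$).* 1. $A^\alpha[\mu]$, $\mu\in M$, are uniformly bounded as operators $D\to B$ and $\tilde D\to D$; and $\|A^\alpha[\mu]-A^\alpha[\eta]\|_{D\to B}$ and $\|A^\alpha[\mu]-A^\alpha[\eta]\|_{\tilde D\to D}$ are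 at most $c\|\mu-\eta\|_{D^\star}$ for $\mu,\eta\in B^\star$. 2. For each $\xi_\cdot\in\mathcal C$ there is a strongly continuous backward propagator $U^{t,s}=U^{t,s;\alpha}[\xi_\cdot]$, $0\le t\le s\le r$, of bounded operators in $B$ which restricts to strongly continuous propagators in $D$ and in $\tilde D$, is bounded in $B$ and in $D$ uniformly in $t,s$ and $\xi_\cdot$, and is generated by $A^\alpha[\xi_t]$ on $D$: for $f\in D$, in the norm of $B$, $\frac{d}{ds}U^{t,s}f=U^{t,s}A^\alpha[\xi_s]f$ and $\frac{d}{ds}U^{s,q}f=-A^\alpha[\xi_s]U^{s,q}f$. The dual operators $(U^{t,s})^\star$ map $M$ into $M$. 3. For $\mu\in B^\star$, $\xi\in D^\star$ the limit $D_\xi A^\alpha[\mu]=\lim_{s\to0+}\frac1s(A^\alpha[\mu+s\xi]-A^\alpha[\mu])$ exists in $\mathcal L(D,B)$ and is a bounded linear function of $\xi\in D^\star$, with $\|D_\xi A^\alpha[\mu]\|_{D\to B}$ and $\|D_\xi A^\alpha[\mu]\|_{\tilde D\to D}$ at most $c(1+\|\mu\|_{B^\star})\|\xi\|_{D^\star}$,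 and $\|D_\xi A^\alpha[\mu]-D_\xi A^\alpha[\eta]\|_{D\to B}\le c\|\mu-\eta\|_{D^\star}\|\xi\|_{D^\star}$ for $\mu,\eta\in B^\star$. 4. There are operators $F^\alpha[\mu]\in\mathcal L(D,D)$, depending continuously on $\mu\in M$ (taken with the norm of $D^\star$), with $(D_\xi A^\alpha[\mu]g,\mu)=(F^\alpha[\mu]g,\xi)$ for $\mu\in M$, $\xi\in D^\star$, $g\in D$. *Assumptions on the dependence on $\alpha$.* For $\alpha\in I$, $\mu\in M$ the derivative $\partial A^\alpha[\mu]/\partial\alpha$ exists in the norms of $\mathcal L(D,B)$ and of $\mathcal L(\tilde D,D)$, both norms of it are bounded uniformly in $\alpha\in I$, $\mu\in M$, and $\|\partial_\alpha A^\alpha[\mu]-\partial_\alpha A^\alpha[\eta]\|_{\tilde D\to D}\le c\|\mu-\eta\|_{D^\star}$ for $\mu,\eta\in M$, with $c$ independent of $\alpha$. **Theorem.** For every $\alpha\in I$ and $\nu\in M$ there is a unique $M$-valued solution $T^\alpha_t(\nu)$, $t\in[0,r]$, of $$\tfrac{d}{dt}(f,\mu_t)=(A^\alpha[\mu_t]f,\mu_t)\quad(f\in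 D),\qquad \mu_0=\nu .$$ (a) Let $\mu_0^\beta\in M$ for $\beta\in I$, put $\mu_t^\beta=T_t^\beta(\mu_0^\beta)$, and suppose that at a point $\alpha\in I$ the derivative $\xi_0=\partial\mu_0^\alpha/\partial\alpha\in B^\star$ exists in the norm of $\tilde D^\star$ and weakly-$\star$ in $D^\star$. Then the linearized equation $$\tfrac{d}{dt}(g,\xi_t)=(A^\alpha[\mu_t^\alpha]g,\xi_t)+(D_{\xi_t}A^\alpha[\mu_t^\alpha]g,\mu_t^\alpha)+\Big(\tfrac{\partial A^\alpha[\mu_t^\alpha]}{\partial\alpha}g,\mu_t^\alpha\Big)\quad(g\in\tilde D)$$ has a unique weakly-$\star$ continuous solution $\xi_t\in D^\star$, $t\in[0,r]$, with initial value $\xi_0$. It is given by $\xi_t=\Pi^{t,0}[\alpha,\mu_0^\alpha]\xi_0$, where, for $g\in D$, $$(g,\Pi^{t,0}\xi_0)=(\Phi^{0,t}g,\xi_0)+\int_0^t\Big(\tfrac{\partial A^\alpha[\mu_s^\alpha]}{\partial\alpha}\Phi^{s,t}g,\mu_s^\alpha\Big)ds ,$$ $$\Phi^{t,q}=U^{t,q}+\sum_{m\ge1}\int_{t\le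 s_1\le\dots\le s_m\le q}U^{t,s_1}F_{s_1}U^{s_1,s_2}\cdots F_{s_m}U^{s_m,q}\,ds_1\cdots ds_m ,$$ with $U^{t,s}=U^{t,s;\alpha}[\mu^\alpha_\cdot]$ and $F_s=F^\alpha[\mu_s^\alpha]$. For every $t\in[0,r]$ the derivative $\partial\mu_t^\alpha/\partial\alpha$ exists weakly-$\star$ in $D^\star$ and equals $\xi_t$. If, moreover, the operators $F^\alpha[\mu]$, $\mu\in M$, map $\tilde D$ into itself and are uniformly bounded in $\tilde D$, then $\partial\mu_t^\alpha/\partial\alpha=\xi_t$ also in the norm of $\tilde D^\star$. (b) (Initial data.) Let $\alpha\in I$ be fixed, let $\nu\in M$, $\xi_0\in B^\star$, and let $\nu+s\xi_0\in M$ for all small $s>0$. Then for every $t\in[0,r]$ the derivative $\lim_{s\to0+}\frac1s\big(T_t^\alpha(\nu+s\xi_0)-T_t^\alpha(\nu)\big)$ exists weakly-$\star$ in $D^\star$, and, if the operators $F^\alpha[\mu]$, $\mu\in M$, are uniformly bounded in $\tilde D$, also in the norm of $\tilde D^\star$. It equals the unique weakly-$\star$ continuous solution $\xi_t\in D^\star$,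 with initial value $\xi_0$, of the linearized equation around $\mu_t=T^\alpha_t(\nu)$ without its last term. This solution is $\xi_t=\Pi^{t,0}\xi_0$, with $\Pi$ as in (a) without the integral. -/

import Mathlib

open Set Filter Topology

noncomputable section

namespace Sensitivity

/-- Three Banach spaces `E ⊂ D ⊂ B` (`E` is the space usually written `D̃`) with
`‖·‖_E ≥ ‖·‖_D ≥ ‖·‖_B`, `D` dense in `B` and `E` dense in `D`; the inclusions are written as
injective maps `ι : D → B` and `κ : E → D`. -/
structure BanachTriple (B D E : Type*) [NormedAddCommGroup B] [NormedSpace ℝ B]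
    [NormedAddCommGroup D] [NormedSpace ℝ D] [NormedAddCommGroup E] [NormedSpace ℝ E] where
  ι : D →L[ℝ] B
  κ : E →L[ℝ] D
  ι_injective : Function.Injective ι
  κ_injective : Function.Injective κ
  norm_ι_le : ∀ f : D, ‖ι f‖ ≤ ‖f‖
  norm_κ_le : ∀ f : E, ‖κ f‖ ≤ ‖f‖
  ι_dense : DenseRange ι
  κ_dense : DenseRange κ

section

variable {B D E : Type*} [NormedAddCommGroup B] [NormedSpace ℝ B]
  [NormedAddCommGroup D] [NormedSpace ℝ D] [NormedAddCommGroup E] [NormedSpace ℝ E]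

namespace BanachTriple

/-- The inclusion `B⋆ ⊂ D⋆` (restriction of functionals). -/
def toD (S : BanachTriple B D E) (μ : StrongDual ℝ B) : StrongDual ℝ D := μ.comp S.ι

/-- The map `D⋆ → E⋆` (restriction of functionals). -/
def toE (S : BanachTriple B D E) (ξ : StrongDual ℝ D) : StrongDual ℝ E := ξ.comp S.κ

/-- `T : D → B` restricts to a bounded operator `E → D` and `‖T‖_{E → D} ≤ C`. -/
def RestrictsWithBound (S : BanachTriple B D E) (T : D →L[ℝ] B) (C : ℝ) : Prop :=
  ∀ g : E, ∃ h : D, S.ι h = T (S.κ g) ∧ ‖h‖ ≤ C * ‖g‖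

/-- `M` is a bounded subset of `B⋆` that is closed in the norms of both `B⋆` and `D⋆`. -/
structure IsStateSpace (S : BanachTriple B D E) (M : Set (StrongDual ℝ B)) : Prop where
  bounded : Bornology.IsBounded M
  closed : IsClosed M
  closed_toD : IsClosed (S.toD '' M)

/-- `ξ` is, on `[0,r]`, a curve in `M` that is continuous in the norm of `D⋆`. -/
def IsCurve (S : BanachTriple B D E) (r : ℝ) (M : Set (StrongDual ℝ B))
    (ξ : ℝ → StrongDual ℝ B) : Prop :=
  (∀ s ∈ Icc 0 r, ξ s ∈ M) ∧ ContinuousOn (fun s => S.toD (ξ s)) (Icc 0 r)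

end BanachTriple

/-- `U t s`, `0 ≤ t ≤ s ≤ r`, is a strongly continuous backward propagator of bounded operators
in `X`: `U t t = 1`, `U t q = U t s ∘ U s q`, and `(t, s) ↦ U t s f` is continuous. -/
structure IsBackwardPropagator {X : Type*} [NormedAddCommGroup X] [NormedSpace ℝ X] (r : ℝ)
    (U : ℝ → ℝ → X →L[ℝ] X) : Prop where
  refl : ∀ t ∈ Icc 0 r, U t t = ContinuousLinearMap.id ℝ X
  comp : ∀ t s q : ℝ, 0 ≤ t → t ≤ s → s ≤ q → q ≤ r → (U t s).comp (U s q) = U t q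
  continuous : ∀ f : X,
    ContinuousOn (fun p : ℝ × ℝ => U p.1 p.2 f) {p | 0 ≤ p.1 ∧ p.1 ≤ p.2 ∧ p.2 ≤ r}

/-- The operators attached to one value of the parameter:
`A ξ = A[ξ] : D → B` for `ξ ∈ D⋆`; `DA μ ξ = D_ξ A[μ]`, linear and bounded in `ξ ∈ D⋆`;
`F ξ = F[ξ] : D → D`; and, for a curve `ξ`, the propagator `U^{t,s}[ξ]` as a family of operators
in `B` (`UB ξ t s`), in `D` (`UD ξ t s`) and in `E` (`UE ξ t s`).
All laws are in `Model.Admissible`. -/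
structure Model (B D E : Type*) [NormedAddCommGroup B] [NormedSpace ℝ B]
    [NormedAddCommGroup D] [NormedSpace ℝ D] [NormedAddCommGroup E] [NormedSpace ℝ E] where
  A : StrongDual ℝ D → (D →L[ℝ] B)
  DA : StrongDual ℝ B → (StrongDual ℝ D →L[ℝ] (D →L[ℝ] B))
  F : StrongDual ℝ D → (D →L[ℝ] D)
  UB : (ℝ → StrongDual ℝ B) → ℝ → ℝ → (B →L[ℝ] B)
  UD : (ℝ → StrongDual ℝ B) → ℝ → ℝ → (D →L[ℝ] D)
  UE : (ℝ → StrongDual ℝ B) → ℝ → ℝ → (E →L[ℝ] E)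

/-- The assumptions that do not involve the dependence on the parameter. -/
structure Model.Admissible (G : Model B D E) (S : BanachTriple B D E) (r : ℝ)
    (M : Set (StrongDual ℝ B)) : Prop where
  /-- `A[μ]`, `μ ∈ M`, are uniformly bounded as operators `D → B` and `E → D`. -/
  bounded_A : ∃ c : ℝ, ∀ μ ∈ M, ‖G.A (S.toD μ)‖ ≤ c ∧ S.RestrictsWithBound (G.A (S.toD μ)) c
  /-- `A` is Lipschitz in the norm of `D⋆`, as operators `D → B` and `E → D`. -/
  lipschitz_A : ∃ c : ℝ, ∀ μ η : StrongDual ℝ B,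
    ‖G.A (S.toD μ) - G.A (S.toD η)‖ ≤ c * ‖S.toD μ - S.toD η‖ ∧
    S.RestrictsWithBound (G.A (S.toD μ) - G.A (S.toD η)) (c * ‖S.toD μ - S.toD η‖)
  /-- `UB ξ` is a strongly continuous backward propagator in `B`. -/
  propagator_B : ∀ ξ, S.IsCurve r M ξ → IsBackwardPropagator r (G.UB ξ)
  /-- Its restriction to `D` is a strongly continuous propagator in `D`. -/
  propagator_D : ∀ ξ, S.IsCurve r M ξ → IsBackwardPropagator r (G.UD ξ)
  /-- Its restriction to `E` is a strongly continuous propagator in `E`. -/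
  propagator_E : ∀ ξ, S.IsCurve r M ξ → IsBackwardPropagator r (G.UE ξ)
  restrict_D : ∀ ξ, S.IsCurve r M ξ → ∀ t s : ℝ, 0 ≤ t → t ≤ s → s ≤ r → ∀ f : D,
    S.ι (G.UD ξ t s f) = G.UB ξ t s (S.ι f)
  restrict_E : ∀ ξ, S.IsCurve r M ξ → ∀ t s : ℝ, 0 ≤ t → t ≤ s → s ≤ r → ∀ f : E,
    S.κ (G.UE ξ t s f) = G.UD ξ t s (S.κ f)
  /-- The propagators are bounded in `B` and in `D`, uniformly in the curve. (In `E`, boundedness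
  for each curve follows from strong continuity.) -/
  bounded_U : ∃ K : ℝ, ∀ ξ, S.IsCurve r M ξ → ∀ t s : ℝ, 0 ≤ t → t ≤ s → s ≤ r →
    ‖G.UB ξ t s‖ ≤ K ∧ ‖G.UD ξ t s‖ ≤ K
  /-- `d/ds U^{t,s} f = U^{t,s} A[ξ_s] f` in `B` for `f ∈ D`. -/
  generates_right : ∀ ξ, S.IsCurve r M ξ → ∀ f : D, ∀ t s : ℝ, 0 ≤ t → t ≤ s → s ≤ r →
    HasDerivWithinAt (fun s' => G.UB ξ t s' (S.ι f)) (G.UB ξ t s (G.A (S.toD (ξ s)) f))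
      (Icc t r) s
  /-- `d/ds U^{s,q} f = - A[ξ_s] U^{s,q} f` in `B` for `f ∈ D`. -/
  generates_left : ∀ ξ, S.IsCurve r M ξ → ∀ f : D, ∀ s q : ℝ, 0 ≤ s → s ≤ q → q ≤ r →
    HasDerivWithinAt (fun s' => G.UB ξ s' q (S.ι f)) (-(G.A (S.toD (ξ s)) (G.UD ξ s q f)))
      (Icc 0 q) s
  /-- The dual propagators `V^{s,t} = (U^{t,s})⋆` preserve `M`. -/
  preserves : ∀ ξ, S.IsCurve r M ξ → ∀ t s : ℝ, 0 ≤ t → t ≤ s → s ≤ r → ∀ μ ∈ M,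
    μ.comp (G.UB ξ t s) ∈ M
  /-- `D_ξ A[μ]` is the Gateaux derivative, in the norm of operators `D → B`. -/
  gateaux : ∀ (μ : StrongDual ℝ B) (ξ : StrongDual ℝ D),
    Tendsto (fun s : ℝ => s⁻¹ • (G.A (S.toD μ + s • ξ) - G.A (S.toD μ))) (𝓝[>] 0)
      (𝓝 (G.DA μ ξ))
  /-- Bounds for `D_ξ A[μ]` as an operator `D → B` and `E → D`. -/
  bounded_DA : ∃ c : ℝ, ∀ (μ : StrongDual ℝ B) (ξ : StrongDual ℝ D),
    ‖G.DA μ ξ‖ ≤ c * (1 + ‖μ‖) * ‖ξ‖ ∧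
    S.RestrictsWithBound (G.DA μ ξ) (c * (1 + ‖μ‖) * ‖ξ‖)
  /-- `D_ξ A[μ]` is Lipschitz in `μ` in the norm of `D⋆`. -/
  lipschitz_DA : ∃ c : ℝ, ∀ (μ η : StrongDual ℝ B) (ξ : StrongDual ℝ D),
    ‖G.DA μ ξ - G.DA η ξ‖ ≤ c * ‖S.toD μ - S.toD η‖ * ‖ξ‖
  /-- `(D_ξ A[μ] g, μ) = (F[μ] g, ξ)`. -/
  dual_rep : ∀ μ ∈ M, ∀ (ξ : StrongDual ℝ D) (g : D), μ (G.DA μ ξ g) = ξ (G.F (S.toD μ) g)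
  /-- `F` is continuous from the norm of `D⋆` to the norm of operators `D → D`. -/
  continuous_F : ContinuousOn G.F (S.toD '' M)

/-- The operators `F[μ]`, `μ ∈ M`, restrict to uniformly bounded operators in `E`. -/
def Model.FBoundedOnE (G : Model B D E) (S : BanachTriple B D E)
    (M : Set (StrongDual ℝ B)) : Prop :=
  ∃ c : ℝ, ∀ μ ∈ M, ∀ g : E, ∃ h : E, S.κ h = G.F (S.toD μ) (S.κ g) ∧ ‖h‖ ≤ c * ‖g‖

/-- Assumptions on the dependence on the parameter `α ∈ I`; `A' α μ` is `∂A^α[μ]/∂α`. -/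
structure ParameterAssumptions (S : BanachTriple B D E) (M : Set (StrongDual ℝ B)) (I : Set ℝ)
    (G : ℝ → Model B D E) (A' : ℝ → StrongDual ℝ B → (D →L[ℝ] B)) : Prop where
  /-- The derivative exists in the norm of operators `D → B`. -/
  deriv_DB : ∀ α ∈ I, ∀ μ ∈ M,
    HasDerivWithinAt (fun β => (G β).A (S.toD μ)) (A' α μ) I α
  /-- The derivative exists in the norm of operators `E → D`. -/
  deriv_ED : ∀ α ∈ I, ∀ μ ∈ M, ∀ ε > 0, ∀ᶠ β in 𝓝[I \ {α}] α,
    S.RestrictsWithBound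
      ((β - α)⁻¹ • ((G β).A (S.toD μ) - (G α).A (S.toD μ)) - A' α μ) ε
  /-- The derivatives are bounded as operators `D → B` and `E → D`. -/
  bounded : ∃ c : ℝ, ∀ α ∈ I, ∀ μ ∈ M, ‖A' α μ‖ ≤ c ∧ S.RestrictsWithBound (A' α μ) c
  /-- The derivatives are Lipschitz in `μ` as operators `E → D`. -/
  lipschitz : ∃ c : ℝ, ∀ α ∈ I, ∀ μ ∈ M, ∀ η ∈ M,
    S.RestrictsWithBound (A' α μ - A' α η) (c * ‖S.toD μ - S.toD η‖)

/-- `ν` is an `M`-valued solution on `[0,r]` of `d/dt (f, ν_t) = (A[ν_t] f, ν_t)`, `f ∈ D`,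
with `ν_0 = ν₀`. -/
def Model.IsNonlinearSolution (G : Model B D E) (S : BanachTriple B D E) (r : ℝ)
    (M : Set (StrongDual ℝ B)) (ν₀ : StrongDual ℝ B) (ν : ℝ → StrongDual ℝ B) : Prop :=
  (∀ t ∈ Icc 0 r, ν t ∈ M) ∧ ν 0 = ν₀ ∧
  ∀ f : D, ∀ t ∈ Icc 0 r,
    HasDerivWithinAt (fun s => ν s (S.ι f)) (ν t (G.A (S.toD (ν t)) f)) (Icc 0 r) t

/-- `ξ` is, on `[0,r]`, a weakly-⋆ continuous curve in `D⋆` with `ξ_0 = ξ₀` such that for `g ∈ E`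
`d/dt (g, ξ_t) = (A[μ_t] g, ξ_t) + (D_{ξ_t} A[μ_t] g, μ_t) + (P[μ_t] g, μ_t)`.
Here `h` is the element `A[μ_t] g` of `D`, and `P` stands for `∂A/∂α`. -/
def Model.IsLinearizedSolution (G : Model B D E) (S : BanachTriple B D E) (r : ℝ)
    (P : StrongDual ℝ B → (D →L[ℝ] B)) (μ : ℝ → StrongDual ℝ B) (ξ₀ : StrongDual ℝ D)
    (ξ : ℝ → StrongDual ℝ D) : Prop :=
  (∀ g : D, ContinuousOn (fun t => ξ t g) (Icc 0 r)) ∧ ξ 0 = ξ₀ ∧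
  ∀ g : E, ∀ t ∈ Icc 0 r, ∃ h : D, S.ι h = G.A (S.toD (μ t)) (S.κ g) ∧
    HasDerivWithinAt (fun s => ξ s (S.κ g))
      (ξ t h + μ t (G.DA (μ t) (ξ t) (S.κ g)) + μ t (P (μ t) (S.κ g))) (Icc 0 r) t

/-- The terms of the perturbation series:
`∫_{t ≤ s₁ ≤ ⋯ ≤ s_m ≤ q} U^{t,s₁} F_{s₁} U^{s₁,s₂} ⋯ F_{s_m} U^{s_m,q} g ds₁ ⋯ ds_m`. -/
def seriesTerm (U : ℝ → ℝ → (D →L[ℝ] D)) (F : ℝ → (D →L[ℝ] D)) : ℕ → ℝ → ℝ → D → D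
  | 0, t, q, g => U t q g
  | m + 1, t, q, g => ∫ s in t..q, U t s (F s (seriesTerm U F m s q g))

/-- The perturbed backward propagator `Φ^{t,q}` around the path `μ`, the sum of the series. -/
def Model.Phi (G : Model B D E) (S : BanachTriple B D E) (μ : ℝ → StrongDual ℝ B)
    (t q : ℝ) (g : D) : D :=
  ∑' m : ℕ, seriesTerm (G.UD μ) (fun s => G.F (S.toD (μ s))) m t q g

/-- The value `(g, Π^{q,t} ξ) = (Φ^{t,q} g, ξ) + ∫_t^q (P[μ_s] Φ^{s,q} g, μ_s) ds`. -/
def Model.PiApply (G : Model B D E) (S : BanachTriple B D E)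
    (P : StrongDual ℝ B → (D →L[ℝ] B)) (μ : ℝ → StrongDual ℝ B) (q t : ℝ)
    (ξ : StrongDual ℝ D) (g : D) : ℝ :=
  ξ (G.Phi S μ t q g) + ∫ s in t..q, μ s (P (μ s) (G.Phi S μ s q g))

/-- `ξ` is the unique weakly-⋆ continuous solution of the linearized equation around `μ` that
starts from `ξ₀`, and `ξ_t = Π^{t,0} ξ₀`. -/
def Model.IsLinearizedEvolution (G : Model B D E) (S : BanachTriple B D E) (r : ℝ)
    (P : StrongDual ℝ B → (D →L[ℝ] B)) (μ : ℝ → StrongDual ℝ B) (ξ₀ : StrongDual ℝ D)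
    (ξ : ℝ → StrongDual ℝ D) : Prop :=
  G.IsLinearizedSolution S r P μ ξ₀ ξ ∧
  (∀ ξ', G.IsLinearizedSolution S r P μ ξ₀ ξ' → EqOn ξ' ξ (Icc 0 r)) ∧
  ∀ t ∈ Icc 0 r, ∀ g : D, ξ t g = G.PiApply S P μ t 0 ξ₀ g

/-- `dμ^β/dβ = ξ` at `β = α` (within `I`), weakly-⋆ in `D⋆`. -/
def HasWeakStarDeriv (S : BanachTriple B D E) (I : Set ℝ) (μ : ℝ → StrongDual ℝ B) (α : ℝ)
    (ξ : StrongDual ℝ D) : Prop :=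
  ∀ g : D, HasDerivWithinAt (fun β => S.toD (μ β) g) (ξ g) I α

/-- `dμ^β/dβ = ξ` at `β = α` (within `I`), in the norm of `E⋆`. -/
def HasNormDeriv (S : BanachTriple B D E) (I : Set ℝ) (μ : ℝ → StrongDual ℝ B) (α : ℝ)
    (ξ : StrongDual ℝ D) : Prop :=
  HasDerivWithinAt (fun β => S.toE (S.toD (μ β))) (S.toE ξ) I α

end

end Sensitivity

end

/-!
The nonlinear equation is solved by Picard iteration. A curve `ξ` of states is mapped to
`Ψ(ξ) : t ↦ (U^{0,t}[ξ])⋆ ν`, and Duhamel's formula (`duhamel`) turns the Lipschitz dependence of `A` on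
the state into `‖Ψ(ξ)_t - Ψ(η)_t‖_{D⋆} ≤ C ∫_0^t ‖ξ_s - η_s‖_{D⋆} ds` (`exists_linear_stability`).
This gives existence and, since every solution is a fixed point, uniqueness.

The linearized equation is replaced by its mild form, whose homogeneous part is
`θ_t(f) = x₀(U^{0,t} f) + ∫_0^t θ_s(F_s U^{s,t} f) ds`, with an inhomogeneity `e_s(U^{s,t} f)` added
under the integral. By the duality `(D_ξ A[μ] g, μ) = (F[μ] g, ξ)`, a weakly-⋆ continuous curve
solves the linearized equation if and only if it solves the mild equation: on vectors of `E` the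
propagator is differentiable in the norm of `D`, and `E` is dense in `D`. The perturbation series
`Φ` satisfies the Volterra equation `Φ^{t,q} = U^{t,q} + ∫_t^q Φ^{t,σ} F_σ U^{σ,q} dσ`
(`exists_perturbed_propagator`), and Fubini's theorem on a triangle then shows that
`x₀(Φ^{0,t} f) + ∫_0^t e_s(Φ^{s,t} f) ds` is a mild solution. It is the only one, by a Gronwall
argument that needs no measurability of the norms (`gronwall_of_bounded`).

For the sensitivity, the difference quotients `ζ^β = (μ^β - μ^α)/(β - α)` solve the same mild
equation with inhomogeneities `e^β` (`isMildSolution_quotient`). Weak-⋆ convergence of the initial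
quotients makes them bounded in `D⋆`, and stability propagates this bound to `ζ^β`. Hence `e^β` is
bounded in `D⋆` and converges in the norm of `E⋆`, uniformly in time, to the inhomogeneity of the
linearized equation (`eventually_inhomogeneity_close`); here the Taylor remainder of `A` is
quadratic, and the difference quotients of `A` in the parameter are equi-Lipschitz in the state, so
that they converge uniformly on the compact set of states of a curve. The formula with `Φ` passes
this convergence on to `ζ^β`, weakly-⋆ in `D⋆` (`tendsto_mild_solution`). If `F` is bounded on `E`,
the mild equation can be estimated directly in the norm of `E⋆` (`tendsto_toE_mild_solution`).

Differentiability in the initial data is the special case in which the parameter enters only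
through the initial value.
-/

noncomputable section

namespace Sensitivity

/-! ### Strongly convergent families of operators -/

section Strong

variable {X Y Z ι : Type*} [NormedAddCommGroup X] [NormedSpace ℝ X] [CompleteSpace X]
  [NormedAddCommGroup Y] [NormedSpace ℝ Y]

/-- Banach–Steinhaus along a countably generated filter. -/
theorem exists_eventually_norm_le {l : Filter ι} [l.IsCountablyGenerated] {L : ι → X →L[ℝ] Y}
    {y : X → Y} (h : ∀ x, Tendsto (fun i => L i x) l (𝓝 (y x))) :
    ∃ C : ℝ, 0 ≤ C ∧ ∀ᶠ i in l, ‖L i‖ ≤ C := by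
  by_contra! hcon
  have hfreq : ∀ n : ℕ, ∃ᶠ i in l, (n : ℝ) < ‖L i‖ := fun n => by
    have := hcon n n.cast_nonneg
    simpa [Filter.not_eventually] using this
  obtain ⟨s, hs⟩ := l.exists_antitone_basis
  have hex : ∀ n : ℕ, ∃ i ∈ s n, (n : ℝ) < ‖L i‖ := fun n =>
    ((hfreq n).and_eventually (hs.toHasBasis.mem_of_mem trivial)).exists.imp fun i hi => hi.symm
  choose i his hin using hex
  have hi : Tendsto i atTop l := hs.tendsto his
  obtain ⟨C, hC⟩ := banach_steinhaus (g := fun n => L (i n)) fun x => by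
    obtain ⟨c, hc⟩ := ((h x).comp hi).norm.bddAbove_range
    exact ⟨c, fun n => hc ⟨n, rfl⟩⟩
  obtain ⟨n, hn⟩ := exists_nat_gt C
  exact absurd (hC n) (not_le.2 (hn.trans (hin n)))

/-- Strong convergence of operators is compatible with convergence of their arguments; the uniform
bound this needs comes from the Banach–Steinhaus theorem. -/
theorem tendsto_apply_of_strong {l : Filter ι} [l.IsCountablyGenerated] {L : ι → X →L[ℝ] Y}
    {L₀ : X →L[ℝ] Y} {v : ι → X} {v₀ : X} (h : ∀ x, Tendsto (fun i => L i x) l (𝓝 (L₀ x)))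
    (hv : Tendsto v l (𝓝 v₀)) : Tendsto (fun i => L i (v i)) l (𝓝 (L₀ v₀)) := by
  obtain ⟨C, hC0, hC⟩ := exists_eventually_norm_le h
  have h1 : Tendsto (fun i => L i (v i - v₀)) l (𝓝 0) := by
    have h2 : Tendsto (fun i => C * ‖v i - v₀‖) l (𝓝 0) := by
      simpa using (tendsto_iff_norm_sub_tendsto_zero.1 hv).const_mul C
    refine squeeze_zero_norm' (hC.mono fun i hi => ?_) h2
    exact (L i).le_of_opNorm_le hi _
  have h3 := h1.add (h v₀)
  rw [zero_add] at h3
  refine h3.congr fun i => ?_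
  rw [map_sub, sub_add_cancel]

theorem continuousOn_apply_of_strong [TopologicalSpace Z] [FirstCountableTopology Z] {s : Set Z}
    {L : Z → X →L[ℝ] Y} {v : Z → X} (h : ∀ x, ContinuousOn (fun z => L z x) s)
    (hv : ContinuousOn v s) : ContinuousOn (fun z => L z (v z)) s := fun z hz =>
  tendsto_apply_of_strong (fun x => h x z hz) (hv z hz)

theorem continuous_apply_of_strong [TopologicalSpace Z] [FirstCountableTopology Z]
    {L : Z → X →L[ℝ] Y} {v : Z → X} (h : ∀ x, Continuous (fun z => L z x))
    (hv : Continuous v) : Continuous (fun z => L z (v z)) := by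
  rw [← continuousOn_univ] at *
  exact continuousOn_apply_of_strong (fun x => (h x).continuousOn) hv

theorem exists_norm_le_of_strong [TopologicalSpace Z] {s : Set Z} (hs : IsCompact s)
    {L : Z → X →L[ℝ] Y} (h : ∀ x, ContinuousOn (fun z => L z x) s) :
    ∃ C : ℝ, 0 ≤ C ∧ ∀ z ∈ s, ‖L z‖ ≤ C := by
  obtain ⟨C, hC⟩ := banach_steinhaus (g := fun z : s => L z) fun x => by
    obtain ⟨c, hc⟩ := (hs.image_of_continuousOn (h x)).isBounded.exists_norm_le
    exact ⟨c, fun z => hc _ ⟨z, z.2, rfl⟩⟩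
  exact ⟨max C 0, le_max_right _ _, fun z hz => (hC ⟨z, hz⟩).trans (le_max_left _ _)⟩

/-- Product rule for `s ↦ m_s (u_s)`, where `m` is only strongly continuous and is differentiable
only at the vector `u x`. -/
theorem hasDerivWithinAt_apply_of_strong {m : ℝ → X →L[ℝ] Y} {u : ℝ → X} {s : Set ℝ} {x : ℝ}
    {a : Y} {u' : X} (hm : ∀ v, ContinuousWithinAt (fun t => m t v) s x)
    (hd : HasDerivWithinAt (fun t => m t (u x)) a s x) (hu : HasDerivWithinAt u u' s x) :
    HasDerivWithinAt (fun t => m t (u t)) (a + m x u') s x := by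
  rw [hasDerivWithinAt_iff_tendsto_slope] at *
  have h1 : Tendsto (fun t => m t (slope u x t)) (𝓝[s \ {x}] x) (𝓝 (m x u')) :=
    tendsto_apply_of_strong (fun v => (hm v).mono_left (nhdsWithin_mono _ sdiff_subset)) hu
  refine (hd.add h1).congr fun t => ?_
  simp only [slope_def_module, map_smul, map_sub, ← smul_add]
  congr 1
  abel

/-- The strong integral of a strongly continuous family of operators. -/
theorem exists_strong_integral [CompleteSpace Y] {L : ℝ → X →L[ℝ] Y}
    (h : ∀ x, Continuous fun s => L s x) (a b : ℝ) :
    ∃ J : X →L[ℝ] Y, ∀ x, J x = ∫ s in a..b, L s x := by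
  obtain ⟨C, hC0, hC⟩ := exists_norm_le_of_strong (isCompact_uIcc (a := a) (b := b))
    fun x => (h x).continuousOn
  refine ⟨LinearMap.mkContinuous
    { toFun := fun x => ∫ s in a..b, L s x
      map_add' := fun x y => ?_
      map_smul' := fun c x => ?_ } (C * |b - a|) fun x => ?_, fun x => rfl⟩
  · simp only [map_add]
    exact intervalIntegral.integral_add ((h x).intervalIntegrable _ _)
      ((h y).intervalIntegrable _ _)
  · simp only [map_smul, RingHom.id_apply]
    exact intervalIntegral.integral_smul _ _
  · have := intervalIntegral.norm_integral_le_of_norm_le_const (a := a) (b := b)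
      (f := fun s => L s x) (C := C * ‖x‖)
      fun s hs => (L s).le_of_opNorm_le (hC s (uIoc_subset_uIcc hs)) x
    simpa [mul_right_comm] using this

end Strong

/-! ### Integrals over triangles, exponential weights -/

section Integrals

open MeasureTheory

variable {Y : Type*} [NormedAddCommGroup Y] [NormedSpace ℝ Y]

theorem integral_triangle_swap_of_le {f : ℝ → ℝ → Y} (hf : Continuous (Function.uncurry f))
    {a b : ℝ} (hab : a ≤ b) :
    ∫ s in a..b, ∫ σ in s..b, f s σ = ∫ σ in a..b, ∫ s in a..σ, f s σ := by
  have hm : MeasurableSet {p : ℝ × ℝ | p.1 < p.2} := measurableSet_lt measurable_fst measurable_snd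
  have hint : IntegrableOn (Function.uncurry fun s σ => if s < σ then f s σ else 0)
      (uIoc a b ×ˢ uIoc a b) := by
    have h1 : IntegrableOn (Function.uncurry f) (uIoc a b ×ˢ uIoc a b) :=
      (hf.continuousOn.integrableOn_compact (isCompact_uIcc.prod isCompact_uIcc)).mono_set
        (prod_mono uIoc_subset_uIcc uIoc_subset_uIcc)
    have h2 := h1.integrable.indicator hm
    refine h2.congr (Eventually.of_forall fun p => ?_)
    simp [indicator, Function.uncurry]
  have hswap := intervalIntegral_intervalIntegral_swap hint
  have e1 : ∀ s ∈ uIcc a b, ∫ σ in a..b, (if s < σ then f s σ else 0) = ∫ σ in s..b, f s σ := by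
    intro s hs
    rw [uIcc_of_le hab] at hs
    rw [intervalIntegral.integral_of_le hab, intervalIntegral.integral_of_le hs.2]
    have : (fun σ => if s < σ then f s σ else 0) = indicator (Ioi s) (f s) := by
      ext σ; simp [indicator]
    rw [this, setIntegral_indicator measurableSet_Ioi]
    congr 2
    ext σ
    simp only [mem_inter_iff, mem_Ioc, mem_Ioi]
    exact ⟨fun h => ⟨h.2, h.1.2⟩, fun h => ⟨⟨hs.1.trans_lt h.1, h.2⟩, h.1⟩⟩
  have e2 : ∀ σ ∈ uIcc a b, ∫ s in a..b, (if s < σ then f s σ else 0) = ∫ s in a..σ, f s σ := by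
    intro σ hs
    rw [uIcc_of_le hab] at hs
    rw [intervalIntegral.integral_of_le hab, intervalIntegral.integral_of_le hs.1,
      integral_Ioc_eq_integral_Ioo (x := a) (y := σ)]
    have : (fun s => if s < σ then f s σ else 0) = indicator (Iio σ) (fun s => f s σ) := by
      ext σ; simp [indicator]
    rw [this, setIntegral_indicator measurableSet_Iio]
    congr 2
    ext s
    simp only [mem_inter_iff, mem_Ioc, mem_Iio, mem_Ioo]
    exact ⟨fun h => ⟨h.1.1, h.2⟩, fun h => ⟨⟨h.1, h.2.le.trans hs.2⟩, h.2⟩⟩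
  rw [← intervalIntegral.integral_congr e1, ← intervalIntegral.integral_congr e2, hswap]

theorem integral_triangle_swap {f : ℝ → ℝ → Y} (hf : Continuous (Function.uncurry f)) (a b : ℝ) :
    ∫ s in a..b, ∫ σ in s..b, f s σ = ∫ σ in a..b, ∫ s in a..σ, f s σ := by
  rcases le_total a b with hab | hab
  · exact integral_triangle_swap_of_le hf hab
  · have h := integral_triangle_swap_of_le (f := fun s σ => f σ s) (hf.comp continuous_swap) hab
    rw [intervalIntegral.integral_symm b a, intervalIntegral.integral_symm b a, neg_inj]
    simp_rw [fun s => intervalIntegral.integral_symm (μ := volume) (f := f s) b s,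
      fun σ => intervalIntegral.integral_symm (μ := volume) (f := fun s => f s σ) σ a]
    rw [intervalIntegral.integral_neg, intervalIntegral.integral_neg, h]

theorem continuous_integral_both {Z : Type*} [TopologicalSpace Z] [FirstCountableTopology Z]
    [LocallyCompactSpace Z] {f : Z → ℝ → Y} (hf : Continuous (Function.uncurry f)) {a b : Z → ℝ}
    (ha : Continuous a) (hb : Continuous b) : Continuous fun z => ∫ s in (a z)..(b z), f z s := by
  have hi : ∀ z c d, IntervalIntegrable (f z) volume c d := fun z c d =>
    (hf.comp (Continuous.prodMk_right z)).intervalIntegrable c d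
  have h := (intervalIntegral.continuous_parametric_intervalIntegral_of_continuous
    (μ := volume) (a₀ := 0) hf hb).sub
    (intervalIntegral.continuous_parametric_intervalIntegral_of_continuous
    (μ := volume) (a₀ := 0) hf ha)
  refine h.congr fun z => ?_
  exact intervalIntegral.integral_interval_sub_left (hi z _ _) (hi z _ _)

theorem integral_exp_mul_le {l : ℝ} (hl : 0 < l) (t : ℝ) :
    ∫ s in (0 : ℝ)..t, Real.exp (l * s) ≤ l⁻¹ * Real.exp (l * t) := by
  rw [intervalIntegral.integral_comp_mul_left (fun x => Real.exp x) hl.ne', integral_exp]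
  simp only [mul_zero, Real.exp_zero, smul_eq_mul]
  have := inv_pos.2 hl
  nlinarith

/-- If `φ ≤ S w` always implies the improved bound `φ ≤ (a + S/2) w`, then `φ ≤ 2 a w`:
iterate, starting from any bound `φ ≤ N w`. -/
theorem le_of_improvable_bound {Z : Type*} {φ w : Z → ℝ} {s : Set Z} {a N : ℝ} (ha : 0 ≤ a)
    (hN : 0 ≤ N) (hw : ∀ z ∈ s, 0 ≤ w z) (hφ : ∀ z ∈ s, φ z ≤ N * w z)
    (h : ∀ S : ℝ, 0 ≤ S → (∀ z ∈ s, φ z ≤ S * w z) → ∀ z ∈ s, φ z ≤ (a + S / 2) * w z) :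
    ∀ z ∈ s, φ z ≤ 2 * a * w z := by
  have hn : ∀ n : ℕ, ∀ z ∈ s, φ z ≤ (2 * a + N / 2 ^ n) * w z := by
    intro n
    induction n with
    | zero =>
      intro z hz
      refine (hφ z hz).trans (mul_le_mul_of_nonneg_right ?_ (hw z hz))
      simp only [pow_zero, div_one]
      linarith
    | succ n ih =>
      intro z hz
      refine (h _ (by positivity) ih z hz).trans_eq ?_
      rw [pow_succ]
      ring
  intro z hz
  have hlim : Tendsto (fun n : ℕ => (2 * a + N / 2 ^ n) * w z) atTop (𝓝 ((2 * a + 0) * w z)) := by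
    refine ((tendsto_const_nhds).add ?_).mul_const _
    exact tendsto_const_nhds.div_atTop (tendsto_pow_atTop_atTop_of_one_lt one_lt_two)
  rw [add_zero] at hlim
  exact ge_of_tendsto' hlim fun n => hn n z hz

/-- A Gronwall inequality for a bounded function that need not be measurable: the integral
inequality is assumed only for continuous majorants of `φ`. -/
theorem gronwall_of_bounded {φ : ℝ → ℝ} {r a C N : ℝ} (ha : 0 ≤ a) (hC : 0 ≤ C)
    (hN : ∀ t ∈ Icc 0 r, φ t ≤ N)
    (h : ∀ ψ : ℝ → ℝ, Continuous ψ → (∀ s, 0 ≤ ψ s) → (∀ s ∈ Icc 0 r, φ s ≤ ψ s) →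
      ∀ t ∈ Icc 0 r, φ t ≤ a + C * ∫ s in (0 : ℝ)..t, ψ s) :
    ∀ t ∈ Icc 0 r, φ t ≤ 2 * a * Real.exp (2 * (C + 1) * t) := by
  have hl : 0 < 2 * (C + 1) := by positivity
  have h1 : ∀ t ∈ Icc 0 r, 1 ≤ Real.exp (2 * (C + 1) * t) := fun t ht =>
    Real.one_le_exp (mul_nonneg hl.le ht.1)
  refine le_of_improvable_bound (N := max N 0) ha (le_max_right _ _)
    (fun t _ => (Real.exp_pos _).le) (fun t ht => ?_) fun S hS hφ t ht => ?_
  · exact (hN t ht).trans ((le_max_left _ _).trans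
      (le_mul_of_one_le_right (le_max_right _ _) (h1 t ht)))
  · have h2 := h (fun t => S * Real.exp (2 * (C + 1) * t)) (by fun_prop)
      (fun s => by positivity) hφ t ht
    rw [intervalIntegral.integral_const_mul] at h2
    have h3 := integral_exp_mul_le hl t
    have h4 : C * (S * ∫ s in (0 : ℝ)..t, Real.exp (2 * (C + 1) * s)) ≤
        C * (S * ((2 * (C + 1))⁻¹ * Real.exp (2 * (C + 1) * t))) := by gcongr
    -- The rate `2 (C + 1)` of the weight is chosen so that integration gains the factor `1/2`.
    have h5 : C * (2 * (C + 1))⁻¹ ≤ 1 / 2 := by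
      rw [← div_eq_mul_inv, div_le_div_iff₀ hl two_pos]
      linarith
    have h6 : C * (S * ((2 * (C + 1))⁻¹ * Real.exp (2 * (C + 1) * t))) ≤
        1 / 2 * (S * Real.exp (2 * (C + 1) * t)) := by
      calc _ = (C * (2 * (C + 1))⁻¹) * (S * Real.exp (2 * (C + 1) * t)) := by ring
        _ ≤ _ := mul_le_mul_of_nonneg_right h5 (by positivity)
    nlinarith [mul_le_mul_of_nonneg_left (h1 t ht) ha]

end Integrals

/-! ### The perturbation series -/

section Series

open MeasureTheory

variable {D : Type*} [NormedAddCommGroup D] [NormedSpace ℝ D]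
  {U : ℝ → ℝ → D →L[ℝ] D} {F : ℝ → D →L[ℝ] D}

/-- In the norm weighted by `e^{l |q - t|}` each step of the recursion gains the factor `1/2`. -/
theorem norm_seriesTerm_le {K c l : ℝ} (hK : ∀ t s, ‖U t s‖ ≤ K) (hc : ∀ s, ‖F s‖ ≤ c)
    (hl0 : 0 < l) (hl : 2 * (K * c) ≤ l) (m : ℕ) (t q : ℝ) (g : D) :
    ‖seriesTerm U F m t q g‖ ≤ K * Real.exp (l * |q - t|) * (1 / 2) ^ m * ‖g‖ := by
  have hK0 : 0 ≤ K := (norm_nonneg _).trans (hK 0 0)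
  have hc0 : 0 ≤ c := (norm_nonneg _).trans (hc 0)
  induction m generalizing t with
  | zero =>
    simp only [seriesTerm, pow_zero, mul_one]
    refine ((U t q).le_of_opNorm_le (hK t q) g).trans ?_
    gcongr
    exact le_mul_of_one_le_right hK0 (Real.one_le_exp (by positivity))
  | succ m ih =>
    rw [seriesTerm]
    set b : ℝ := K * c * (K * (1 / 2) ^ m * ‖g‖) with hb
    have hb0 : 0 ≤ b := by positivity
    have hpt : ∀ s, ‖U t s (F s (seriesTerm U F m s q g))‖ ≤ b * Real.exp (l * |q - s|) := by
      intro s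
      refine ((U t s).le_of_opNorm_le (hK t s) _).trans ?_
      refine (mul_le_mul_of_nonneg_left (((F s).le_of_opNorm_le (hc s) _).trans
        (mul_le_mul_of_nonneg_left (ih s) hc0)) hK0).trans_eq ?_
      rw [hb]; ring
    have hexp : |∫ s in t..q, Real.exp (l * |q - s|)| ≤ l⁻¹ * Real.exp (l * |q - t|) := by
      rw [intervalIntegral.integral_comp_sub_left (fun x => Real.exp (l * |x|)) q, sub_self]
      rcases le_total t q with h | h
      · have e : ∫ x in (0 : ℝ)..q - t, Real.exp (l * |x|) =
            ∫ x in (0 : ℝ)..q - t, Real.exp (l * x) := by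
          refine intervalIntegral.integral_congr fun x hx => ?_
          rw [uIcc_of_le (sub_nonneg.2 h)] at hx
          simp only [abs_of_nonneg hx.1]
        rw [e, abs_of_nonneg (sub_nonneg.2 h), abs_of_nonneg]
        · exact integral_exp_mul_le hl0 _
        · exact intervalIntegral.integral_nonneg (sub_nonneg.2 h) fun _ _ => (Real.exp_pos _).le
      · have e : ∫ x in (0 : ℝ)..q - t, Real.exp (l * |x|) =
            -∫ x in (0 : ℝ)..t - q, Real.exp (l * x) := by
          rw [← intervalIntegral.integral_symm, show (0 : ℝ) = -0 from neg_zero.symm,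
            show q - t = -(t - q) by ring,
            ← intervalIntegral.integral_comp_neg (fun x => Real.exp (l * |x|))]
          simp only [neg_zero]
          refine intervalIntegral.integral_congr fun x hx => ?_
          rw [uIcc_of_ge (sub_nonneg.2 h)] at hx
          simp only [abs_neg, abs_of_nonneg hx.1]
        rw [e, abs_neg, abs_sub_comm, abs_of_nonneg (sub_nonneg.2 h), abs_of_nonneg]
        · exact integral_exp_mul_le hl0 _
        · exact intervalIntegral.integral_nonneg (sub_nonneg.2 h) fun _ _ => (Real.exp_pos _).le
    have h1 := intervalIntegral.norm_integral_le_abs_of_norm_le (μ := volume) (a := t) (b := q)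
      (f := fun s => U t s (F s (seriesTerm U F m s q g))) (Eventually.of_forall hpt)
      (Continuous.intervalIntegrable (by fun_prop) _ _)
    rw [intervalIntegral.integral_const_mul, abs_mul, abs_of_nonneg hb0] at h1
    have h2 : K * c * l⁻¹ ≤ 1 / 2 := by
      rw [← div_eq_mul_inv, div_le_div_iff₀ hl0 two_pos]
      linarith
    calc _ ≤ b * (l⁻¹ * Real.exp (l * |q - t|)) := h1.trans (mul_le_mul_of_nonneg_left hexp hb0)
      _ = (K * c * l⁻¹) * (K * Real.exp (l * |q - t|) * (1 / 2) ^ m * ‖g‖) := by rw [hb]; ring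
      _ ≤ (1 / 2) * (K * Real.exp (l * |q - t|) * (1 / 2) ^ m * ‖g‖) := by gcongr
      _ = _ := by rw [pow_succ]; ring

variable [CompleteSpace D]

theorem continuous_kernel_apply {Z : Type*} [TopologicalSpace Z] [FirstCountableTopology Z]
    (hU : ∀ f, Continuous fun p : ℝ × ℝ => U p.1 p.2 f) {a b : Z → ℝ} {v : Z → D}
    (ha : Continuous a) (hb : Continuous b) (hv : Continuous v) :
    Continuous fun z => U (a z) (b z) (v z) :=
  continuous_apply_of_strong (L := fun z => U (a z) (b z))
    (fun f => (hU f).comp (ha.prodMk hb)) hv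

theorem continuous_family_apply {Z : Type*} [TopologicalSpace Z] [FirstCountableTopology Z]
    {Y : Type*} [NormedAddCommGroup Y] [NormedSpace ℝ Y] {F : ℝ → D →L[ℝ] Y}
    (hF : ∀ f, Continuous fun s => F s f) {a : Z → ℝ} {v : Z → D}
    (ha : Continuous a) (hv : Continuous v) : Continuous fun z => F (a z) (v z) :=
  continuous_apply_of_strong (L := fun z => F (a z)) (fun f => (hF f).comp ha) hv

/-- The terms of the perturbation series are strongly continuous families of operators. -/
theorem exists_seriesTerm_operators (hU : ∀ f, Continuous fun p : ℝ × ℝ => U p.1 p.2 f)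
    (hF : ∀ f, Continuous fun s => F s f) :
    ∃ T : ℕ → ℝ → ℝ → D →L[ℝ] D, (∀ m t q g, T m t q g = seriesTerm U F m t q g) ∧
      ∀ m g, Continuous fun p : ℝ × ℝ => T m p.1 p.2 g := by
  have key : ∀ m : ℕ, ∃ T : ℝ → ℝ → D →L[ℝ] D, (∀ t q g, T t q g = seriesTerm U F m t q g) ∧
      ∀ g, Continuous fun p : ℝ × ℝ => T p.1 p.2 g := by
    intro m
    induction m with
    | zero => exact ⟨U, fun _ _ _ => rfl, hU⟩
    | succ m ih =>
      obtain ⟨T, hT, hTc⟩ := ih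
      have hex : ∀ t q, ∃ J : D →L[ℝ] D, ∀ x, J x = ∫ s in t..q, U t s (F s (T s q x)) :=
        fun t q => exists_strong_integral (L := fun s => U t s ∘L F s ∘L T s q)
          (fun x => continuous_kernel_apply hU continuous_const continuous_id
            (continuous_family_apply hF continuous_id
              (continuous_kernel_apply hTc continuous_id continuous_const continuous_const))) t q
      choose J hJ using hex
      refine ⟨J, fun t q g => ?_, fun g => ?_⟩
      · simp only [hJ, hT, seriesTerm]
      · simp only [hJ]
        refine continuous_integral_both (f := fun (p : ℝ × ℝ) s => U p.1 s (F s (T s p.2 g)))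
          ?_ continuous_fst continuous_snd
        exact continuous_kernel_apply hU (by fun_prop) (by fun_prop)
          (continuous_family_apply hF (by fun_prop)
            (continuous_kernel_apply hTc (by fun_prop) (by fun_prop) continuous_const))
  choose T hT hTc using key
  exact ⟨T, hT, hTc⟩

/-- The recursion for the terms of the perturbation series that peels off the last factor instead
of the first one. -/
theorem seriesTerm_succ_right (hU : ∀ f, Continuous fun p : ℝ × ℝ => U p.1 p.2 f)
    (hF : ∀ f, Continuous fun s => F s f) (m : ℕ) (t q : ℝ) (g : D) :
    seriesTerm U F (m + 1) t q g =
      ∫ σ in t..q, seriesTerm U F m t σ (F σ (U σ q g)) := by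
  obtain ⟨T, hT, hTc⟩ := exists_seriesTerm_operators hU hF
  induction m generalizing t q with
  | zero => rfl
  | succ m ih =>
    rw [seriesTerm]
    simp only [ih]
    simp only [← hT]
    have hc : Continuous (Function.uncurry fun s σ => U t s (F s (T m s σ (F σ (U σ q g))))) :=
      continuous_kernel_apply hU continuous_const continuous_fst
        (continuous_family_apply hF continuous_fst
          (continuous_kernel_apply (hTc m) continuous_fst continuous_snd
            (continuous_family_apply hF continuous_snd
              (continuous_kernel_apply hU continuous_snd continuous_const continuous_const))))
    have e1 : ∀ s, U t s (F s (∫ σ in s..q, T m s σ (F σ (U σ q g)))) =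
        ∫ σ in s..q, U t s (F s (T m s σ (F σ (U σ q g)))) := fun s =>
      ((U t s ∘L F s).intervalIntegral_comp_comm
        ((continuous_kernel_apply (hTc m) continuous_const continuous_id
          (continuous_family_apply hF continuous_id (continuous_kernel_apply hU continuous_id
            continuous_const continuous_const))).intervalIntegrable _ _)).symm
    simp only [e1]
    rw [integral_triangle_swap hc]
    simp only [hT, seriesTerm]

/-- The sum of the perturbation series is a strongly continuous family of operators, and it solves
the Volterra equation in which the perturbation acts last. -/
theorem exists_perturbed_propagator {K c : ℝ} (hK : ∀ t s, ‖U t s‖ ≤ K) (hc : ∀ s, ‖F s‖ ≤ c)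
    (hU : ∀ f, Continuous fun p : ℝ × ℝ => U p.1 p.2 f) (hF : ∀ f, Continuous fun s => F s f) :
    ∃ Φ : ℝ → ℝ → D →L[ℝ] D, (∀ f, Continuous fun p : ℝ × ℝ => Φ p.1 p.2 f) ∧
      (∀ t q g, Φ t q g = ∑' m, seriesTerm U F m t q g) ∧
      ∀ t q g, Φ t q g = U t q g + ∫ σ in t..q, Φ t σ (F σ (U σ q g)) := by
  obtain ⟨T, hT, hTc⟩ := exists_seriesTerm_operators hU hF
  have hK0 : 0 ≤ K := (norm_nonneg _).trans (hK 0 0)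
  have hc0 : 0 ≤ c := (norm_nonneg _).trans (hc 0)
  set l : ℝ := 2 * (K * c) + 1
  have hl0 : 0 < l := by positivity
  have hgeo : Summable fun m : ℕ => (1 / 2 : ℝ) ^ m := summable_geometric_two
  have hbd : ∀ m t q g, ‖T m t q g‖ ≤ K * Real.exp (l * |q - t|) * (1 / 2) ^ m * ‖g‖ :=
    fun m t q g => by
      rw [hT]; exact norm_seriesTerm_le hK hc hl0 (by simp [l]) m t q g
  have hsum : ∀ R g, Summable fun m : ℕ => K * Real.exp (l * R) * (1 / 2) ^ m * ‖g‖ :=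
    fun R g => (hgeo.mul_left _).mul_right (‖(g : D)‖)
  have hTs : ∀ t q g, Summable fun m => T m t q g := fun t q g =>
    Summable.of_norm_bounded (hsum _ g) (hbd · t q g)
  have hex : ∀ t q, ∃ J : D →L[ℝ] D, ∀ g, J g = ∑' m, T m t q g := by
    intro t q
    refine ⟨LinearMap.mkContinuous
      { toFun := fun g => ∑' m, T m t q g
        map_add' := fun x y => ?_
        map_smul' := fun a x => ?_ } (∑' m : ℕ, K * Real.exp (l * |q - t|) * (1 / 2) ^ m)
      fun g => ?_, fun g => rfl⟩
    · simp only [map_add]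
      exact (hTs t q x).tsum_add (hTs t q y)
    · simp only [map_smul, RingHom.id_apply]
      exact tsum_const_smul'' a
    · rw [← tsum_mul_right]
      exact tsum_of_norm_bounded (hsum _ g).hasSum (hbd · t q g)
  choose Φ hΦ using hex
  have hΦc : ∀ g, Continuous fun p : ℝ × ℝ => Φ p.1 p.2 g := by
    intro g
    simp only [hΦ]
    rw [continuous_iff_continuousAt]
    intro p
    set R := |p.2 - p.1| + 1
    have hop : IsOpen {x : ℝ × ℝ | |x.2 - x.1| < R} :=
      isOpen_lt (by fun_prop) continuous_const
    refine (continuousOn_tsum (fun m => (hTc m g).continuousOn) (hsum R g) ?_).continuousAt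
      (hop.mem_nhds (by simp [R]))
    intro m x hx
    refine (hbd m x.1 x.2 g).trans ?_
    have : |x.2 - x.1| ≤ R := (show |x.2 - x.1| < R from hx).le
    gcongr
  refine ⟨Φ, hΦc, fun t q g => by simp only [hΦ, hT], fun t q g => ?_⟩
  have hy : Continuous fun σ => F σ (U σ q g) :=
    continuous_family_apply hF continuous_id
      (continuous_kernel_apply hU continuous_id continuous_const continuous_const)
  obtain ⟨C, hC⟩ := (isCompact_uIcc (a := t) (b := q)).exists_bound_of_continuousOn hy.continuousOn
  have hint : HasSum (fun m => ∫ σ in t..q, T m t σ (F σ (U σ q g)))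
      (∫ σ in t..q, Φ t σ (F σ (U σ q g))) := by
    refine intervalIntegral.hasSum_integral_of_dominated_convergence
      (fun m _ => K * Real.exp (l * |q - t|) * (1 / 2) ^ m * C) (fun m => ?_)
      (fun m => ?_) ?_ ?_ ?_
    · exact (continuous_kernel_apply (hTc m) continuous_const continuous_id
        hy).aestronglyMeasurable
    · refine Eventually.of_forall fun σ hσ => (hbd m t σ _).trans ?_
      have hσ' := uIoc_subset_uIcc hσ
      have h1 : |σ - t| ≤ |q - t| := abs_sub_left_of_mem_uIcc hσ'
      gcongr
      exact hC σ hσ'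
    · exact Eventually.of_forall fun σ _ => (hgeo.mul_left _).mul_right C
    · exact intervalIntegrable_const
    · refine Eventually.of_forall fun σ _ => ?_
      rw [hΦ]
      exact (hTs _ _ _).hasSum
  rw [← hint.tsum_eq, hΦ, (hTs t q g).tsum_eq_zero_add]
  simp only [hT, seriesTerm_succ_right hU hF]
  rfl

end Series

/-! ### The mild equation in the dual space -/

section Mild

variable {D : Type*} [NormedAddCommGroup D] [NormedSpace ℝ D] [CompleteSpace D]
  {U Φ : ℝ → ℝ → D →L[ℝ] D} {F : ℝ → D →L[ℝ] D}

/-- The functionals given by the variation-of-constants formula with the perturbed propagator `Φ`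
solve the mild equation, in which only the unperturbed propagator `U` occurs. -/
theorem exists_mild_solution (hU : ∀ f, Continuous fun p : ℝ × ℝ => U p.1 p.2 f)
    (hF : ∀ f, Continuous fun s => F s f) (hΦ : ∀ f, Continuous fun p : ℝ × ℝ => Φ p.1 p.2 f)
    (hV : ∀ t q g, Φ t q g = U t q g + ∫ σ in t..q, Φ t σ (F σ (U σ q g)))
    (x₀ : StrongDual ℝ D) {e : ℝ → StrongDual ℝ D} (he : ∀ f, Continuous fun s => e s f) :
    ∃ Y : ℝ → StrongDual ℝ D, (∀ f, Continuous fun t => Y t f) ∧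
      (∀ t f, Y t f = x₀ (Φ 0 t f) + ∫ s in (0 : ℝ)..t, e s (Φ s t f)) ∧
      ∀ t f, Y t f = x₀ (U 0 t f) + ∫ s in (0 : ℝ)..t, (Y s (F s (U s t f)) + e s (U s t f)) := by
  have hex : ∀ t, ∃ J : StrongDual ℝ D, ∀ f, J f = ∫ s in (0 : ℝ)..t, e s (Φ s t f) := fun t =>
    exists_strong_integral (L := fun s => e s ∘L Φ s t) (fun f =>
      continuous_family_apply he continuous_id
        (continuous_kernel_apply hΦ continuous_id continuous_const continuous_const)) 0 t
  choose J hJ using hex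
  have hYc : ∀ f, Continuous fun t => (x₀ ∘L Φ 0 t + J t) f := by
    intro f
    simp only [add_apply, ContinuousLinearMap.comp_apply, hJ]
    refine (x₀.continuous.comp (continuous_kernel_apply hΦ continuous_const continuous_id
      continuous_const)).add ?_
    exact continuous_integral_both (f := fun t s => e s (Φ s t f))
      (continuous_family_apply he continuous_snd
        (continuous_kernel_apply hΦ continuous_snd continuous_fst continuous_const))
      continuous_const continuous_id
  refine ⟨fun t => x₀ ∘L Φ 0 t + J t, hYc, fun t f => by simp [hJ], fun t f => ?_⟩
  have hUt : Continuous fun s => U s t f :=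
    continuous_kernel_apply hU continuous_id continuous_const continuous_const
  have hy : Continuous fun s => F s (U s t f) := continuous_family_apply hF continuous_id hUt
  have hΦy : ∀ s, Continuous fun σ => Φ s σ (F σ (U σ t f)) := fun s =>
    continuous_kernel_apply hΦ continuous_const continuous_id hy
  have hin : Continuous (Function.uncurry fun s σ => e s (Φ s σ (F σ (U σ t f)))) :=
    continuous_family_apply he continuous_fst
      (continuous_kernel_apply hΦ continuous_fst continuous_snd (hy.comp continuous_snd))
  have h1 : x₀ (Φ 0 t f) = x₀ (U 0 t f) +
      ∫ s in (0 : ℝ)..t, x₀ (Φ 0 s (F s (U s t f))) := by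
    rw [hV, map_add, ← x₀.intervalIntegral_comp_comm ((hΦy 0).intervalIntegrable _ _)]
  have h2 : ∀ s, e s (Φ s t f) = e s (U s t f) + ∫ σ in s..t, e s (Φ s σ (F σ (U σ t f))) := by
    intro s
    rw [hV, map_add, ← (e s).intervalIntegral_comp_comm ((hΦy s).intervalIntegrable _ _)]
  have heU : Continuous fun s => e s (U s t f) := continuous_family_apply he continuous_id hUt
  have h3 : ∫ s in (0 : ℝ)..t, e s (Φ s t f) = (∫ s in (0 : ℝ)..t, e s (U s t f)) +
      ∫ σ in (0 : ℝ)..t, ∫ s in (0 : ℝ)..σ, e s (Φ s σ (F σ (U σ t f))) := by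
    rw [← integral_triangle_swap hin]
    simp only [h2]
    exact intervalIntegral.integral_add (heU.intervalIntegrable _ _)
      ((continuous_integral_both (f := fun s σ => e s (Φ s σ (F σ (U σ t f)))) hin continuous_id
        continuous_const).intervalIntegrable _ _)
  simp only [add_apply, ContinuousLinearMap.comp_apply, hJ]
  rw [h1, h3, intervalIntegral.integral_add, intervalIntegral.integral_add]
  · ring
  · exact (x₀.continuous.comp (hΦy 0)).intervalIntegrable _ _
  · exact (continuous_integral_both (f := fun σ s => e s (Φ s σ (F σ (U σ t f))))
      (hin.comp continuous_swap) continuous_const continuous_id).intervalIntegrable _ _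
  · refine ((x₀.continuous.comp (hΦy 0)).add ?_).intervalIntegrable _ _
    exact continuous_integral_both (f := fun σ s => e s (Φ s σ (F σ (U σ t f))))
      (hin.comp continuous_swap) continuous_const continuous_id
  · exact heU.intervalIntegrable _ _

/-- The difference of two mild solutions satisfies `d_t(f) = ∫_0^t d_s(F_s U^{s,t} f) ds`, so that
Gronwall's inequality applies to `‖d_t‖`. -/
theorem mild_solution_unique {K c r : ℝ} (hK : ∀ t s, ‖U t s‖ ≤ K) (hc : ∀ s, ‖F s‖ ≤ c)
    (hU : ∀ f, Continuous fun p : ℝ × ℝ => U p.1 p.2 f) (hF : ∀ f, Continuous fun s => F s f)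
    {x₀ : StrongDual ℝ D} {e θ θ' : ℝ → StrongDual ℝ D} (he : ∀ f, Continuous fun s => e s f)
    (hθc : ∀ f, ContinuousOn (fun t => θ t f) (Icc 0 r))
    (hθc' : ∀ f, ContinuousOn (fun t => θ' t f) (Icc 0 r))
    (hθ : ∀ t ∈ Icc 0 r, ∀ f, θ t f =
      x₀ (U 0 t f) + ∫ s in (0 : ℝ)..t, (θ s (F s (U s t f)) + e s (U s t f)))
    (hθ' : ∀ t ∈ Icc 0 r, ∀ f, θ' t f =
      x₀ (U 0 t f) + ∫ s in (0 : ℝ)..t, (θ' s (F s (U s t f)) + e s (U s t f))) :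
    EqOn θ θ' (Icc 0 r) := by
  have hK0 : 0 ≤ K := (norm_nonneg _).trans (hK 0 0)
  have hc0 : 0 ≤ c := (norm_nonneg _).trans (hc 0)
  have hdc : ∀ f, ContinuousOn (fun t => (θ t - θ' t) f) (Icc 0 r) := fun f =>
    (hθc f).sub (hθc' f)
  obtain ⟨N, -, hN⟩ := exists_norm_le_of_strong isCompact_Icc hdc
  have hd : ∀ t ∈ Icc 0 r, ∀ f, (θ t - θ' t) f =
      ∫ s in (0 : ℝ)..t, (θ s - θ' s) (F s (U s t f)) := by
    intro t ht f
    have hUt : Continuous fun s => U s t f :=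
      continuous_kernel_apply hU continuous_id continuous_const continuous_const
    have hy : Continuous fun s => F s (U s t f) := continuous_family_apply hF continuous_id hUt
    have heU : Continuous fun s => e s (U s t f) := continuous_family_apply he continuous_id hUt
    have hsub : uIcc 0 t ⊆ Icc 0 r := by
      rw [uIcc_of_le ht.1]; exact Icc_subset_Icc_right ht.2
    have hi : ∀ {η : ℝ → StrongDual ℝ D}, (∀ f, ContinuousOn (fun t => η t f) (Icc 0 r)) →
        IntervalIntegrable (fun s => η s (F s (U s t f)) + e s (U s t f)) MeasureTheory.volume 0 t :=
      fun h => (((continuousOn_apply_of_strong h hy.continuousOn).mono hsub).add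
        heU.continuousOn).intervalIntegrable
    rw [sub_apply, hθ t ht f, hθ' t ht f, add_sub_add_left_eq_sub,
      ← intervalIntegral.integral_sub (hi hθc) (hi hθc')]
    refine intervalIntegral.integral_congr fun s _ => ?_
    simp
  intro t ht
  have h := gronwall_of_bounded (φ := fun t => ‖θ t - θ' t‖) (a := 0) (C := c * K) le_rfl
    (by positivity) hN (fun ψ hψ hψ0 hle t ht => ?_) t ht
  · rw [mul_zero, zero_mul] at h
    exact sub_eq_zero.1 (norm_le_zero_iff.1 h)
  · rw [zero_add]
    refine ContinuousLinearMap.opNorm_le_bound _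
      (mul_nonneg (by positivity) (intervalIntegral.integral_nonneg ht.1 fun s _ => hψ0 s))
      fun f => ?_
    rw [hd t ht f]
    have hb : ∀ s ∈ Ioc 0 t, ‖(θ s - θ' s) (F s (U s t f))‖ ≤ ψ s * (c * K * ‖f‖) := by
      intro s hs
      refine ((θ s - θ' s).le_of_opNorm_le (hle s ⟨hs.1.le, hs.2.trans ht.2⟩) _).trans ?_
      refine mul_le_mul_of_nonneg_left ?_ (hψ0 s)
      refine ((F s).le_of_opNorm_le (hc s) _).trans ?_
      rw [mul_assoc]
      exact mul_le_mul_of_nonneg_left ((U s t).le_of_opNorm_le (hK s t) f) hc0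
    refine (intervalIntegral.norm_integral_le_of_norm_le ht.1
      (Eventually.of_forall fun s hs => hb s hs)
      (Continuous.intervalIntegrable (by fun_prop) _ _)).trans_eq ?_
    rw [intervalIntegral.integral_mul_const]
    ring

end Mild

/-! ### Restriction of functionals, and curves of states -/

section Basics

theorem tendsto_apply_of_dense {X Y V ι : Type*} [NormedAddCommGroup X] [NormedSpace ℝ X]
    [NormedAddCommGroup Y] [NormedSpace ℝ Y] {l : Filter ι} {L : ι → X →L[ℝ] Y} {L₀ : X →L[ℝ] Y}
    {C : ℝ} {j : V → X} (hj : DenseRange j) (hC : ∀ᶠ i in l, ‖L i‖ ≤ C)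
    (h : ∀ v, Tendsto (fun i => L i (j v)) l (𝓝 (L₀ (j v)))) (x : X) :
    Tendsto (fun i => L i x) l (𝓝 (L₀ x)) := by
  rw [Metric.tendsto_nhds]
  intro ε hε
  set c := max C 0 + ‖L₀‖ + 1
  have hc : 0 < c := by positivity
  obtain ⟨v, hv⟩ := hj.exists_dist_lt x (show 0 < ε / (2 * c) by positivity)
  filter_upwards [hC, Metric.tendsto_nhds.1 (h v) (ε / 2) (by positivity)] with i hi hiv
  rw [dist_eq_norm] at *
  have e : L i x - L₀ x = L i (x - j v) - L₀ (x - j v) + (L i (j v) - L₀ (j v)) := by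
    simp only [map_sub]; abel
  have h1 : ‖L i (x - j v)‖ ≤ max C 0 * ‖x - j v‖ :=
    (L i).le_of_opNorm_le (hi.trans (le_max_left _ _)) _
  have h2 : ‖L₀ (x - j v)‖ ≤ ‖L₀‖ * ‖x - j v‖ := L₀.le_opNorm _
  have h3 : c * ‖x - j v‖ < ε / 2 := by
    rw [lt_div_iff₀ (by positivity)] at hv
    nlinarith
  have h4 : (max C 0 + ‖L₀‖) * ‖x - j v‖ ≤ c * ‖x - j v‖ :=
    mul_le_mul_of_nonneg_right (by simp [c]) (norm_nonneg _)
  rw [e]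
  calc _ ≤ ‖L i (x - j v)‖ + ‖L₀ (x - j v)‖ + ‖L i (j v) - L₀ (j v)‖ :=
        (norm_add_le _ _).trans (add_le_add_left (norm_sub_le _ _) _)
    _ < ε := by linarith

theorem continuousOn_apply_of_dense {X Y V Z : Type*} [NormedAddCommGroup X] [NormedSpace ℝ X]
    [NormedAddCommGroup Y] [NormedSpace ℝ Y] [TopologicalSpace Z] {s : Set Z} {L : Z → X →L[ℝ] Y}
    {C : ℝ} {j : V → X} (hj : DenseRange j) (hC : ∀ z ∈ s, ‖L z‖ ≤ C)
    (h : ∀ v, ContinuousOn (fun z => L z (j v)) s) (x : X) : ContinuousOn (fun z => L z x) s :=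
  fun z hz => tendsto_apply_of_dense hj (eventually_mem_nhdsWithin.mono hC) (fun v => h v z hz) x

variable {B D E : Type*} [NormedAddCommGroup B] [NormedSpace ℝ B]
  [NormedAddCommGroup D] [NormedSpace ℝ D] [NormedAddCommGroup E] [NormedSpace ℝ E]
  {S : BanachTriple B D E} {r : ℝ} {M : Set (StrongDual ℝ B)} {G : Model B D E}

namespace BanachTriple

theorem toD_apply (S : BanachTriple B D E) (μ : StrongDual ℝ B) (f : D) :
    S.toD μ f = μ (S.ι f) := rfl

theorem toD_sub (S : BanachTriple B D E) (μ η : StrongDual ℝ B) :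
    S.toD (μ - η) = S.toD μ - S.toD η := rfl

theorem toD_add (S : BanachTriple B D E) (μ η : StrongDual ℝ B) :
    S.toD (μ + η) = S.toD μ + S.toD η := rfl

theorem toD_smul (S : BanachTriple B D E) (a : ℝ) (μ : StrongDual ℝ B) :
    S.toD (a • μ) = a • S.toD μ := rfl

theorem toD_injective (S : BanachTriple B D E) : Function.Injective S.toD := by
  intro μ η h
  ext b
  have := S.ι_dense.equalizer μ.continuous η.continuous
    (funext fun f => DFunLike.congr_fun h f)
  exact congrFun this b

theorem norm_toD_le_of_forall (S : BanachTriple B D E) {μ : StrongDual ℝ B} {c : ℝ} (hc : 0 ≤ c)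
    (h : ∀ f, ‖μ (S.ι f)‖ ≤ c * ‖f‖) : ‖S.toD μ‖ ≤ c :=
  ContinuousLinearMap.opNorm_le_bound _ hc h

theorem opNorm_comp_κ_le (S : BanachTriple B D E) {T : D →L[ℝ] B} {C : ℝ} (hC : 0 ≤ C)
    (h : S.RestrictsWithBound T C) : ‖T ∘L S.κ‖ ≤ C :=
  ContinuousLinearMap.opNorm_le_bound _ hC fun g => by
    obtain ⟨x, hx, hxC⟩ := h g
    rw [ContinuousLinearMap.comp_apply, ← hx]
    exact (S.norm_ι_le x).trans hxC

/-- A curve of states, continuous in the norm of `D⋆`, is weakly-⋆ continuous in `B⋆`, since `M` is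
bounded and `D` is dense in `B`. -/
theorem IsCurve.continuousOn_apply (hM : S.IsStateSpace M) {ξ : ℝ → StrongDual ℝ B}
    (hξ : S.IsCurve r M ξ) (b : B) : ContinuousOn (fun s => ξ s b) (Icc 0 r) := by
  obtain ⟨R, hR⟩ := hM.bounded.exists_norm_le
  exact continuousOn_apply_of_dense S.ι_dense (fun s hs => hR _ (hξ.1 s hs))
    (fun f => hξ.2.clm_apply (continuousOn_const (c := f))) b

end BanachTriple

namespace Model.Admissible

theorem exists_lipschitz_A (hG : G.Admissible S r M) : ∃ c : ℝ, 0 ≤ c ∧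
    ∀ μ η : StrongDual ℝ B, ‖G.A (S.toD μ) - G.A (S.toD η)‖ ≤ c * ‖S.toD μ - S.toD η‖ ∧
      S.RestrictsWithBound (G.A (S.toD μ) - G.A (S.toD η)) (c * ‖S.toD μ - S.toD η‖) := by
  obtain ⟨c, hc⟩ := hG.lipschitz_A
  have hle : ∀ μ η : StrongDual ℝ B, c * ‖S.toD μ - S.toD η‖ ≤ |c| * ‖S.toD μ - S.toD η‖ :=
    fun μ η => mul_le_mul_of_nonneg_right (le_abs_self c) (norm_nonneg _)
  refine ⟨|c|, abs_nonneg c, fun μ η => ⟨(hc μ η).1.trans (hle μ η), fun g => ?_⟩⟩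
  obtain ⟨h, h1, h2⟩ := (hc μ η).2 g
  exact ⟨h, h1, h2.trans (mul_le_mul_of_nonneg_right (hle μ η) (norm_nonneg _))⟩

theorem continuousOn_A (hG : G.Admissible S r M) {ξ : ℝ → StrongDual ℝ B} {s : Set ℝ}
    (hξ : ContinuousOn (fun s => S.toD (ξ s)) s) :
    ContinuousOn (fun s => G.A (S.toD (ξ s))) s := by
  obtain ⟨c, -, hc⟩ := hG.exists_lipschitz_A
  intro x hx
  have h1 := (tendsto_iff_norm_sub_tendsto_zero.1 (hξ x hx)).const_mul c
  rw [mul_zero] at h1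
  exact tendsto_iff_norm_sub_tendsto_zero.2
    (squeeze_zero (fun _ => norm_nonneg _) (fun s => (hc _ _).1) h1)

end Model.Admissible

/-- A bounded curve of functionals whose values on `D` have the derivatives `(L_t f, m_t)` with
bounded `L_t : D → B` is continuous in the norm of `D⋆`. -/
theorem continuousOn_toD_of_hasDerivWithinAt {m : ℝ → StrongDual ℝ B} {L : ℝ → D →L[ℝ] B}
    {R c : ℝ} {s : Set ℝ} (hs : Convex ℝ s) (hR0 : 0 ≤ R) (hc0 : 0 ≤ c)
    (hR : ∀ t ∈ s, ‖m t‖ ≤ R) (hc : ∀ t ∈ s, ‖L t‖ ≤ c)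
    (hd : ∀ f, ∀ t ∈ s, HasDerivWithinAt (fun t => m t (S.ι f)) (m t (L t f)) s t) :
    ContinuousOn (fun t => S.toD (m t)) s := by
  have hlip : ∀ x ∈ s, ∀ y ∈ s, ‖S.toD (m y) - S.toD (m x)‖ ≤ R * c * ‖y - x‖ := by
    intro x hx y hy
    rw [← S.toD_sub]
    refine S.norm_toD_le_of_forall (by positivity) fun f => ?_
    have := hs.norm_image_sub_le_of_norm_hasDerivWithin_le (C := R * (c * ‖f‖)) (hd f)
      (fun t ht => (m t).le_of_opNorm_le_of_le (hR t ht) ((L t).le_of_opNorm_le (hc t ht) f)) hx hy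
    rw [sub_apply]
    refine this.trans_eq ?_
    ring
  have hlw : LipschitzOnWith (R * c).toNNReal (fun t => S.toD (m t)) s := by
    refine LipschitzOnWith.of_dist_le_mul fun x hx y hy => ?_
    rw [dist_eq_norm, dist_eq_norm, Real.coe_toNNReal _ (by positivity)]
    exact hlip y hy x hx
  exact hlw.continuousOn

end Basics

/-! ### Well-posedness of the nonlinear equation -/

section Nonlinear

variable {B D E : Type*} [NormedAddCommGroup B] [NormedSpace ℝ B]
  [NormedAddCommGroup D] [NormedSpace ℝ D]
  [NormedAddCommGroup E] [NormedSpace ℝ E]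
  {S : BanachTriple B D E} {r : ℝ} {M : Set (StrongDual ℝ B)} {G : Model B D E}

theorem IsBackwardPropagator.continuousOn_left {X : Type*} [NormedAddCommGroup X] [NormedSpace ℝ X]
    {U : ℝ → ℝ → X →L[ℝ] X} (h : IsBackwardPropagator r U) {t : ℝ} (ht : t ∈ Icc 0 r) (f : X) :
    ContinuousOn (fun s => U s t f) (Icc 0 t) :=
  (h.continuous f).comp (Continuous.prodMk_left t).continuousOn fun _ hs => ⟨hs.1, hs.2, ht.2⟩

/-- `m` is an `M`-valued solution of the linear equation `d/dt (f, m_t) = (A[η_t] f, m_t)`. -/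
def Model.IsLinearSolution (G : Model B D E) (S : BanachTriple B D E) (r : ℝ)
    (M : Set (StrongDual ℝ B)) (η : ℝ → StrongDual ℝ B) (ν : StrongDual ℝ B)
    (m : ℝ → StrongDual ℝ B) : Prop :=
  (∀ t ∈ Icc 0 r, m t ∈ M) ∧ m 0 = ν ∧
  ∀ f : D, ∀ t ∈ Icc 0 r,
    HasDerivWithinAt (fun s => m s (S.ι f)) (m t (G.A (S.toD (η t)) f)) (Icc 0 r) t

theorem Model.IsLinearSolution.isCurve (hG : G.Admissible S r M) (hM : S.IsStateSpace M)
    {η : ℝ → StrongDual ℝ B} {ν : StrongDual ℝ B} {m : ℝ → StrongDual ℝ B}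
    (hη : ∀ t ∈ Icc 0 r, η t ∈ M) (hm : G.IsLinearSolution S r M η ν m) : S.IsCurve r M m := by
  obtain ⟨R, hR⟩ := hM.bounded.exists_norm_le
  obtain ⟨c, hc⟩ := hG.bounded_A
  exact ⟨hm.1, continuousOn_toD_of_hasDerivWithinAt (R := max R 0) (c := max c 0)
    (convex_Icc 0 r) (le_max_right _ _)
    (le_max_right _ _) (fun t ht => (hR _ (hm.1 t ht)).trans (le_max_left _ _))
    (fun t ht => ((hc _ (hη t ht)).1).trans (le_max_left _ _)) hm.2.2⟩

theorem Model.IsNonlinearSolution.isCurve (hG : G.Admissible S r M) (hM : S.IsStateSpace M)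
    {ν : StrongDual ℝ B} {m : ℝ → StrongDual ℝ B}
    (hm : G.IsNonlinearSolution S r M ν m) : S.IsCurve r M m :=
  Model.IsLinearSolution.isCurve (η := m) hG hM hm.1 hm

/-- The dual propagator along the curve `η` solves the linear equation. -/
theorem isLinearSolution_comp (hG : G.Admissible S r M) {η : ℝ → StrongDual ℝ B}
    (hη : S.IsCurve r M η) (hr : 0 ≤ r) {ν : StrongDual ℝ B} (hν : ν ∈ M) :
    G.IsLinearSolution S r M η ν (fun t => ν.comp (G.UB η 0 t)) := by
  refine ⟨fun t ht => hG.preserves η hη 0 t le_rfl ht.1 ht.2 ν hν, ?_, fun f t ht => ?_⟩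
  · simp only [(hG.propagator_B η hη).refl 0 ⟨le_rfl, hr⟩]
    rfl
  · exact ν.hasFDerivAt.comp_hasDerivWithinAt t (hG.generates_right η hη f 0 t le_rfl ht.1 ht.2)

variable [CompleteSpace B]

/-- Duhamel's formula: a curve `m` in `B⋆` that evolves by generators `L_t` is compared with the
propagator along the curve `ξ`. -/
theorem duhamel (hG : G.Admissible S r M) {ξ : ℝ → StrongDual ℝ B}
    (hξ : S.IsCurve r M ξ) {t : ℝ} (ht : t ∈ Icc 0 r) {m : ℝ → StrongDual ℝ B}
    {L : ℝ → D →L[ℝ] B} (hm : ∀ b, ContinuousOn (fun s => m s b) (Icc 0 r))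
    (hL : ContinuousOn L (Icc 0 r))
    (hd : ∀ f, ∀ s ∈ Icc 0 r, HasDerivWithinAt (fun s => m s (S.ι f)) (m s (L s f)) (Icc 0 r) s)
    (f : D) :
    m t (S.ι f) = m 0 (S.ι (G.UD ξ 0 t f)) +
      ∫ s in (0 : ℝ)..t, m s ((L s - G.A (S.toD (ξ s))) (G.UD ξ s t f)) := by
  have hsub : Icc 0 t ⊆ Icc 0 r := Icc_subset_Icc_right ht.2
  have hder : ∀ s ∈ Icc 0 t, HasDerivWithinAt (fun s => m s (G.UB ξ s t (S.ι f)))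
      (m s ((L s - G.A (S.toD (ξ s))) (G.UD ξ s t f))) (Icc 0 t) s := by
    intro s hs
    have h1 := hasDerivWithinAt_apply_of_strong (m := m) (u := fun s => G.UB ξ s t (S.ι f))
      (a := m s (L s (G.UD ξ s t f))) (fun b => (hm b).mono hsub s hs) ?_
      (hG.generates_left ξ hξ f s t hs.1 hs.2 ht.2)
    · rw [← map_add, ← sub_eq_add_neg] at h1
      exact h1
    · simp only [← hG.restrict_D ξ hξ s t hs.1 hs.2 ht.2 f]
      exact (hd _ s (hsub hs)).mono hsub
  have hcont : ContinuousOn (fun s => m s ((L s - G.A (S.toD (ξ s))) (G.UD ξ s t f)))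
      (Icc 0 t) :=
    continuousOn_apply_of_strong (fun b => (hm b).mono hsub)
      (((hL.sub (hG.continuousOn_A hξ.2)).mono hsub).clm_apply
        ((hG.propagator_D ξ hξ).continuousOn_left ht f))
  have := intervalIntegral.integral_eq_sub_of_hasDerivAt_of_le ht.1
    (HasDerivWithinAt.continuousOn hder)
    (fun s hs => (hder s (Ioo_subset_Icc_self hs)).hasDerivAt (Icc_mem_nhds hs.1 hs.2))
    (hcont.intervalIntegrable_of_Icc ht.1)
  rw [this, hG.restrict_D ξ hξ 0 t le_rfl ht.1 ht.2, (hG.propagator_B ξ hξ).refl t ht]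
  simp

/-- Stability of the linear equation with respect to the curve along which the generators are
taken. The distance of the curves enters through a continuous majorant `ψ`. -/
theorem exists_linear_stability (hG : G.Admissible S r M) (hM : S.IsStateSpace M) :
    ∃ C : ℝ, 0 ≤ C ∧ ∀ η η' m m' : ℝ → StrongDual ℝ B, ∀ ν, S.IsCurve r M η → S.IsCurve r M η' →
      G.IsLinearSolution S r M η ν m → G.IsLinearSolution S r M η' ν m' →
      ∀ ψ : ℝ → ℝ, Continuous ψ → (∀ s, 0 ≤ ψ s) →
      (∀ s ∈ Icc 0 r, ‖S.toD (η' s) - S.toD (η s)‖ ≤ ψ s) →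
      ∀ t ∈ Icc 0 r, ‖S.toD (m' t) - S.toD (m t)‖ ≤ C * ∫ s in (0 : ℝ)..t, ψ s := by
  obtain ⟨R, hR⟩ := hM.bounded.exists_norm_le
  obtain ⟨c, hc0, hc⟩ := hG.exists_lipschitz_A
  obtain ⟨K, hK⟩ := hG.bounded_U
  refine ⟨max R 0 * c * max K 0, by positivity, ?_⟩
  intro η η' m m' ν hη hη' hm hm' ψ hψ hψ0 hle t ht
  have h1 : ∀ f, m t (S.ι f) = m 0 (S.ι (G.UD η 0 t f)) := fun f => by
    rw [duhamel hG hη ht ((hm.isCurve hG hM hη.1).continuousOn_apply hM) (hG.continuousOn_A hη.2)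
      hm.2.2 f]
    simp
  have h2 := duhamel hG hη ht ((hm'.isCurve hG hM hη'.1).continuousOn_apply hM)
    (hG.continuousOn_A hη'.2) hm'.2.2
  rw [← S.toD_sub]
  refine S.norm_toD_le_of_forall (mul_nonneg (by positivity)
    (intervalIntegral.integral_nonneg ht.1 fun s _ => hψ0 s)) fun f => ?_
  rw [sub_apply, h1, h2, hm.2.1, hm'.2.1, add_sub_cancel_left]
  have hb : ∀ s ∈ Ioc 0 t, ‖m' s ((G.A (S.toD (η' s)) - G.A (S.toD (η s))) (G.UD η s t f))‖ ≤
      ψ s * (max R 0 * c * max K 0 * ‖f‖) := by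
    intro s hs
    have hs' : s ∈ Icc 0 r := ⟨hs.1.le, hs.2.trans ht.2⟩
    have e1 := (G.UD η s t).le_of_opNorm_le
      (((hK η hη s t hs.1.le hs.2 ht.2).2).trans (le_max_left K 0)) f
    have e2 := ((hc (η' s) (η s)).1).trans (mul_le_mul_of_nonneg_left (hle s hs') hc0)
    refine ((m' s).le_of_opNorm_le_of_le ((hR _ (hm'.1 s hs')).trans (le_max_left R 0))
      (ContinuousLinearMap.le_of_opNorm_le_of_le _ e2 e1)).trans_eq ?_
    ring
  refine (intervalIntegral.norm_integral_le_of_norm_le ht.1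
      (Eventually.of_forall fun s hs => hb s hs)
      (Continuous.intervalIntegrable (by fun_prop) _ _)).trans_eq ?_
  rw [intervalIntegral.integral_mul_const]
  ring

theorem nonlinear_solution_unique (hG : G.Admissible S r M) (hM : S.IsStateSpace M)
    {ν : StrongDual ℝ B} {m m' : ℝ → StrongDual ℝ B}
    (hm : G.IsNonlinearSolution S r M ν m) (hm' : G.IsNonlinearSolution S r M ν m') :
    EqOn m m' (Icc 0 r) := by
  obtain ⟨C, hC0, hC⟩ := exists_linear_stability hG hM
  have hcm := hm.isCurve hG hM
  have hcm' := hm'.isCurve hG hM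
  obtain ⟨N, hN⟩ := isCompact_Icc.exists_bound_of_continuousOn (hcm.2.sub hcm'.2)
  intro t ht
  have h := gronwall_of_bounded (φ := fun t => ‖S.toD (m t) - S.toD (m' t)‖) (a := 0) le_rfl hC0
    hN (fun ψ hψ hψ0 hle t ht => ?_) t ht
  · rw [mul_zero, zero_mul] at h
    exact S.toD_injective (sub_eq_zero.1 (norm_le_zero_iff.1 h))
  · rw [zero_add]
    exact hC m' m m' m ν hcm' hcm hm' hm ψ hψ hψ0 hle t ht

/-- Picard iteration in the norm `sup_t e^{-l t} ‖·‖_{D⋆}`. -/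
theorem exists_nonlinear_solution (hG : G.Admissible S r M) (hM : S.IsStateSpace M) (hr : 0 ≤ r)
    {ν : StrongDual ℝ B} (hν : ν ∈ M) : ∃ m, G.IsNonlinearSolution S r M ν m := by
  obtain ⟨C, hC0, hC⟩ := exists_linear_stability hG hM
  set Ψ : (ℝ → StrongDual ℝ B) → ℝ → StrongDual ℝ B := fun η t => ν.comp (G.UB η 0 t) with hΨ
  have hΨs : ∀ η, S.IsCurve r M η → G.IsLinearSolution S r M η ν (Ψ η) := fun η hη =>
    isLinearSolution_comp hG hη hr hν
  have hΨc : ∀ η, S.IsCurve r M η → S.IsCurve r M (Ψ η) := fun η hη =>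
    (hΨs η hη).isCurve hG hM hη.1
  -- With the weight `e^{-l t}` the map `Ψ` halves distances.
  set l : ℝ := 2 * (C + 1) with hl
  have hl0 : 0 < l := by positivity
  have hCl : C * l⁻¹ ≤ 1 / 2 := by
    rw [← div_eq_mul_inv, div_le_div_iff₀ hl0 two_pos]
    linarith
  have hcontr : ∀ η η' : ℝ → StrongDual ℝ B, S.IsCurve r M η → S.IsCurve r M η' → ∀ N : ℝ, 0 ≤ N →
      (∀ t ∈ Icc 0 r, ‖S.toD (η' t) - S.toD (η t)‖ ≤ N * Real.exp (l * t)) →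
      ∀ t ∈ Icc 0 r, ‖S.toD (Ψ η' t) - S.toD (Ψ η t)‖ ≤ N / 2 * Real.exp (l * t) := by
    intro η η' hη hη' N hN hle t ht
    have h1 := hC η η' _ _ ν hη hη' (hΨs η hη) (hΨs η' hη') (fun t => N * Real.exp (l * t))
      (by fun_prop) (fun s => by positivity) hle t ht
    rw [intervalIntegral.integral_const_mul] at h1
    calc _ ≤ C * (N * (l⁻¹ * Real.exp (l * t))) :=
          h1.trans (by gcongr; exact integral_exp_mul_le hl0 t)
      _ = (C * l⁻¹) * (N * Real.exp (l * t)) := by ring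
      _ ≤ (1 / 2) * (N * Real.exp (l * t)) := by gcongr
      _ = _ := by ring
  set x : ℕ → ℝ → StrongDual ℝ B := fun n => Ψ^[n] fun _ => ν with hx
  have hxs : ∀ n, x (n + 1) = Ψ (x n) := fun n => Function.iterate_succ_apply' _ _ _
  have hxc : ∀ n, S.IsCurve r M (x n) := by
    intro n
    induction n with
    | zero => exact ⟨fun _ _ => hν, continuousOn_const (c := S.toD ν)⟩
    | succ n ih => rw [hxs]; exact hΨc _ ih
  obtain ⟨N₀, hN₀⟩ := isCompact_Icc.exists_bound_of_continuousOn ((hxc 1).2.sub (hxc 0).2)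
  set N := max N₀ 0
  have hN : (0 : ℝ) ≤ N := le_max_right _ _
  have hstep : ∀ n, ∀ t ∈ Icc 0 r,
      ‖S.toD (x (n + 1) t) - S.toD (x n t)‖ ≤ N / 2 ^ n * Real.exp (l * t) := by
    intro n
    induction n with
    | zero =>
      intro t ht
      rw [pow_zero, div_one]
      exact (hN₀ t ht).trans ((le_max_left _ _).trans
        (le_mul_of_one_le_right hN (Real.one_le_exp (mul_nonneg hl0.le ht.1))))
    | succ n ih =>
      intro t ht
      have h1 := hcontr _ _ (hxc n) (hxc (n + 1)) _ (by positivity) ih t ht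
      simp only [← hxs] at h1
      refine h1.trans_eq ?_
      rw [pow_succ]; ring
  set W := Real.exp (l * r) with hW
  have hWt : ∀ t ∈ Icc 0 r, Real.exp (l * t) ≤ W := fun t ht =>
    Real.exp_le_exp.2 (mul_le_mul_of_nonneg_left ht.2 hl0.le)
  have hdist : ∀ t ∈ Icc 0 r, ∀ n,
      dist (S.toD (x n t)) (S.toD (x (n + 1) t)) ≤ 2 * N * W / 2 / 2 ^ n := by
    intro t ht n
    rw [dist_comm, dist_eq_norm]
    refine ((hstep n t ht).trans (mul_le_mul_of_nonneg_left (hWt t ht) (by positivity))).trans_eq ?_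
    ring
  have hlim : ∀ t : ℝ, ∃ y ∈ M, t ∈ Icc 0 r →
      Tendsto (fun n => S.toD (x n t)) atTop (𝓝 (S.toD y)) := by
    intro t
    by_cases ht : t ∈ Icc 0 r
    · obtain ⟨z, hz⟩ := cauchySeq_tendsto_of_complete
        (cauchySeq_of_le_geometric_two (hdist t ht))
      obtain ⟨y, hy, rfl⟩ := hM.closed_toD.mem_of_tendsto hz
        (Eventually.of_forall fun n => ⟨x n t, (hxc n).1 t ht, rfl⟩)
      exact ⟨y, hy, fun _ => hz⟩
    · exact ⟨ν, hν, fun h => absurd h ht⟩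
  choose y hyM hy using hlim
  have hyd : ∀ n, ∀ t ∈ Icc 0 r, ‖S.toD (y t) - S.toD (x n t)‖ ≤ 2 * N * W / 2 ^ n := by
    intro n t ht
    rw [← dist_eq_norm, dist_comm]
    exact dist_le_of_le_geometric_two_of_tendsto (hdist t ht) (hy t ht) n
  have hz : Tendsto (fun n : ℕ => 2 * N * W / 2 ^ n) atTop (𝓝 0) :=
    tendsto_const_nhds.div_atTop (tendsto_pow_atTop_atTop_of_one_lt one_lt_two)
  have hyc : S.IsCurve r M y := by
    refine ⟨fun t _ => hyM t, ?_⟩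
    have hu : TendstoUniformlyOn (fun n t => S.toD (x n t)) (fun t => S.toD (y t)) atTop
        (Icc 0 r) := by
      rw [Metric.tendstoUniformlyOn_iff]
      intro ε hε
      filter_upwards [hz.eventually (gt_mem_nhds hε)] with n hn t ht
      rw [dist_eq_norm]
      exact (hyd n t ht).trans_lt hn
    exact hu.continuousOn (Frequently.of_forall fun n => (hxc n).2)
  have hfix : ∀ t ∈ Icc 0 r, Ψ y t = y t := by
    intro t ht
    apply S.toD_injective
    have h1 : Tendsto (fun n => S.toD (x (n + 1) t)) atTop (𝓝 (S.toD (Ψ y t))) := by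
      rw [tendsto_iff_norm_sub_tendsto_zero]
      have h2 : Tendsto (fun n : ℕ => 2 * N * W / 2 ^ n / 2 * Real.exp (l * t)) atTop (𝓝 0) := by
        simpa using (hz.div_const 2).mul_const (Real.exp (l * t))
      refine squeeze_zero (fun _ => norm_nonneg _) (fun n => ?_) h2
      rw [hxs, norm_sub_rev]
      refine hcontr _ _ (hxc n) hyc _ (by positivity) (fun s hs => (hyd n s hs).trans ?_) t ht
      exact le_mul_of_one_le_right (by positivity) (Real.one_le_exp (mul_nonneg hl0.le hs.1))
    exact tendsto_nhds_unique h1 ((hy t ht).comp (tendsto_add_atTop_nat 1))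
  have hs := hΨs y hyc
  refine ⟨Ψ y, hs.1, hs.2.1, fun f t ht => ?_⟩
  have := hs.2.2 f t ht
  rw [hfix t ht] at this ⊢
  exact this

end Nonlinear

/-! ### Calculus on an interval -/

section Interval

/-- The retraction of `ℝ` onto `[0,r]`, used to extend curves and propagators from `[0,r]`
to the whole line. -/
def clamp (r s : ℝ) : ℝ := max 0 (min s r)

theorem continuous_clamp (r : ℝ) : Continuous (clamp r) := by unfold clamp; fun_prop

theorem clamp_mem {r : ℝ} (hr : 0 ≤ r) (s : ℝ) : clamp r s ∈ Icc 0 r :=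
  ⟨le_max_left _ _, max_le hr (min_le_right _ _)⟩

theorem clamp_of_mem {r s : ℝ} (hs : s ∈ Icc 0 r) : clamp r s = s := by
  rw [clamp, min_eq_left hs.2, max_eq_right hs.1]

theorem continuous_comp_clamp {X : Type*} [TopologicalSpace X] {r : ℝ} (hr : 0 ≤ r) {v : ℝ → X}
    (hv : ContinuousOn v (Icc 0 r)) : Continuous fun s => v (clamp r s) :=
  hv.comp_continuous (continuous_clamp r) (clamp_mem hr)

variable {X Y : Type*} [NormedAddCommGroup X] [NormedSpace ℝ X] [CompleteSpace X]
  [NormedAddCommGroup Y] [NormedSpace ℝ Y] [CompleteSpace Y]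

/-- If `u` is differentiable for a weaker norm, with a derivative that is continuous for the
stronger norm, then the fundamental theorem of calculus holds for the stronger norm. -/
theorem integral_eq_sub_of_injective {j : X →L[ℝ] Y} (hj : Function.Injective j) {u v : ℝ → X}
    {a b : ℝ} (hab : a ≤ b) (hv : ContinuousOn v (Icc a b))
    (hu : ∀ s ∈ Icc a b, HasDerivWithinAt (fun s => j (u s)) (j (v s)) (Icc a b) s) :
    ∫ s in a..b, v s = u b - u a := by
  apply hj
  rw [map_sub, ← j.intervalIntegral_comp_comm (hv.intervalIntegrable_of_Icc hab)]
  exact intervalIntegral.integral_eq_sub_of_hasDerivAt_of_le hab (HasDerivWithinAt.continuousOn hu)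
    (fun s hs => (hu s (Ioo_subset_Icc_self hs)).hasDerivAt (Icc_mem_nhds hs.1 hs.2))
    ((j.continuous.comp_continuousOn hv).intervalIntegrable_of_Icc hab)

theorem hasDerivWithinAt_of_eq_integral {u v : ℝ → X} {r : ℝ} (hv : ContinuousOn v (Icc 0 r))
    {x : X} (hu : ∀ t ∈ Icc 0 r, u t = x + ∫ s in (0 : ℝ)..t, v s) {t : ℝ} (ht : t ∈ Icc 0 r) :
    HasDerivWithinAt u (v t) (Icc 0 r) t := by
  have hr : 0 ≤ r := ht.1.trans ht.2
  have h1 := ((continuous_comp_clamp hr hv).integral_hasStrictDerivAt 0 t).hasDerivAt.const_add x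
  rw [clamp_of_mem ht] at h1
  have h2 : ∀ t ∈ Icc 0 r, u t = x + ∫ s in (0 : ℝ)..t, v (clamp r s) := by
    intro t ht
    rw [hu t ht]
    congr 1
    refine intervalIntegral.integral_congr fun s hs => ?_
    rw [uIcc_of_le ht.1] at hs
    simp only [clamp_of_mem (show s ∈ Icc 0 r from ⟨hs.1, hs.2.trans ht.2⟩)]
  exact h1.hasDerivWithinAt.congr h2 (h2 t ht)

theorem hasDerivWithinAt_of_injective {j : X →L[ℝ] Y} (hj : Function.Injective j) {u v : ℝ → X}
    {r : ℝ} (hv : ContinuousOn v (Icc 0 r))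
    (hu : ∀ s ∈ Icc 0 r, HasDerivWithinAt (fun s => j (u s)) (j (v s)) (Icc 0 r) s) {t : ℝ}
    (ht : t ∈ Icc 0 r) : HasDerivWithinAt u (v t) (Icc 0 r) t := by
  refine hasDerivWithinAt_of_eq_integral hv (x := u 0) (fun t ht => ?_) ht
  have hsub : Icc 0 t ⊆ Icc 0 r := Icc_subset_Icc_right ht.2
  rw [integral_eq_sub_of_injective hj ht.1 (hv.mono hsub) fun s hs => (hu s (hsub hs)).mono hsub]
  abel

end Interval

/-! ### The propagator on vectors of the smallest space -/

section Linearized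

variable {B D E : Type*} [NormedAddCommGroup B] [NormedSpace ℝ B]
  [NormedAddCommGroup D] [NormedSpace ℝ D] [NormedAddCommGroup E] [NormedSpace ℝ E]
  {S : BanachTriple B D E} {r : ℝ} {M : Set (StrongDual ℝ B)} {G : Model B D E}

theorem BanachTriple.RestrictsWithBound.exists_restriction {T : D →L[ℝ] B} {C : ℝ} (hC : 0 ≤ C)
    (h : S.RestrictsWithBound T C) : ∃ T' : E →L[ℝ] D, (∀ g, S.ι (T' g) = T (S.κ g)) ∧ ‖T'‖ ≤ C := by
  choose t ht htC using h
  refine ⟨LinearMap.mkContinuous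
    { toFun := t
      map_add' := fun x y => S.ι_injective (by simp [ht])
      map_smul' := fun c x => S.ι_injective (by simp [ht]) } C htC, ht, ?_⟩
  exact LinearMap.mkContinuous_norm_le _ hC _

/-- Along a curve of states the generators restrict to a norm continuous family of bounded
operators from `E` to `D`. -/
theorem Model.Admissible.exists_restriction_A (hG : G.Admissible S r M) {μ : ℝ → StrongDual ℝ B}
    (hμ : S.IsCurve r M μ) : ∃ a : ℝ → E →L[ℝ] D, ContinuousOn a (Icc 0 r) ∧
      ∀ s ∈ Icc 0 r, ∀ g, S.ι (a s g) = G.A (S.toD (μ s)) (S.κ g) := by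
  obtain ⟨c, hc⟩ := hG.bounded_A
  obtain ⟨c', hc0', hc'⟩ := hG.exists_lipschitz_A
  have hex : ∀ s, ∃ a : E →L[ℝ] D, s ∈ Icc 0 r →
      ∀ g, S.ι (a g) = G.A (S.toD (μ s)) (S.κ g) := by
    intro s
    by_cases hs : s ∈ Icc 0 r
    · have h1 := hc _ (hμ.1 s hs)
      obtain ⟨a, ha, -⟩ := h1.2.exists_restriction ((norm_nonneg _).trans h1.1)
      exact ⟨a, fun _ => ha⟩
    · exact ⟨0, fun h => absurd h hs⟩
  choose a ha using hex
  refine ⟨a, fun x hx => ?_, ha⟩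
  have h1 := (tendsto_iff_norm_sub_tendsto_zero.1 (hμ.2 x hx)).const_mul c'
  rw [mul_zero] at h1
  refine tendsto_iff_norm_sub_tendsto_zero.2 (squeeze_zero' (Eventually.of_forall fun _ =>
    norm_nonneg _) (eventually_mem_nhdsWithin.mono fun s hs => ?_) h1)
  obtain ⟨b, hb, hbn⟩ := (hc' (μ s) (μ x)).2.exists_restriction
    (mul_nonneg hc0' (norm_nonneg _))
  have : a s - a x = b := by
    ext g
    apply S.ι_injective
    simp [hb, ha s hs, ha x hx]
  rw [this]
  exact hbn

theorem IsBackwardPropagator.continuousOn_right {X : Type*} [NormedAddCommGroup X] [NormedSpace ℝ X]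
    {U : ℝ → ℝ → X →L[ℝ] X} (h : IsBackwardPropagator r U) {t q : ℝ} (ht : 0 ≤ t) (hq : q ≤ r)
    (f : X) : ContinuousOn (fun s => U t s f) (Icc t q) :=
  (h.continuous f).comp (Continuous.prodMk_right t).continuousOn
    fun _ hs => ⟨ht, hs.1, hs.2.trans hq⟩

variable [CompleteSpace B] [CompleteSpace D]

/-- The forward equation for the propagator holds in the norm of `D` on vectors of `E`. -/
theorem integral_propagator_right (hG : G.Admissible S r M) {μ : ℝ → StrongDual ℝ B}
    (hμ : S.IsCurve r M μ) {a : ℝ → E →L[ℝ] D} (hac : ContinuousOn a (Icc 0 r))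
    (ha : ∀ s ∈ Icc 0 r, ∀ g, S.ι (a s g) = G.A (S.toD (μ s)) (S.κ g)) (g : E) {t q : ℝ}
    (ht : 0 ≤ t) (htq : t ≤ q) (hq : q ≤ r) :
    ∫ s in t..q, G.UD μ t s (a s g) = G.UD μ t q (S.κ g) - S.κ g := by
  have hsub : Icc t q ⊆ Icc 0 r := Icc_subset_Icc ht hq
  have htr : t ∈ Icc 0 r := ⟨ht, htq.trans hq⟩
  have h := integral_eq_sub_of_injective S.ι_injective (u := fun s => G.UD μ t s (S.κ g))
    (v := fun s => G.UD μ t s (a s g)) htq ?_ fun s hs => ?_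
  · rw [h, (hG.propagator_D μ hμ).refl t htr]
    rfl
  · exact continuousOn_apply_of_strong
      (fun f => (hG.propagator_D μ hμ).continuousOn_right ht hq f)
      ((hac.mono hsub).clm_apply continuousOn_const)
  · have h1 := (hG.generates_right μ hμ (S.κ g) t s ht hs.1 (hs.2.trans hq)).mono
      (Icc_subset_Icc_right hq)
    rw [hG.restrict_D μ hμ t s ht hs.1 (hs.2.trans hq), ha s (hsub hs)]
    exact h1.congr (fun s hs => hG.restrict_D μ hμ t s ht hs.1 (hs.2.trans hq) _)
      (hG.restrict_D μ hμ t s ht hs.1 (hs.2.trans hq) _)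

/-- The backward equation for the propagator holds in the norm of `D` on vectors of `E`. -/
theorem hasDerivWithinAt_propagator_left (hG : G.Admissible S r M) {μ : ℝ → StrongDual ℝ B}
    (hμ : S.IsCurve r M μ) {a : ℝ → E →L[ℝ] D} (hac : ContinuousOn a (Icc 0 r))
    (ha : ∀ s ∈ Icc 0 r, ∀ g, S.ι (a s g) = G.A (S.toD (μ s)) (S.κ g)) (g : E) {t s : ℝ}
    (ht : t ∈ Icc 0 r) (hs : s ∈ Icc 0 t) :
    HasDerivWithinAt (fun s => G.UD μ s t (S.κ g)) (-(a s (G.UE μ s t g))) (Icc 0 t) s := by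
  have hsub : Icc 0 t ⊆ Icc 0 r := Icc_subset_Icc_right ht.2
  refine hasDerivWithinAt_of_injective S.ι_injective (v := fun s => -(a s (G.UE μ s t g)))
    ?_ (fun s hs => ?_) hs
  · exact ((hac.mono hsub).clm_apply ((hG.propagator_E μ hμ).continuousOn_left ht g)).neg
  · rw [map_neg, ha s (hsub hs), hG.restrict_E μ hμ s t hs.1 hs.2 ht.2]
    exact (hG.generates_left μ hμ (S.κ g) s t hs.1 hs.2 ht.2).congr
      (fun s hs => hG.restrict_D μ hμ s t hs.1 hs.2 ht.2 _)
      (hG.restrict_D μ hμ s t hs.1 hs.2 ht.2 _)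

end Linearized

/-! ### The perturbed propagator and the mild form of the linearized equation -/

section Perturbed

variable {B D E : Type*} [NormedAddCommGroup B] [NormedSpace ℝ B]
  [NormedAddCommGroup D] [NormedSpace ℝ D] [NormedAddCommGroup E] [NormedSpace ℝ E]
  {S : BanachTriple B D E} {r : ℝ} {M : Set (StrongDual ℝ B)} {G : Model B D E}

/-- Extensions `U`, `F` and `Φ` to the whole line of the propagator in `D`, the perturbation and the
perturbed propagator around the path `μ`. They agree with the given operators for times in `[0,r]`
(in increasing order), and are strongly continuous everywhere. -/
structure IsPerturbedExtension (G : Model B D E) (S : BanachTriple B D E) (r : ℝ)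
    (μ : ℝ → StrongDual ℝ B) (U Φ : ℝ → ℝ → D →L[ℝ] D) (F : ℝ → D →L[ℝ] D) : Prop where
  U_eq : ∀ t s, 0 ≤ t → t ≤ s → s ≤ r → U t s = G.UD μ t s
  F_eq : ∀ s ∈ Icc 0 r, F s = G.F (S.toD (μ s))
  Phi_eq : ∀ t s, 0 ≤ t → t ≤ s → s ≤ r → ∀ g, Φ t s g = G.Phi S μ t s g
  bound_U : ∃ K, ∀ t s, ‖U t s‖ ≤ K
  bound_F : ∃ c, ∀ s, ‖F s‖ ≤ c
  continuous_U : ∀ f, Continuous fun p : ℝ × ℝ => U p.1 p.2 f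
  continuous_F : ∀ f, Continuous fun s => F s f
  continuous_Phi : ∀ f, Continuous fun p : ℝ × ℝ => Φ p.1 p.2 f
  volterra : ∀ t q g, Φ t q g = U t q g + ∫ σ in t..q, Φ t σ (F σ (U σ q g))

theorem seriesTerm_congr {U U' : ℝ → ℝ → D →L[ℝ] D} {F F' : ℝ → D →L[ℝ] D}
    (hU : ∀ t s, 0 ≤ t → t ≤ s → s ≤ r → U t s = U' t s) (hF : ∀ s ∈ Icc 0 r, F s = F' s)
    (m : ℕ) {t q : ℝ} (ht : 0 ≤ t) (htq : t ≤ q) (hq : q ≤ r) (g : D) :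
    seriesTerm U F m t q g = seriesTerm U' F' m t q g := by
  induction m generalizing t with
  | zero => simp only [seriesTerm, hU t q ht htq hq]
  | succ m ih =>
    refine intervalIntegral.integral_congr fun s hs => ?_
    rw [uIcc_of_le htq] at hs
    simp only [hU t s ht hs.1 (hs.2.trans hq), hF s ⟨ht.trans hs.1, hs.2.trans hq⟩,
      ih (ht.trans hs.1) hs.2]

variable [CompleteSpace D]

theorem exists_isPerturbedExtension (hG : G.Admissible S r M) (hr : 0 ≤ r)
    {μ : ℝ → StrongDual ℝ B} (hμ : S.IsCurve r M μ) :
    ∃ U Φ F, IsPerturbedExtension G S r μ U Φ F := by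
  set p := clamp r with hp
  have hpc : Continuous p := continuous_clamp r
  have hpm : ∀ s, p s ∈ Icc 0 r := clamp_mem hr
  set U : ℝ → ℝ → D →L[ℝ] D := fun t s => G.UD μ (min (p t) (p s)) (p s) with hU
  set F : ℝ → D →L[ℝ] D := fun s => G.F (S.toD (μ (p s))) with hF
  have hUe : ∀ t s, 0 ≤ t → t ≤ s → s ≤ r → U t s = G.UD μ t s := fun t s ht hts hs => by
    simp only [hU, hp, clamp_of_mem (show t ∈ Icc 0 r from ⟨ht, hts.trans hs⟩),
      clamp_of_mem (show s ∈ Icc 0 r from ⟨ht.trans hts, hs⟩), min_eq_left hts]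
  have hFe : ∀ s ∈ Icc 0 r, F s = G.F (S.toD (μ s)) := fun s hs => by
    simp only [hF, hp, clamp_of_mem hs]
  have hUc : ∀ f, Continuous fun p : ℝ × ℝ => U p.1 p.2 f := fun f =>
    ((hG.propagator_D μ hμ).continuous f).comp_continuous
      (f := fun x : ℝ × ℝ => (min (p x.1) (p x.2), p x.2)) (by fun_prop)
      fun x => ⟨le_min (hpm _).1 (hpm _).1, min_le_right _ _, (hpm _).2⟩
  have hFn : ContinuousOn (fun s => G.F (S.toD (μ s))) (Icc 0 r) :=
    hG.continuous_F.comp hμ.2 fun s hs => ⟨μ s, hμ.1 s hs, rfl⟩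
  have hFc : Continuous F := continuous_comp_clamp hr hFn
  obtain ⟨K, hK⟩ := hG.bounded_U
  have hUb : ∀ t s, ‖U t s‖ ≤ K := fun t s =>
    (hK μ hμ _ _ (le_min (hpm _).1 (hpm _).1) (min_le_right _ _) (hpm _).2).2
  obtain ⟨c, hc⟩ := isCompact_Icc.exists_bound_of_continuousOn hFn
  have hFb : ∀ s, ‖F s‖ ≤ c := fun s => hc _ (hpm s)
  have hFs : ∀ f, Continuous fun s => F s f := fun f => hFc.clm_apply continuous_const
  obtain ⟨Φ, h1, h2, h3⟩ := exists_perturbed_propagator hUb hFb hUc hFs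
  refine ⟨U, Φ, F, hUe, hFe, fun t s ht hts hs g => ?_, ⟨K, hUb⟩, ⟨c, hFb⟩, hUc, hFs, h1, h3⟩
  rw [h2]
  exact tsum_congr fun m => seriesTerm_congr hUe hFe m ht hts hs g

/-- The mild form of the linearized equation with the inhomogeneity `e`. -/
def IsMildSolution (r : ℝ) (U : ℝ → ℝ → D →L[ℝ] D) (F : ℝ → D →L[ℝ] D) (e : ℝ → StrongDual ℝ D)
    (x₀ : StrongDual ℝ D) (θ : ℝ → StrongDual ℝ D) : Prop :=
  (∀ f, ContinuousOn (fun t => θ t f) (Icc 0 r)) ∧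
  ∀ t ∈ Icc 0 r, ∀ f, θ t f =
    x₀ (U 0 t f) + ∫ s in (0 : ℝ)..t, (θ s (F s (U s t f)) + e s (U s t f))

/-- A mild solution is given by the variation-of-constants formula with `Φ`. -/
theorem IsMildSolution.eq_integral {μ : ℝ → StrongDual ℝ B} {U Φ : ℝ → ℝ → D →L[ℝ] D}
    {F : ℝ → D →L[ℝ] D} (H : IsPerturbedExtension G S r μ U Φ F) {x₀ : StrongDual ℝ D}
    {e θ : ℝ → StrongDual ℝ D} (he : ∀ f, Continuous fun s => e s f)
    (hθ : IsMildSolution r U F e x₀ θ) {t : ℝ} (ht : t ∈ Icc 0 r) (f : D) :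
    θ t f = x₀ (Φ 0 t f) + ∫ s in (0 : ℝ)..t, e s (Φ s t f) := by
  obtain ⟨Y, hYc, hY, hYm⟩ := exists_mild_solution H.continuous_U H.continuous_F H.continuous_Phi
    H.volterra x₀ he
  obtain ⟨K, hK⟩ := H.bound_U
  obtain ⟨c, hc⟩ := H.bound_F
  rw [mild_solution_unique hK hc H.continuous_U H.continuous_F he hθ.1
    (fun f => (hYc f).continuousOn) hθ.2 (fun t _ f => hYm t f) ht, hY]

variable [CompleteSpace B]

/-- Every solution of the linearized equation solves the mild equation. -/
theorem Model.IsLinearizedSolution.isMildSolution (hG : G.Admissible S r M)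
    {μ : ℝ → StrongDual ℝ B} (hμ : S.IsCurve r M μ) {U Φ : ℝ → ℝ → D →L[ℝ] D}
    {F : ℝ → D →L[ℝ] D} (H : IsPerturbedExtension G S r μ U Φ F)
    {P : StrongDual ℝ B → D →L[ℝ] B} {e : ℝ → StrongDual ℝ D}
    (he : ∀ f, Continuous fun s => e s f) (heP : ∀ s ∈ Icc 0 r, ∀ f, e s f = μ s (P (μ s) f))
    {x₀ : StrongDual ℝ D} {ξ : ℝ → StrongDual ℝ D}
    (hξ : G.IsLinearizedSolution S r P μ x₀ ξ) : IsMildSolution r U F e x₀ ξ := by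
  refine ⟨hξ.1, fun t ht => ?_⟩
  have hr : 0 ≤ r := ht.1.trans ht.2
  have hsub : Icc 0 t ⊆ Icc 0 r := Icc_subset_Icc_right ht.2
  obtain ⟨a, hac, ha⟩ := hG.exists_restriction_A hμ
  have hξc : ∀ f, Continuous fun s => ξ (clamp r s) f := fun f => continuous_comp_clamp hr (hξ.1 f)
  have hUt : ∀ f, Continuous fun s => U s t f := fun f =>
    continuous_kernel_apply H.continuous_U continuous_id continuous_const continuous_const
  have hcont : ∀ f, Continuous fun s => ξ (clamp r s) (F s (U s t f)) + e s (U s t f) := fun f =>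
    (continuous_family_apply hξc continuous_id
      (continuous_family_apply H.continuous_F continuous_id (hUt f))).add
      (continuous_family_apply he continuous_id (hUt f))
  obtain ⟨J, hJ⟩ := exists_strong_integral
    (L := fun s => ξ (clamp r s) ∘L F s ∘L U s t + e s ∘L U s t) hcont 0 t
  have hJ' : ∀ f, J f = ∫ s in (0 : ℝ)..t, (ξ s (F s (U s t f)) + e s (U s t f)) := by
    intro f
    rw [hJ]
    refine intervalIntegral.integral_congr fun s hs => ?_
    rw [uIcc_of_le ht.1] at hs
    simp only [clamp_of_mem (hsub hs)]
    rfl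
  -- The identity holds on the dense subspace `E`, on which the propagator is differentiable, and
  -- both sides are continuous on `D`.
  have hE : ∀ g : E, ξ t (S.κ g) = x₀ (U 0 t (S.κ g)) + J (S.κ g) := by
    intro g
    have hder : ∀ s ∈ Icc 0 t, HasDerivWithinAt (fun s => ξ s (G.UD μ s t (S.κ g)))
        (ξ (clamp r s) (F s (U s t (S.κ g))) + e s (U s t (S.κ g))) (Icc 0 t) s := by
      intro s hs
      have hs' := hsub hs
      obtain ⟨h, hh, hd⟩ := hξ.2.2 (G.UE μ s t g) s hs'
      have hah : h = a s (G.UE μ s t g) := S.ι_injective (by rw [hh, ha s hs'])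
      rw [hG.restrict_E μ hμ s t hs.1 hs.2 ht.2] at hd
      have h1 := hasDerivWithinAt_apply_of_strong (m := ξ) (u := fun s => G.UD μ s t (S.κ g))
        (fun f => (hξ.1 f).mono hsub s hs) (hd.mono hsub)
        (hasDerivWithinAt_propagator_left hG hμ hac ha g ht hs)
      refine h1.congr_deriv ?_
      rw [clamp_of_mem hs', H.U_eq s t hs.1 hs.2 ht.2, H.F_eq s hs', heP s hs',
        hG.dual_rep _ (hμ.1 s hs'), hah, map_neg]
      ring
    have hint := intervalIntegral.integral_eq_sub_of_hasDerivAt_of_le ht.1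
      (HasDerivWithinAt.continuousOn hder)
      (fun s hs => (hder s (Ioo_subset_Icc_self hs)).hasDerivAt (Icc_mem_nhds hs.1 hs.2))
      ((hcont _).intervalIntegrable _ _)
    rw [(hG.propagator_D μ hμ).refl t ht, hξ.2.1] at hint
    rw [hJ, H.U_eq 0 t le_rfl ht.1 ht.2]
    simp only [add_apply, ContinuousLinearMap.comp_apply]
    rw [hint]
    simp
  intro f
  rw [← hJ']
  have := S.κ_dense.equalizer (ξ t).continuous (x₀ ∘L U 0 t + J).continuous (funext hE)
  exact congrFun this f

/-- Every solution of the mild equation solves the linearized equation: inserting the mild equation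
into `∫_0^t (A[μ_s] g, Y_s) ds` and interchanging the integrals, the forward equation for the
propagator gives the integrated form of the linearized equation. -/
theorem isLinearizedSolution_of_mild (hG : G.Admissible S r M)
    {μ : ℝ → StrongDual ℝ B} (hμ : S.IsCurve r M μ) (hr : 0 ≤ r) {U Φ : ℝ → ℝ → D →L[ℝ] D}
    {F : ℝ → D →L[ℝ] D} (H : IsPerturbedExtension G S r μ U Φ F)
    {P : StrongDual ℝ B → D →L[ℝ] B} {e : ℝ → StrongDual ℝ D}
    (he : ∀ f, Continuous fun s => e s f) (heP : ∀ s ∈ Icc 0 r, ∀ f, e s f = μ s (P (μ s) f))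
    {x₀ : StrongDual ℝ D} {Y : ℝ → StrongDual ℝ D} (hYc : ∀ f, Continuous fun t => Y t f)
    (hY : ∀ t f, Y t f = x₀ (U 0 t f) + ∫ s in (0 : ℝ)..t, (Y s (F s (U s t f)) + e s (U s t f))) :
    G.IsLinearizedSolution S r P μ x₀ Y := by
  have h0 : (0 : ℝ) ∈ Icc 0 r := ⟨le_rfl, hr⟩
  refine ⟨fun g => (hYc g).continuousOn, ?_, fun g t ht => ?_⟩
  · ext f
    rw [hY, H.U_eq 0 0 le_rfl le_rfl hr, (hG.propagator_D μ hμ).refl 0 h0]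
    simp
  obtain ⟨a, hac, ha⟩ := hG.exists_restriction_A hμ
  refine ⟨a t g, ha t ht g, ?_⟩
  set b : ℝ → D := fun s => a (clamp r s) g with hb
  have hbc : Continuous b := (continuous_comp_clamp hr hac).clm_apply continuous_const
  set w : ℝ → StrongDual ℝ D := fun s => Y s ∘L F s + e s with hw
  have hwc : ∀ f, Continuous fun s => w s f := fun f =>
    (continuous_family_apply hYc continuous_id (H.continuous_F f)).add (he f)
  have hY' : ∀ t f, Y t f = x₀ (U 0 t f) + ∫ s in (0 : ℝ)..t, w s (U s t f) := hY
  have hYb : Continuous fun s => Y s (b s) := continuous_family_apply hYc continuous_id hbc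
  have hUb : Continuous (Function.uncurry fun σ s => U σ s (b s)) :=
    continuous_kernel_apply H.continuous_U continuous_fst continuous_snd (hbc.comp continuous_snd)
  have hin : Continuous (Function.uncurry fun σ s => w σ (U σ s (b s))) :=
    continuous_family_apply hwc continuous_fst hUb
  have key : ∀ t ∈ Icc 0 r, Y t (S.κ g) =
      x₀ (S.κ g) + ∫ s in (0 : ℝ)..t, (Y s (b s) + w s (S.κ g)) := by
    intro t ht
    have hfor : ∀ σ ∈ Icc 0 t, ∫ s in σ..t, U σ s (b s) = U σ t (S.κ g) - S.κ g := by
      intro σ hσ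
      rw [H.U_eq σ t hσ.1 hσ.2 ht.2,
        ← integral_propagator_right hG hμ hac ha g hσ.1 hσ.2 ht.2]
      refine intervalIntegral.integral_congr fun s hs => ?_
      rw [uIcc_of_le hσ.2] at hs
      simp only [hb, clamp_of_mem (show s ∈ Icc 0 r from ⟨hσ.1.trans hs.1, hs.2.trans ht.2⟩),
        H.U_eq σ s hσ.1 hs.1 (hs.2.trans ht.2)]
    have hcx : Continuous fun s => x₀ (U 0 s (b s)) :=
      x₀.continuous.comp (hUb.comp (Continuous.prodMk_right 0))
    have hci : Continuous fun s => ∫ σ in (0 : ℝ)..s, w σ (U σ s (b s)) :=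
      continuous_integral_both (f := fun s σ => w σ (U σ s (b s))) (hin.comp continuous_swap)
        continuous_const continuous_id
    have e1 : ∫ s in (0 : ℝ)..t, Y s (b s) = x₀ (U 0 t (S.κ g)) - x₀ (S.κ g) +
        ∫ σ in (0 : ℝ)..t, w σ (U σ t (S.κ g) - S.κ g) := by
      simp only [fun s => hY' s (b s)]
      rw [intervalIntegral.integral_add (hcx.intervalIntegrable _ _) (hci.intervalIntegrable _ _),
        ← integral_triangle_swap hin]
      congr 1
      · rw [← map_sub, ← hfor 0 ⟨le_rfl, ht.1⟩]
        exact x₀.intervalIntegral_comp_comm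
          ((hUb.comp (Continuous.prodMk_right 0)).intervalIntegrable _ _)
      · refine intervalIntegral.integral_congr fun σ hσ => ?_
        rw [uIcc_of_le ht.1] at hσ
        simp only [← hfor σ hσ]
        exact (w σ).intervalIntegral_comp_comm
          ((hUb.comp (Continuous.prodMk_right σ)).intervalIntegrable _ _)
    have hwU : Continuous fun s => w s (U s t (S.κ g)) :=
      continuous_family_apply hwc continuous_id
        (continuous_kernel_apply H.continuous_U continuous_id continuous_const continuous_const)
    simp only [map_sub] at e1
    rw [intervalIntegral.integral_sub (hwU.intervalIntegrable _ _)
      ((hwc _).intervalIntegrable _ _)] at e1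
    rw [intervalIntegral.integral_add (hYb.intervalIntegrable _ _)
      ((hwc _).intervalIntegrable _ _), e1, hY']
    ring
  have hd : HasDerivWithinAt (fun s => Y s (S.κ g)) (Y t (b t) + w t (S.κ g)) (Icc 0 r) t :=
    hasDerivWithinAt_of_eq_integral (hYb.add (hwc _)).continuousOn key ht
  refine hd.congr_deriv ?_
  simp only [hb, hw, clamp_of_mem ht, add_apply, ContinuousLinearMap.comp_apply, H.F_eq t ht,
    heP t ht, hG.dual_rep _ (hμ.1 t ht)]
  ring

/-- Well-posedness of the linearized equation, with the inhomogeneity in the form `e`. -/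
theorem exists_isLinearizedEvolution (hG : G.Admissible S r M)
    {μ : ℝ → StrongDual ℝ B} (hμ : S.IsCurve r M μ) (hr : 0 ≤ r) {U Φ : ℝ → ℝ → D →L[ℝ] D}
    {F : ℝ → D →L[ℝ] D} (H : IsPerturbedExtension G S r μ U Φ F)
    {P : StrongDual ℝ B → D →L[ℝ] B} {e : ℝ → StrongDual ℝ D}
    (he : ∀ f, Continuous fun s => e s f) (heP : ∀ s ∈ Icc 0 r, ∀ f, e s f = μ s (P (μ s) f))
    (x₀ : StrongDual ℝ D) : ∃ ξ, G.IsLinearizedEvolution S r P μ x₀ ξ ∧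
      IsMildSolution r U F e x₀ ξ := by
  obtain ⟨Y, hYc, hY, hYm⟩ := exists_mild_solution H.continuous_U H.continuous_F H.continuous_Phi
    H.volterra x₀ he
  refine ⟨Y, ⟨isLinearizedSolution_of_mild hG hμ hr H he heP hYc hYm, fun ξ' hξ' t ht => ?_,
    fun t ht g => ?_⟩, fun f => (hYc f).continuousOn, fun t _ f => hYm t f⟩
  · ext f
    rw [hY]
    exact (hξ'.isMildSolution hG hμ H he heP).eq_integral H he ht f
  · rw [hY, Model.PiApply, H.Phi_eq 0 t le_rfl ht.1 ht.2]
    congr 1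
    refine intervalIntegral.integral_congr fun s hs => ?_
    rw [uIcc_of_le ht.1] at hs
    simp only [H.Phi_eq s t hs.1 hs.2 ht.2, heP s ⟨hs.1, hs.2.trans ht.2⟩]

end Perturbed

/-! ### Convergence of mild solutions -/

section Convergence

open MeasureTheory

variable {B D E ι : Type*} [NormedAddCommGroup B] [NormedSpace ℝ B]
  [NormedAddCommGroup D] [NormedSpace ℝ D] [CompleteSpace D]
  [NormedAddCommGroup E] [NormedSpace ℝ E]
  {S : BanachTriple B D E} {r : ℝ} {M : Set (StrongDual ℝ B)} {G : Model B D E}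
  {μ : ℝ → StrongDual ℝ B} {U Φ : ℝ → ℝ → D →L[ℝ] D} {F : ℝ → D →L[ℝ] D}
  {l : Filter ι} {x : ι → StrongDual ℝ D} {x₀ : StrongDual ℝ D}
  {e θ : ι → ℝ → StrongDual ℝ D} {e₀ θ₀ : ℝ → StrongDual ℝ D}

/-- Weak-⋆ convergence of mild solutions. It rests on the variation-of-constants formula with `Φ`,
since `F` need not preserve `E`, on which alone the inhomogeneities converge uniformly. -/
theorem tendsto_mild_solution [l.IsCountablyGenerated] (H : IsPerturbedExtension G S r μ U Φ F)
    (he : ∀ᶠ i in l, ∀ f, Continuous fun s => e i s f) (he₀ : ∀ f, Continuous fun s => e₀ s f)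
    (hθ : ∀ᶠ i in l, IsMildSolution r U F (e i) (x i) (θ i)) (hθ₀ : IsMildSolution r U F e₀ x₀ θ₀)
    (hx : ∀ f, Tendsto (fun i => x i f) l (𝓝 (x₀ f))) {C : ℝ}
    (hC : ∀ᶠ i in l, ∀ s ∈ Icc 0 r, ‖e i s - e₀ s‖ ≤ C)
    (hε : ∀ ε > 0, ∀ᶠ i in l, ∀ s ∈ Icc 0 r, ∀ g : E, ‖(e i s - e₀ s) (S.κ g)‖ ≤ ε * ‖g‖)
    {t : ℝ} (ht : t ∈ Icc 0 r) (f : D) : Tendsto (fun i => θ i t f) l (𝓝 (θ₀ t f)) := by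
  have hΦ : Continuous fun s => Φ s t f :=
    continuous_kernel_apply H.continuous_Phi continuous_id continuous_const continuous_const
  obtain ⟨b, hb⟩ := (isCompact_Icc (a := (0 : ℝ)) (b := t)).exists_bound_of_continuousOn
    hΦ.continuousOn
  have hsub : uIoc 0 t ⊆ Icc 0 t := by
    rw [uIoc_of_le ht.1]; exact Ioc_subset_Icc_self
  have hpt : ∀ s ∈ Icc 0 r, ∀ y, Tendsto (fun i => e i s y) l (𝓝 (e₀ s y)) := by
    intro s hs y
    have h1 : ∀ y, Tendsto (fun i => (e i s - e₀ s) y) l (𝓝 ((0 : StrongDual ℝ D) y)) := by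
      refine tendsto_apply_of_dense S.κ_dense (hC.mono fun i hi => hi s hs) fun g => ?_
      rw [zero_apply, Metric.tendsto_nhds]
      intro ε hε0
      filter_upwards [hε (ε / (2 * (‖g‖ + 1))) (by positivity)] with i hi
      rw [dist_zero_right]
      refine (hi s hs g).trans_lt ?_
      rw [div_mul_eq_mul_div, div_lt_iff₀ (by positivity)]
      nlinarith [norm_nonneg g]
    have h2 := (h1 y).add_const (e₀ s y)
    simpa using h2
  have hint : Tendsto (fun i => ∫ s in (0 : ℝ)..t, e i s (Φ s t f)) l
      (𝓝 (∫ s in (0 : ℝ)..t, e₀ s (Φ s t f))) := by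
    have hcont₀ : Continuous fun s => e₀ s (Φ s t f) :=
      continuous_family_apply he₀ continuous_id hΦ
    refine intervalIntegral.tendsto_integral_filter_of_dominated_convergence
      (fun s => C * b + ‖e₀ s (Φ s t f)‖) ?_ ?_ ?_ ?_
    · filter_upwards [he] with i hi
      exact (continuous_family_apply hi continuous_id hΦ).aestronglyMeasurable
    · filter_upwards [hC] with i hi
      refine Eventually.of_forall fun s hs => ?_
      have hs' := hsub hs
      have hs'' : s ∈ Icc 0 r := ⟨hs'.1, hs'.2.trans ht.2⟩
      have h1 := (e i s - e₀ s).le_of_opNorm_le_of_le (hi s hs'') (hb s hs')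
      have h2 : e i s (Φ s t f) = (e i s - e₀ s) (Φ s t f) + e₀ s (Φ s t f) := by simp
      rw [h2]
      exact (norm_add_le _ _).trans (add_le_add_left h1 _)
    · exact (continuous_const.add hcont₀.norm).intervalIntegrable _ _
    · refine Eventually.of_forall fun s hs => ?_
      have hs' := hsub hs
      exact hpt s ⟨hs'.1, hs'.2.trans ht.2⟩ _
  rw [hθ₀.eq_integral H he₀ ht f]
  refine ((hx _).add hint).congr' ?_
  filter_upwards [he, hθ] with i hi hθi
  rw [hθi.eq_integral H hi ht f]

/-- A quantitative estimate in the norm of `E⋆`, for `F` bounded on `E`. -/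
theorem norm_toE_sub_le_of_mild (H : IsPerturbedExtension G S r μ U Φ F) (hr : 0 ≤ r)
    {e θ : ℝ → StrongDual ℝ D} {x : StrongDual ℝ D}
    (he : ∀ f, Continuous fun s => e s f) (he₀ : ∀ f, Continuous fun s => e₀ s f)
    (hθ : IsMildSolution r U F e x θ) (hθ₀ : IsMildSolution r U F e₀ x₀ θ₀) {K c ε : ℝ}
    (hK0 : 0 ≤ K) (hc0 : 0 ≤ c) (hε0 : 0 ≤ ε)
    (hU : ∀ s t, 0 ≤ s → s ≤ t → t ≤ r → ∀ g : E, ∃ h : E, S.κ h = U s t (S.κ g) ∧ ‖h‖ ≤ K * ‖g‖)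
    (hF : ∀ s ∈ Icc 0 r, ∀ g : E, ∃ h : E, S.κ h = F s (S.κ g) ∧ ‖h‖ ≤ c * ‖g‖)
    (hε : ∀ s ∈ Icc 0 r, ∀ g : E, ‖(e s - e₀ s) (S.κ g)‖ ≤ ε * ‖g‖) {t : ℝ} (ht : t ∈ Icc 0 r) :
    ‖S.toE (θ t) - S.toE (θ₀ t)‖ ≤
      2 * (‖S.toE x - S.toE x₀‖ * K + ε * K * r) * Real.exp (2 * (c * K + 1) * t) := by
  have hdc : ∀ f, ContinuousOn (fun t => (θ t - θ₀ t) f) (Icc 0 r) := fun f =>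
    (hθ.1 f).sub (hθ₀.1 f)
  obtain ⟨N, hN0, hN⟩ := exists_norm_le_of_strong isCompact_Icc hdc
  have hi : ∀ {η : ℝ → StrongDual ℝ D} {e : ℝ → StrongDual ℝ D}, ∀ t ∈ Icc 0 r, ∀ f,
      (∀ f, ContinuousOn (fun t => η t f) (Icc 0 r)) → (∀ f, Continuous fun s => e s f) →
      IntervalIntegrable (fun s => η s (F s (U s t f)) + e s (U s t f)) volume 0 t := by
    intro η e t ht f hη he
    have hUt : Continuous fun s => U s t f :=
      continuous_kernel_apply H.continuous_U continuous_id continuous_const continuous_const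
    exact (((continuousOn_apply_of_strong hη
      (continuous_family_apply H.continuous_F continuous_id hUt).continuousOn).mono
        (Icc_subset_Icc_right ht.2)).add
      (continuous_family_apply he continuous_id hUt).continuousOn).intervalIntegrable_of_Icc ht.1
  have hd : ∀ t ∈ Icc 0 r, ∀ f, (θ t - θ₀ t) f = (x - x₀) (U 0 t f) +
      ∫ s in (0 : ℝ)..t, ((θ s - θ₀ s) (F s (U s t f)) + (e s - e₀ s) (U s t f)) := by
    intro t ht f
    rw [sub_apply, hθ.2 t ht f, hθ₀.2 t ht f, add_sub_add_comm, ← sub_apply,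
      ← intervalIntegral.integral_sub (hi t ht f hθ.1 he) (hi t ht f hθ₀.1 he₀)]
    congr 1
    refine intervalIntegral.integral_congr fun s _ => ?_
    simp only [sub_apply]
    ring
  refine gronwall_of_bounded (φ := fun t => ‖S.toE (θ t) - S.toE (θ₀ t)‖) (r := r)
    (N := N) (by positivity) (by positivity) (fun t ht => ?_) (fun ψ hψ hψ0 hle t ht => ?_) t ht
  · refine ContinuousLinearMap.opNorm_le_bound _ hN0 fun g => ?_
    exact (θ t - θ₀ t).le_of_opNorm_le_of_le (hN t ht) (S.norm_κ_le g)
  · have hψi : 0 ≤ ∫ s in (0 : ℝ)..t, ψ s := intervalIntegral.integral_nonneg ht.1 fun s _ => hψ0 s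
    refine ContinuousLinearMap.opNorm_le_bound _ (by positivity) fun g => ?_
    change ‖(θ t - θ₀ t) (S.κ g)‖ ≤ _
    rw [hd t ht]
    have h1 : ‖(x - x₀) (U 0 t (S.κ g))‖ ≤ ‖S.toE x - S.toE x₀‖ * (K * ‖g‖) := by
      obtain ⟨h, hh, hhn⟩ := hU 0 t le_rfl ht.1 ht.2 g
      rw [← hh]
      exact (S.toE x - S.toE x₀).le_of_opNorm_le_of_le le_rfl hhn
    have h2 : ∀ s ∈ Ioc 0 t, ‖(θ s - θ₀ s) (F s (U s t (S.κ g))) + (e s - e₀ s) (U s t (S.κ g))‖ ≤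
        ψ s * (c * K * ‖g‖) + ε * (K * ‖g‖) := by
      intro s hs
      have hs' : s ∈ Icc 0 r := ⟨hs.1.le, hs.2.trans ht.2⟩
      obtain ⟨h, hh, hhn⟩ := hU s t hs'.1 hs.2 ht.2 g
      obtain ⟨k, hk, hkn⟩ := hF s hs' h
      rw [← hh, ← hk]
      refine (norm_add_le _ _).trans (add_le_add ?_ ?_)
      · refine ((S.toE (θ s) - S.toE (θ₀ s)).le_of_opNorm_le_of_le (hle s hs') hkn).trans ?_
        rw [mul_assoc c]
        exact mul_le_mul_of_nonneg_left (mul_le_mul_of_nonneg_left hhn hc0) (hψ0 s)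
      · exact (hε s hs' h).trans (mul_le_mul_of_nonneg_left hhn hε0)
    have h3 := intervalIntegral.norm_integral_le_of_norm_le ht.1
      (Eventually.of_forall fun s hs => h2 s hs)
      (Continuous.intervalIntegrable (μ := volume) (by fun_prop) _ _)
    have h5 : ∫ s in (0 : ℝ)..t, (ψ s * (c * K * ‖g‖) + ε * (K * ‖g‖)) =
        (∫ s in (0 : ℝ)..t, ψ s) * (c * K * ‖g‖) + t * (ε * (K * ‖g‖)) := by
      rw [intervalIntegral.integral_add (Continuous.intervalIntegrable (by fun_prop) _ _)
        (Continuous.intervalIntegrable (by fun_prop) _ _), intervalIntegral.integral_mul_const,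
        intervalIntegral.integral_const, smul_eq_mul, sub_zero]
    rw [h5] at h3
    have h4 : t * (ε * (K * ‖g‖)) ≤ r * (ε * (K * ‖g‖)) :=
      mul_le_mul_of_nonneg_right ht.2 (by positivity)
    refine (norm_add_le _ _).trans ((add_le_add h1 (h3.trans (add_le_add_right h4 _))).trans_eq ?_)
    ring

/-- Convergence of mild solutions in the norm of `E⋆`, for `F` bounded on `E`. -/
theorem tendsto_toE_mild_solution [CompleteSpace E] (hG : G.Admissible S r M)
    (hμ : S.IsCurve r M μ) (H : IsPerturbedExtension G S r μ U Φ F) (hFE : G.FBoundedOnE S M)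
    (he : ∀ᶠ i in l, ∀ f, Continuous fun s => e i s f) (he₀ : ∀ f, Continuous fun s => e₀ s f)
    (hθ : ∀ᶠ i in l, IsMildSolution r U F (e i) (x i) (θ i)) (hθ₀ : IsMildSolution r U F e₀ x₀ θ₀)
    (hx : Tendsto (fun i => S.toE (x i)) l (𝓝 (S.toE x₀)))
    (hε : ∀ ε > 0, ∀ᶠ i in l, ∀ s ∈ Icc 0 r, ∀ g : E, ‖(e i s - e₀ s) (S.κ g)‖ ≤ ε * ‖g‖)
    {t : ℝ} (ht : t ∈ Icc 0 r) : Tendsto (fun i => S.toE (θ i t)) l (𝓝 (S.toE (θ₀ t))) := by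
  have hr : 0 ≤ r := ht.1.trans ht.2
  obtain ⟨c, hc⟩ := hFE
  have hcompact : IsCompact {p : ℝ × ℝ | 0 ≤ p.1 ∧ p.1 ≤ p.2 ∧ p.2 ≤ r} := by
    refine (isCompact_Icc (a := (0 : ℝ)) (b := r)).prod (isCompact_Icc (a := (0 : ℝ)) (b := r))
      |>.of_isClosed_subset ?_ fun p hp => ⟨⟨hp.1, hp.2.1.trans hp.2.2⟩, hp.1.trans hp.2.1, hp.2.2⟩
    exact (isClosed_le continuous_const continuous_fst).inter
      ((isClosed_le continuous_fst continuous_snd).inter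
        (isClosed_le continuous_snd continuous_const))
  obtain ⟨K, hK0, hK⟩ := exists_norm_le_of_strong hcompact (hG.propagator_E μ hμ).continuous
  have hU : ∀ s t, 0 ≤ s → s ≤ t → t ≤ r → ∀ g : E,
      ∃ h : E, S.κ h = U s t (S.κ g) ∧ ‖h‖ ≤ K * ‖g‖ := fun s t hs hst htr g =>
    ⟨G.UE μ s t g, by rw [hG.restrict_E μ hμ s t hs hst htr, H.U_eq s t hs hst htr],
      (G.UE μ s t).le_of_opNorm_le (hK (s, t) ⟨hs, hst, htr⟩) g⟩
  have hF : ∀ s ∈ Icc 0 r, ∀ g : E, ∃ h : E, S.κ h = F s (S.κ g) ∧ ‖h‖ ≤ max c 0 * ‖g‖ := by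
    intro s hs g
    obtain ⟨h, hh, hhn⟩ := hc _ (hμ.1 s hs) g
    exact ⟨h, by rw [hh, H.F_eq s hs], hhn.trans (by gcongr; exact le_max_left _ _)⟩
  set W := 2 * Real.exp (2 * (max c 0 * K + 1) * t) with hW
  rw [Metric.tendsto_nhds]
  intro δ hδ
  set ε := δ / (2 * (W * (K * r) + 1)) with hεd
  have hW0 : 0 < W := by positivity
  have hε0 : 0 < ε := by positivity
  have h1 : Tendsto (fun i => W * K * ‖S.toE (x i) - S.toE x₀‖) l (𝓝 0) := by
    simpa using (tendsto_iff_norm_sub_tendsto_zero.1 hx).const_mul (W * K)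
  filter_upwards [he, hθ, hε ε hε0, h1.eventually (gt_mem_nhds (half_pos hδ))] with i hi hθi hεi hxi
  rw [dist_eq_norm]
  refine (norm_toE_sub_le_of_mild H hr hi he₀ hθi hθ₀ hK0 (le_max_right c 0) hε0.le hU hF hεi
    ht).trans_lt ?_
  have h2 : W * (K * r) * ε ≤ δ / 2 := by
    rw [hεd, mul_div_assoc', div_le_div_iff₀ (by positivity) two_pos]
    nlinarith [show 0 ≤ W * (K * r) by positivity]
  calc _ = W * K * ‖S.toE (x i) - S.toE x₀‖ + W * (K * r) * ε := by rw [hW]; ring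
    _ < δ := by linarith

end Convergence

/-! ### Dependence of the generators on the state and on the parameter -/

section Generators

variable {B D E : Type*} [NormedAddCommGroup B] [NormedSpace ℝ B]
  [NormedAddCommGroup D] [NormedSpace ℝ D] [NormedAddCommGroup E] [NormedSpace ℝ E]
  {S : BanachTriple B D E} {r : ℝ} {M : Set (StrongDual ℝ B)}

/-- The remainder of the first order expansion of `A` is quadratic. -/
theorem Model.Admissible.exists_remainder_bound {G : Model B D E} (hG : G.Admissible S r M) :
    ∃ c : ℝ, 0 ≤ c ∧ ∀ μ μ' : StrongDual ℝ B,
      ‖G.A (S.toD μ') - G.A (S.toD μ) - G.DA μ (S.toD (μ' - μ))‖ ≤ c * ‖S.toD (μ' - μ)‖ ^ 2 := by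
  obtain ⟨c, hc⟩ := hG.lipschitz_DA
  obtain ⟨c', hc'0, hc'⟩ := hG.exists_lipschitz_A
  refine ⟨|c|, abs_nonneg c, fun μ μ' => ?_⟩
  set d := μ' - μ with hd
  have hcont : Continuous fun s : ℝ => G.A (S.toD (μ + s • d)) := by
    rw [← continuousOn_univ]
    refine hG.continuousOn_A (ξ := fun s : ℝ => μ + s • d) ?_
    simp only [S.toD_add, S.toD_smul]
    fun_prop
  have hder : ∀ x : ℝ, HasDerivWithinAt (fun s : ℝ => G.A (S.toD (μ + s • d)))
      (G.DA (μ + x • d) (S.toD d)) (Ici x) x := by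
    intro x
    rw [← hasDerivWithinAt_Ioi_iff_Ici, hasDerivWithinAt_iff_tendsto_slope' self_notMem_Ioi]
    have hsub : Tendsto (fun y : ℝ => y - x) (𝓝[>] x) (𝓝[>] 0) := by
      have h0 : Tendsto (fun y : ℝ => y - x) (𝓝 x) (𝓝 0) :=
        Continuous.tendsto' (by fun_prop) _ _ (sub_self x)
      exact tendsto_nhdsWithin_iff.2 ⟨h0.mono_left nhdsWithin_le_nhds,
        eventually_mem_nhdsWithin.mono fun y hy => mem_Ioi.2 (sub_pos.2 (mem_Ioi.1 hy))⟩
    refine ((hG.gateaux (μ + x • d) (S.toD d)).comp hsub).congr fun y => ?_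
    rw [slope_def_module, Function.comp_apply, ← S.toD_smul, ← S.toD_add, add_assoc, ← add_smul,
      add_sub_cancel]
  have h := norm_image_sub_le_of_norm_deriv_right_le_segment (a := 0) (b := 1)
    (f := fun s : ℝ => G.A (S.toD (μ + s • d)) - s • G.DA μ (S.toD d))
    (f' := fun s => G.DA (μ + s • d) (S.toD d) - G.DA μ (S.toD d))
    (C := |c| * ‖S.toD d‖ ^ 2) (hcont.sub (by fun_prop)).continuousOn
    (fun x _ => by
      have := (hder x).sub ((hasDerivWithinAt_id x (Ici x)).smul_const (G.DA μ (S.toD d)))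
      rwa [one_smul] at this)
    (fun x hx => by
      refine (hc (μ + x • d) μ (S.toD d)).trans ?_
      rw [S.toD_add, add_sub_cancel_left, S.toD_smul, norm_smul, Real.norm_of_nonneg hx.1]
      have h1 : x * ‖S.toD d‖ ≤ ‖S.toD d‖ := mul_le_of_le_one_left (norm_nonneg _) hx.2.le
      have h0 := hx.1
      calc c * (x * ‖S.toD d‖) * ‖S.toD d‖ ≤ |c| * (x * ‖S.toD d‖) * ‖S.toD d‖ := by
            gcongr; exact le_abs_self c
        _ ≤ |c| * ‖S.toD d‖ * ‖S.toD d‖ := by gcongr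
        _ = _ := by ring)
    1 ⟨zero_le_one, le_rfl⟩
  simp only [one_smul, zero_smul, add_zero, sub_zero, mul_one] at h
  rw [show μ + d = μ' by rw [hd]; abel] at h
  rwa [sub_right_comm]

variable {I : Set ℝ} {G : ℝ → Model B D E} {A' : ℝ → StrongDual ℝ B → D →L[ℝ] B}

namespace ParameterAssumptions

theorem exists_bound (hA' : ParameterAssumptions S M I G A') : ∃ c : ℝ, 0 ≤ c ∧
    ∀ α ∈ I, ∀ μ ∈ M, ‖A' α μ‖ ≤ c ∧ S.RestrictsWithBound (A' α μ) c := by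
  obtain ⟨c, hc⟩ := hA'.bounded
  refine ⟨|c|, abs_nonneg c, fun α hα μ hμ => ⟨(hc α hα μ hμ).1.trans (le_abs_self c), fun g => ?_⟩⟩
  obtain ⟨h, h1, h2⟩ := (hc α hα μ hμ).2 g
  exact ⟨h, h1, h2.trans (mul_le_mul_of_nonneg_right (le_abs_self c) (norm_nonneg _))⟩

/-- The Lipschitz estimate for `∂A/∂α` in the weaker norm of operators from `E` to `B`, which has the
advantage that every `D → B` operator restricts to one of this kind. -/
theorem exists_lipschitz_comp (hA' : ParameterAssumptions S M I G A') : ∃ c : ℝ, 0 ≤ c ∧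
    ∀ α ∈ I, ∀ μ ∈ M, ∀ η ∈ M,
      ‖(A' α μ - A' α η) ∘L S.κ‖ ≤ c * ‖S.toD μ - S.toD η‖ := by
  obtain ⟨c, hc⟩ := hA'.lipschitz
  refine ⟨|c|, abs_nonneg c, fun α hα μ hμ η hη =>
    S.opNorm_comp_κ_le (by positivity) fun g => ?_⟩
  obtain ⟨h, h1, h2⟩ := hc α hα μ hμ η hη g
  refine ⟨h, h1, h2.trans ?_⟩
  gcongr
  exact le_abs_self c

theorem exists_norm_sub_le (hA' : ParameterAssumptions S M I G A') (hI : I.OrdConnected) :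
    ∃ c : ℝ, 0 ≤ c ∧ ∀ α ∈ I, ∀ β ∈ I, ∀ μ ∈ M,
      ‖(G β).A (S.toD μ) - (G α).A (S.toD μ)‖ ≤ c * |β - α| := by
  obtain ⟨c, hc0, hc⟩ := hA'.exists_bound
  exact ⟨c, hc0, fun α hα β hβ μ hμ => hI.convex.norm_image_sub_le_of_norm_hasDerivWithin_le
    (fun γ hγ => hA'.deriv_DB γ hγ μ hμ) (fun γ hγ => (hc γ hγ μ hμ).1) hα hβ⟩

/-- The increments of `A` with respect to the parameter are Lipschitz in the state, as operators
from `E` to `B`. -/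
theorem exists_norm_sub_sub_le (hA' : ParameterAssumptions S M I G A') (hI : I.OrdConnected) :
    ∃ c : ℝ, 0 ≤ c ∧ ∀ α ∈ I, ∀ β ∈ I, ∀ μ ∈ M, ∀ η ∈ M,
      ‖(((G β).A (S.toD μ) - (G α).A (S.toD μ)) - ((G β).A (S.toD η) - (G α).A (S.toD η))) ∘L S.κ‖
        ≤ c * ‖S.toD μ - S.toD η‖ * |β - α| := by
  obtain ⟨c, hc0, hc⟩ := hA'.exists_lipschitz_comp
  refine ⟨c, hc0, fun α hα β hβ μ hμ η hη => ?_⟩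
  have h := hI.convex.norm_image_sub_le_of_norm_hasDerivWithin_le
    (f := fun γ => ((G γ).A (S.toD μ) - (G γ).A (S.toD η)) ∘L S.κ)
    (f' := fun γ => (A' γ μ - A' γ η) ∘L S.κ)
    (fun γ hγ => (((ContinuousLinearMap.compL ℝ E D B).flip S.κ).hasFDerivAt).comp_hasDerivWithinAt γ
      ((hA'.deriv_DB γ hγ μ hμ).sub (hA'.deriv_DB γ hγ η hη)))
    (fun γ hγ => hc γ hγ μ hμ η hη) hα hβ
  convert! h using 2
  ext g
  simp
  abel

/-- Strong continuity of `∂A/∂α` along a curve: it is uniformly bounded from `D` to `B`, and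
Lipschitz on the dense subspace `E`. -/
theorem continuousOn_apply (hA' : ParameterAssumptions S M I G A') {α : ℝ} (hα : α ∈ I)
    {μ : ℝ → StrongDual ℝ B} (hμ : S.IsCurve r M μ) (f : D) :
    ContinuousOn (fun s => A' α (μ s) f) (Icc 0 r) := by
  obtain ⟨c, hc0, hc⟩ := hA'.exists_bound
  obtain ⟨c', hc'0, hc'⟩ := hA'.exists_lipschitz_comp
  refine continuousOn_apply_of_dense S.κ_dense (fun s hs => (hc α hα _ (hμ.1 s hs)).1)
    (fun g x hx => ?_) f
  have h1 := ((tendsto_iff_norm_sub_tendsto_zero.1 (hμ.2 x hx)).const_mul c').mul_const ‖g‖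
  rw [mul_zero, zero_mul] at h1
  refine tendsto_iff_norm_sub_tendsto_zero.2 (squeeze_zero' (Eventually.of_forall fun _ =>
    norm_nonneg _) (eventually_mem_nhdsWithin.mono fun s hs => ?_) h1)
  exact ((A' α (μ s) - A' α (μ x)) ∘L S.κ).le_of_opNorm_le
    (hc' α hα _ (hμ.1 s hs) _ (hμ.1 x hx)) g

/-- The difference quotients of `A` converge uniformly along a curve of states: they are
equi-Lipschitz in the state, and the curve is compact. -/
theorem eventually_uniform (hA' : ParameterAssumptions S M I G A') (hI : I.OrdConnected)
    {α : ℝ} (hα : α ∈ I) {μ : ℝ → StrongDual ℝ B} (hμ : S.IsCurve r M μ) {ε : ℝ} (hε : 0 < ε) :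
    ∀ᶠ β in 𝓝[I \ {α}] α, ∀ s ∈ Icc 0 r,
      ‖((β - α)⁻¹ • ((G β).A (S.toD (μ s)) - (G α).A (S.toD (μ s))) - A' α (μ s)) ∘L S.κ‖ ≤ ε := by
  obtain ⟨c, hc0, hc⟩ := hA'.exists_norm_sub_sub_le hI
  obtain ⟨c', hc'0, hc'⟩ := hA'.exists_lipschitz_comp
  set q : ℝ → ℝ → D →L[ℝ] B := fun β s =>
    (β - α)⁻¹ • ((G β).A (S.toD (μ s)) - (G α).A (S.toD (μ s))) - A' α (μ s) with hq
  have hlip : ∀ β ∈ I \ {α}, ∀ s ∈ Icc 0 r, ∀ x ∈ Icc 0 r,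
      ‖(q β s - q β x) ∘L S.κ‖ ≤ (c + c') * ‖S.toD (μ s) - S.toD (μ x)‖ := by
    intro β hβ s hs x hx
    have hne : β - α ≠ 0 := sub_ne_zero.2 hβ.2
    have e : (q β s - q β x) ∘L S.κ = (β - α)⁻¹ • ((((G β).A (S.toD (μ s)) - (G α).A (S.toD (μ s))) -
        ((G β).A (S.toD (μ x)) - (G α).A (S.toD (μ x)))) ∘L S.κ) -
        (A' α (μ s) - A' α (μ x)) ∘L S.κ := by
      ext g
      simp [hq, smul_sub]
      abel
    rw [e]
    refine (norm_sub_le _ _).trans ?_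
    rw [add_mul, norm_smul, norm_inv, Real.norm_eq_abs]
    refine add_le_add ?_ (hc' α hα _ (hμ.1 s hs) _ (hμ.1 x hx))
    rw [inv_mul_le_iff₀ (abs_pos.2 hne), mul_comm |β - α|]
    exact hc α hα β hβ.1 _ (hμ.1 s hs) _ (hμ.1 x hx)
  change ∀ᶠ β in 𝓝[I \ {α}] α, ∀ s ∈ Icc 0 r, ‖q β s ∘L S.κ‖ ≤ ε
  refine isCompact_Icc.induction_on (p := fun K => ∀ᶠ β in 𝓝[I \ {α}] α, ∀ s ∈ K ∩ Icc 0 r,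
    ‖q β s ∘L S.κ‖ ≤ ε) ?_ ?_ ?_ ?_ |>.mono fun β h s hs => h s ⟨hs, hs⟩
  · exact Eventually.of_forall fun β s hs => absurd hs.1 (notMem_empty s)
  · exact fun K K' hK h => h.mono fun β hβ s hs => hβ s ⟨hK hs.1, hs.2⟩
  · intro K K' h h'
    filter_upwards [h, h'] with β hβ hβ' s hs
    exact hs.1.elim (fun hK => hβ s ⟨hK, hs.2⟩) fun hK => hβ' s ⟨hK, hs.2⟩
  · intro x hx
    have h1 := (tendsto_iff_norm_sub_tendsto_zero.1 (hμ.2 x hx)).const_mul (c + c')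
    rw [mul_zero] at h1
    refine ⟨_, (h1.eventually (gt_mem_nhds (half_pos hε))), ?_⟩
    have h2 := hasDerivWithinAt_iff_tendsto_slope.1 (hA'.deriv_DB α hα _ (hμ.1 x hx))
    have h3 := (tendsto_iff_norm_sub_tendsto_zero.1 h2).eventually (gt_mem_nhds (half_pos hε))
    filter_upwards [h3, eventually_mem_nhdsWithin] with β hβ hβI s hs
    have h4 : ‖q β x ∘L S.κ‖ ≤ ε / 2 := by
      refine ContinuousLinearMap.opNorm_le_bound _ (by positivity) fun g => ?_
      have : ‖q β x‖ ≤ ε / 2 := by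
        simp only [slope_def_module] at hβ
        exact hβ.le
      exact (q β x).le_of_opNorm_le_of_le this (S.norm_κ_le g)
    have e : q β s ∘L S.κ = (q β s - q β x) ∘L S.κ + q β x ∘L S.κ := by
      rw [← ContinuousLinearMap.add_comp, sub_add_cancel]
    have hs1 : (c + c') * ‖S.toD (μ s) - S.toD (μ x)‖ < ε / 2 := hs.1
    rw [e]
    refine (norm_add_le _ _).trans ?_
    have := hlip β hβI s hs.2 x hx
    linarith

end ParameterAssumptions

end Generators

/-! ### Differentiability with respect to the parameter -/

section Parameter

variable {B D E : Type*} [NormedAddCommGroup B] [NormedSpace ℝ B]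
  [NormedAddCommGroup D] [NormedSpace ℝ D]
  [NormedAddCommGroup E] [NormedSpace ℝ E]
  {S : BanachTriple B D E} {r : ℝ} {M : Set (StrongDual ℝ B)}

variable {I : Set ℝ} {G : ℝ → Model B D E} {A' : ℝ → StrongDual ℝ B → D →L[ℝ] B}

/-- A family that does not depend on the parameter. -/
theorem ParameterAssumptions.const (G : Model B D E) :
    ParameterAssumptions S M I (fun _ => G) fun _ _ => 0 where
  deriv_DB _ _ _ _ := hasDerivWithinAt_const _ _ _
  deriv_ED α _ μ _ ε hε := Eventually.of_forall fun β g => ⟨0, by simp, by simp; positivity⟩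
  bounded := ⟨0, fun _ _ _ _ => ⟨by simp, fun g => ⟨0, by simp, by simp⟩⟩⟩
  lipschitz := ⟨0, fun _ _ _ _ _ _ g => ⟨0, by simp, by simp⟩⟩

/-- The inhomogeneity of the linearized equation, extended to the whole line. -/
def inhomogeneity (r : ℝ) (P : StrongDual ℝ B → D →L[ℝ] B) (μ : ℝ → StrongDual ℝ B) (s : ℝ) :
    StrongDual ℝ D :=
  (μ (clamp r s)).comp (P (μ (clamp r s)))

/-- The inhomogeneity in the mild equation for the difference quotient
`(m' - m) / h` of solutions of two models `G'` and `G`, extended to the whole line. -/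
def quotientInhomogeneity (r : ℝ) (S : BanachTriple B D E) (h : ℝ) (G G' : Model B D E)
    (F : ℝ → D →L[ℝ] D) (m m' : ℝ → StrongDual ℝ B) (s : ℝ) : StrongDual ℝ D :=
  h⁻¹ • ((m' (clamp r s)).comp
    (G'.A (S.toD (m' (clamp r s))) - G.A (S.toD (m (clamp r s))))) -
  (h⁻¹ • (S.toD (m' (clamp r s)) - S.toD (m (clamp r s)))).comp (F s)

/-- The inhomogeneities in the mild equations for the difference quotients are bounded in `D⋆`, and
converge in the norm of `E⋆` to the inhomogeneity of the linearized equation. -/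
theorem eventually_inhomogeneity_close (hM : S.IsStateSpace M) (hI : I.OrdConnected)
    (hG : ∀ α ∈ I, (G α).Admissible S r M) (hA' : ParameterAssumptions S M I G A')
    {μ₀ : ℝ → StrongDual ℝ B} {m : ℝ → ℝ → StrongDual ℝ B}
    (hm : ∀ β ∈ I, (G β).IsNonlinearSolution S r M (μ₀ β) (m β)) {α : ℝ} (hα : α ∈ I) {C : ℝ}
    (hC0 : 0 ≤ C) (hC : ∀ᶠ β in 𝓝[I \ {α}] α, ∀ t ∈ Icc 0 r,
      ‖S.toD (m β t) - S.toD (m α t)‖ ≤ C * |β - α|)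
    {U Φ : ℝ → ℝ → D →L[ℝ] D} {F : ℝ → D →L[ℝ] D}
    (H : IsPerturbedExtension (G α) S r (m α) U Φ F) :
    (∃ C' : ℝ, ∀ᶠ β in 𝓝[I \ {α}] α, ∀ s ∈ Icc 0 r,
      ‖quotientInhomogeneity r S (β - α) (G α) (G β) F (m α) (m β) s -
        inhomogeneity r (A' α) (m α) s‖ ≤ C') ∧
    ∀ ε > 0, ∀ᶠ β in 𝓝[I \ {α}] α, ∀ s ∈ Icc 0 r, ∀ g : E,
      ‖(quotientInhomogeneity r S (β - α) (G α) (G β) F (m α) (m β) s -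
        inhomogeneity r (A' α) (m α) s) (S.κ g)‖ ≤ ε * ‖g‖ := by
  obtain ⟨R', hR'⟩ := hM.bounded.exists_norm_le
  set R := max R' 0
  have hR0 : 0 ≤ R := le_max_right _ _
  have hR : ∀ μ ∈ M, ‖μ‖ ≤ R := fun μ hμ => (hR' μ hμ).trans (le_max_left _ _)
  obtain ⟨cA, hcA0, hcA⟩ := (hG α hα).exists_lipschitz_A
  obtain ⟨cP, hcP0, hcP⟩ := hA'.exists_bound
  obtain ⟨cI, hcI0, hcI⟩ := hA'.exists_norm_sub_le hI
  obtain ⟨cQ, hcQ0, hcQ⟩ := hA'.exists_norm_sub_sub_le hI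
  obtain ⟨cR, hcR0, hcR⟩ := (hG α hα).exists_remainder_bound
  obtain ⟨cD, hcD⟩ := (hG α hα).bounded_DA
  obtain ⟨cF, hcF⟩ := H.bound_F
  have hcF0 : 0 ≤ cF := (norm_nonneg _).trans (hcF 0)
  have hcur : S.IsCurve r M (m α) := (hm α hα).isCurve (hG α hα) hM
  constructor
  · refine ⟨R * (cI + cA * C) + C * cF + R * cP, ?_⟩
    filter_upwards [hC, eventually_mem_nhdsWithin] with β hβ hβI s hs
    have hk : 0 < |β - α| := abs_pos.2 (sub_ne_zero.2 hβI.2)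
    simp only [quotientInhomogeneity, inhomogeneity, clamp_of_mem hs]
    have hδ := hβ s hs
    have hMβ := (hm β hβI.1).1 s hs
    have hMα := (hm α hα).1 s hs
    have hgen : ‖(G β).A (S.toD (m β s)) - (G α).A (S.toD (m α s))‖ ≤
        (cI + cA * C) * |β - α| := by
      rw [← sub_add_sub_cancel _ ((G α).A (S.toD (m β s)))]
      refine (norm_add_le _ _).trans ((add_le_add (hcI α hα β hβI.1 _ hMβ)
        (((hcA (m β s) (m α s)).1).trans (mul_le_mul_of_nonneg_left hδ hcA0))).trans_eq ?_)
      ring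
    have hinv : ∀ (x : StrongDual ℝ D) (b : ℝ), ‖x‖ ≤ b * |β - α| → ‖(β - α)⁻¹ • x‖ ≤ b := by
      intro x b hx
      rw [norm_smul, norm_inv, Real.norm_eq_abs, inv_mul_le_iff₀ hk, mul_comm]
      exact hx
    refine (norm_sub_le _ _).trans (add_le_add ((norm_sub_le _ _).trans (add_le_add ?_ ?_)) ?_)
    · refine hinv _ _ ((ContinuousLinearMap.opNorm_comp_le _ _).trans ?_)
      rw [mul_assoc]
      exact mul_le_mul (hR _ hMβ) hgen (norm_nonneg _) hR0
    · exact (ContinuousLinearMap.opNorm_comp_le _ _).trans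
        (mul_le_mul (hinv _ _ hδ) (hcF s) (norm_nonneg _) hC0)
    · exact (ContinuousLinearMap.opNorm_comp_le _ _).trans
        (mul_le_mul (hR _ hMα) (hcP α hα _ hMα).1 (norm_nonneg _) hR0)
  · intro ε hε
    set C₂ := R * cQ * C + C * cP + R * cR * C ^ 2 + C ^ 2 * (|cD| * (1 + R)) with hC₂
    have hC₂0 : 0 ≤ C₂ := by positivity
    have hsmall : ∀ᶠ β in 𝓝[I \ {α}] α, |β - α| < ε / (2 * (C₂ + 1)) := by
      have : Tendsto (fun β : ℝ => |β - α|) (𝓝 α) (𝓝 0) :=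
        Continuous.tendsto' (by fun_prop) _ _ (by simp)
      exact (this.mono_left nhdsWithin_le_nhds).eventually (gt_mem_nhds (by positivity))
    filter_upwards [hC, eventually_mem_nhdsWithin, hsmall,
      hA'.eventually_uniform hI hα hcur (ε := ε / (2 * (R + 1))) (by positivity)]
      with β hβ hβI hβs hβu s hs g
    have hne : β - α ≠ 0 := sub_ne_zero.2 hβI.2
    have hk : 0 < |β - α| := abs_pos.2 hne
    have hδ := hβ s hs
    have hMβ := (hm β hβI.1).1 s hs
    have hMα := (hm α hα).1 s hs
    simp only [quotientInhomogeneity, inhomogeneity, clamp_of_mem hs, H.F_eq s hs]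
    set k := (β - α)⁻¹ with hkd
    have hkh : |k| * |β - α| = 1 := by rw [hkd, abs_inv, inv_mul_cancel₀ hk.ne']
    set μ := m α s
    set η := m β s
    set δ := S.toD (η - μ) with hδd
    have hδ' : ‖δ‖ ≤ C * |β - α| := hδ
    -- The error is split according to its sources: the variation of the difference quotient in the
    -- parameter with the state, its convergence at the unperturbed state, the variation of the
    -- state in the explicit derivative, the Taylor remainder, and the quadratic term.
    have hsplit : (k • (η.comp ((G β).A (S.toD η) - (G α).A (S.toD μ))) -
        (k • (S.toD η - S.toD μ)).comp ((G α).F (S.toD μ)) - μ.comp (A' α μ)) (S.κ g) =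
        k * η ((((G β).A (S.toD η) - (G α).A (S.toD η)) -
          ((G β).A (S.toD μ) - (G α).A (S.toD μ))) (S.κ g)) +
        η ((k • ((G β).A (S.toD μ) - (G α).A (S.toD μ)) - A' α μ) (S.κ g)) +
        (η - μ) (A' α μ (S.κ g)) +
        k * η (((G α).A (S.toD η) - (G α).A (S.toD μ) - (G α).DA μ δ) (S.κ g)) +
        k * (η - μ) ((G α).DA μ δ (S.κ g)) := by
      have hrep : (S.toD η - S.toD μ) ((G α).F (S.toD μ) (S.κ g)) =
          μ ((G α).DA μ δ (S.κ g)) := by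
        rw [(hG α hα).dual_rep μ hMα]; rfl
      simp only [sub_apply, smul_apply, ContinuousLinearMap.comp_apply, map_sub, map_smul,
        smul_eq_mul] at hrep ⊢
      linear_combination -k * hrep
    rw [hsplit]
    have t1 : ‖k * η ((((G β).A (S.toD η) - (G α).A (S.toD η)) -
        ((G β).A (S.toD μ) - (G α).A (S.toD μ))) (S.κ g))‖ ≤ R * cQ * C * |β - α| * ‖g‖ := by
      have e1 := ContinuousLinearMap.le_of_opNorm_le _ (hcQ α hα β hβI.1 η hMβ μ hMα) g
      have e2 := η.le_of_opNorm_le_of_le (hR _ hMβ) e1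
      rw [norm_mul, Real.norm_eq_abs k]
      calc _ ≤ |k| * (R * (cQ * (C * |β - α|) * |β - α| * ‖g‖)) := by
            refine mul_le_mul_of_nonneg_left (e2.trans ?_) (abs_nonneg _)
            gcongr
        _ = (|k| * |β - α|) * (R * cQ * C * |β - α| * ‖g‖) := by ring
        _ = _ := by rw [hkh, one_mul]
    have t2 : ‖η ((k • ((G β).A (S.toD μ) - (G α).A (S.toD μ)) - A' α μ) (S.κ g))‖ ≤
        ε / 2 * ‖g‖ := by
      have e1 := ContinuousLinearMap.le_of_opNorm_le _ (hβu s hs) g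
      have e2 := η.le_of_opNorm_le_of_le (hR _ hMβ) e1
      refine e2.trans ?_
      rw [← mul_assoc]
      gcongr
      rw [mul_div_assoc', div_le_div_iff₀ (by positivity) two_pos]
      nlinarith
    have t3 : ‖(η - μ) (A' α μ (S.κ g))‖ ≤ C * cP * |β - α| * ‖g‖ := by
      obtain ⟨x, hx, hxn⟩ := (hcP α hα μ hMα).2 g
      rw [← hx]
      exact (δ.le_of_opNorm_le_of_le hδ' hxn).trans_eq (by ring)
    have t4 : ‖k * η (((G α).A (S.toD η) - (G α).A (S.toD μ) - (G α).DA μ δ) (S.κ g))‖ ≤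
        R * cR * C ^ 2 * |β - α| * ‖g‖ := by
      have e1 := ContinuousLinearMap.le_of_opNorm_le_of_le _ (hcR μ η) (S.norm_κ_le g)
      have e2 := η.le_of_opNorm_le_of_le (hR _ hMβ) e1
      rw [norm_mul, Real.norm_eq_abs k]
      calc _ ≤ |k| * (R * (cR * (C * |β - α|) ^ 2 * ‖g‖)) := by
            refine mul_le_mul_of_nonneg_left (e2.trans ?_) (abs_nonneg _)
            gcongr
        _ = (|k| * |β - α|) * (R * cR * C ^ 2 * |β - α| * ‖g‖) := by ring
        _ = _ := by rw [hkh, one_mul]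
    have t5 : ‖k * (η - μ) ((G α).DA μ δ (S.κ g))‖ ≤
        C ^ 2 * (|cD| * (1 + R)) * |β - α| * ‖g‖ := by
      obtain ⟨x, hx, hxn⟩ := (hcD μ δ).2 g
      rw [← hx, norm_mul, Real.norm_eq_abs k]
      have hxn' : ‖x‖ ≤ |cD| * (1 + R) * (C * |β - α|) * ‖g‖ := by
        refine hxn.trans ?_
        have := le_abs_self cD
        have := hR μ hMα
        gcongr
      calc _ ≤ |k| * ((C * |β - α|) * (|cD| * (1 + R) * (C * |β - α|) * ‖g‖)) :=
            mul_le_mul_of_nonneg_left (δ.le_of_opNorm_le_of_le hδ' hxn') (abs_nonneg _)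
        _ = (|k| * |β - α|) * (C ^ 2 * (|cD| * (1 + R)) * |β - α| * ‖g‖) := by ring
        _ = _ := by rw [hkh, one_mul]
    have hfin : C₂ * |β - α| ≤ ε / 2 := by
      have := mul_le_mul_of_nonneg_left hβs.le hC₂0
      refine this.trans ?_
      rw [mul_div_assoc', div_le_div_iff₀ (by positivity) two_pos]
      nlinarith
    calc _ ≤ R * cQ * C * |β - α| * ‖g‖ + ε / 2 * ‖g‖ + C * cP * |β - α| * ‖g‖ +
          R * cR * C ^ 2 * |β - α| * ‖g‖ + C ^ 2 * (|cD| * (1 + R)) * |β - α| * ‖g‖ :=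
          (norm_add_le _ _).trans (add_le_add ((norm_add_le _ _).trans (add_le_add
            ((norm_add_le _ _).trans (add_le_add ((norm_add_le _ _).trans (add_le_add t1 t2)) t3))
            t4)) t5)
      _ = (C₂ * |β - α| + ε / 2) * ‖g‖ := by rw [hC₂]; ring
      _ ≤ ε * ‖g‖ := by gcongr; linarith

variable [CompleteSpace B]

/-- The difference of nonlinear solutions for two models, in terms of the propagator of one of
them. -/
theorem toD_sub_eq_integral {G₁ G₂ : Model B D E} (hG₁ : G₁.Admissible S r M)
    (hG₂ : G₂.Admissible S r M) (hM : S.IsStateSpace M) {ν₁ ν₂ : StrongDual ℝ B}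
    {m₁ m₂ : ℝ → StrongDual ℝ B} (h₁ : G₁.IsNonlinearSolution S r M ν₁ m₁)
    (h₂ : G₂.IsNonlinearSolution S r M ν₂ m₂) {t : ℝ} (ht : t ∈ Icc 0 r) (f : D) :
    (S.toD (m₂ t) - S.toD (m₁ t)) f = (S.toD ν₂ - S.toD ν₁) (G₁.UD m₁ 0 t f) +
      ∫ s in (0 : ℝ)..t,
        m₂ s ((G₂.A (S.toD (m₂ s)) - G₁.A (S.toD (m₁ s))) (G₁.UD m₁ s t f)) := by
  have c₁ := h₁.isCurve hG₁ hM
  have c₂ := h₂.isCurve hG₂ hM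
  have e₁ := duhamel hG₁ c₁ ht (c₁.continuousOn_apply hM) (hG₁.continuousOn_A c₁.2) h₁.2.2 f
  have e₂ := duhamel hG₁ c₁ ht (c₂.continuousOn_apply hM) (hG₂.continuousOn_A c₂.2) h₂.2.2 f
  simp only [sub_self, zero_apply, map_zero, intervalIntegral.integral_zero, add_zero] at e₁
  rw [sub_apply, sub_apply, S.toD_apply, S.toD_apply, S.toD_apply, S.toD_apply, e₁, e₂, h₁.2.1,
    h₂.2.1]
  ring

/-- The nonlinear solution is Lipschitz in the parameter and in the initial value, in the norm
of `D⋆`. -/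
theorem exists_parameter_stability (hM : S.IsStateSpace M) (hI : I.OrdConnected)
    (hG : ∀ α ∈ I, (G α).Admissible S r M) (hA' : ParameterAssumptions S M I G A') (hr : 0 ≤ r)
    {α : ℝ} (hα : α ∈ I) : ∃ C : ℝ, 0 ≤ C ∧ ∀ ν m, (G α).IsNonlinearSolution S r M ν m →
      ∀ β ∈ I, ∀ ν' m', (G β).IsNonlinearSolution S r M ν' m' → ∀ t ∈ Icc 0 r,
        ‖S.toD (m' t) - S.toD (m t)‖ ≤ C * (‖S.toD ν' - S.toD ν‖ + |β - α|) := by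
  obtain ⟨R, hR⟩ := hM.bounded.exists_norm_le
  obtain ⟨c, hc0, hc⟩ := (hG α hα).exists_lipschitz_A
  obtain ⟨c', hc'0, hc'⟩ := hA'.exists_norm_sub_le hI
  obtain ⟨K, hK⟩ := (hG α hα).bounded_U
  set R₁ := max R 0
  set K₁ := max K 0
  have hR0 : 0 ≤ R₁ := le_max_right _ _
  have hK0 : 0 ≤ K₁ := le_max_right _ _
  set W := 2 * Real.exp (2 * (R₁ * c * K₁ + 1) * r)
  refine ⟨(K₁ + R₁ * c' * K₁ * r) * W, by positivity, ?_⟩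
  intro ν m hm β hβ ν' m' hm' t ht
  have hcm := hm.isCurve (hG α hα) hM
  have hcm' := hm'.isCurve (hG β hβ) hM
  obtain ⟨N, hN⟩ := isCompact_Icc.exists_bound_of_continuousOn (hcm'.2.sub hcm.2)
  have hgr := gronwall_of_bounded (φ := fun t => ‖S.toD (m' t) - S.toD (m t)‖) (r := r) (N := N)
    (a := K₁ * ‖S.toD ν' - S.toD ν‖ + R₁ * c' * K₁ * r * |β - α|) (C := R₁ * c * K₁)
    (by positivity) (by positivity) hN ?_ t ht
  · refine hgr.trans ?_
    have h1 : Real.exp (2 * (R₁ * c * K₁ + 1) * t) ≤ Real.exp (2 * (R₁ * c * K₁ + 1) * r) := by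
      gcongr; exact ht.2
    calc _ ≤ 2 * (K₁ * ‖S.toD ν' - S.toD ν‖ + R₁ * c' * K₁ * r * |β - α|) *
          Real.exp (2 * (R₁ * c * K₁ + 1) * r) := by gcongr
      _ = (K₁ * ‖S.toD ν' - S.toD ν‖ + R₁ * c' * K₁ * r * |β - α|) * W := by ring
      _ ≤ ((K₁ + R₁ * c' * K₁ * r) * (‖S.toD ν' - S.toD ν‖ + |β - α|)) * W := by
          gcongr
          have e1 : 0 ≤ K₁ * |β - α| := by positivity
          have e2 : 0 ≤ R₁ * c' * K₁ * r * ‖S.toD ν' - S.toD ν‖ := by positivity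
          linarith
      _ = _ := by ring
  · intro ψ hψ hψ0 hle t ht
    have hψi : 0 ≤ ∫ s in (0 : ℝ)..t, ψ s := intervalIntegral.integral_nonneg ht.1 fun s _ => hψ0 s
    refine ContinuousLinearMap.opNorm_le_bound _ (by positivity) fun f => ?_
    rw [toD_sub_eq_integral (hG α hα) (hG β hβ) hM hm hm' ht f]
    have hUb : ∀ s, 0 ≤ s → s ≤ t → ‖(G α).UD m s t f‖ ≤ K₁ * ‖f‖ := fun s hs hst =>
      ((G α).UD m s t).le_of_opNorm_le (((hK m hcm s t hs hst ht.2).2).trans (le_max_left K 0)) f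
    have h1 : ‖(S.toD ν' - S.toD ν) ((G α).UD m 0 t f)‖ ≤ ‖S.toD ν' - S.toD ν‖ * (K₁ * ‖f‖) :=
      ContinuousLinearMap.le_of_opNorm_le_of_le _ le_rfl (hUb 0 le_rfl ht.1)
    have h2 : ∀ s ∈ Ioc 0 t,
        ‖m' s (((G β).A (S.toD (m' s)) - (G α).A (S.toD (m s))) ((G α).UD m s t f))‖ ≤
        ψ s * (R₁ * c * K₁ * ‖f‖) + R₁ * c' * K₁ * |β - α| * ‖f‖ := by
      intro s hs
      have hs' : s ∈ Icc 0 r := ⟨hs.1.le, hs.2.trans ht.2⟩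
      have e1 : ‖(G β).A (S.toD (m' s)) - (G α).A (S.toD (m s))‖ ≤ c' * |β - α| + c * ψ s := by
        rw [← sub_add_sub_cancel _ ((G α).A (S.toD (m' s)))]
        exact (norm_add_le _ _).trans (add_le_add (hc' α hα β hβ _ (hm'.1 s hs'))
          (((hc (m' s) (m s)).1).trans (mul_le_mul_of_nonneg_left (hle s hs') hc0)))
      refine ((m' s).le_of_opNorm_le_of_le ((hR _ (hm'.1 s hs')).trans (le_max_left R 0))
        (ContinuousLinearMap.le_of_opNorm_le_of_le _ e1 (hUb s hs'.1 hs.2))).trans_eq ?_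
      ring
    have h3 := intervalIntegral.norm_integral_le_of_norm_le ht.1
      (Eventually.of_forall fun s hs => h2 s hs)
      (Continuous.intervalIntegrable (μ := MeasureTheory.volume) (by fun_prop) _ _)
    have h5 : ∫ s in (0 : ℝ)..t, (ψ s * (R₁ * c * K₁ * ‖f‖) + R₁ * c' * K₁ * |β - α| * ‖f‖) =
        (∫ s in (0 : ℝ)..t, ψ s) * (R₁ * c * K₁ * ‖f‖) +
          t * (R₁ * c' * K₁ * |β - α| * ‖f‖) := by
      rw [intervalIntegral.integral_add (Continuous.intervalIntegrable (by fun_prop) _ _)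
        (Continuous.intervalIntegrable (by fun_prop) _ _), intervalIntegral.integral_mul_const,
        intervalIntegral.integral_const, smul_eq_mul, sub_zero]
    rw [h5] at h3
    have h4 : t * (R₁ * c' * K₁ * |β - α| * ‖f‖) ≤ r * (R₁ * c' * K₁ * |β - α| * ‖f‖) :=
      mul_le_mul_of_nonneg_right ht.2 (by positivity)
    refine (norm_add_le _ _).trans ((add_le_add h1 (h3.trans (add_le_add_right h4 _))).trans_eq ?_)
    ring

theorem continuous_inhomogeneity (hM : S.IsStateSpace M) (hr : 0 ≤ r)
    {P : StrongDual ℝ B → D →L[ℝ] B} {μ : ℝ → StrongDual ℝ B} (hμ : S.IsCurve r M μ)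
    (hP : ∀ f, ContinuousOn (fun s => P (μ s) f) (Icc 0 r)) (f : D) :
    Continuous fun s => inhomogeneity r P μ s f :=
  continuous_comp_clamp hr (v := fun s => μ s (P (μ s) f))
    (continuousOn_apply_of_strong (hμ.continuousOn_apply hM) (hP f))

theorem continuous_quotientInhomogeneity (hM : S.IsStateSpace M) (hr : 0 ≤ r) {G G' : Model B D E}
    (hG : G.Admissible S r M) (hG' : G'.Admissible S r M) (h : ℝ) {m m' : ℝ → StrongDual ℝ B}
    (hm : S.IsCurve r M m) (hm' : S.IsCurve r M m') {U Φ : ℝ → ℝ → D →L[ℝ] D} {F : ℝ → D →L[ℝ] D}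
    (H : IsPerturbedExtension G S r m U Φ F) (f : D) :
    Continuous fun s => quotientInhomogeneity r S h G G' F m m' s f := by
  have h1 : Continuous fun s => m' (clamp r s)
      ((G'.A (S.toD (m' (clamp r s))) - G.A (S.toD (m (clamp r s)))) f) :=
    continuous_comp_clamp hr
      (v := fun s => m' s ((G'.A (S.toD (m' s)) - G.A (S.toD (m s))) f))
      (continuousOn_apply_of_strong (hm'.continuousOn_apply hM)
        (((hG'.continuousOn_A hm'.2).sub (hG.continuousOn_A hm.2)).clm_apply continuousOn_const))
  have h2 : Continuous fun s => S.toD (m' (clamp r s)) - S.toD (m (clamp r s)) :=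
    continuous_comp_clamp hr (v := fun s => S.toD (m' s) - S.toD (m s)) (hm'.2.sub hm.2)
  exact (h1.const_smul h⁻¹).sub ((h2.const_smul h⁻¹).clm_apply (H.continuous_F f))

/-- The difference quotient of two nonlinear solutions solves a mild equation. -/
theorem isMildSolution_quotient (hM : S.IsStateSpace M) {G₁ G₂ : Model B D E}
    (hG₁ : G₁.Admissible S r M) (hG₂ : G₂.Admissible S r M) (h : ℝ) {ν₁ ν₂ : StrongDual ℝ B}
    {m₁ m₂ : ℝ → StrongDual ℝ B} (h₁ : G₁.IsNonlinearSolution S r M ν₁ m₁)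
    (h₂ : G₂.IsNonlinearSolution S r M ν₂ m₂) {U Φ : ℝ → ℝ → D →L[ℝ] D} {F : ℝ → D →L[ℝ] D}
    (H : IsPerturbedExtension G₁ S r m₁ U Φ F) :
    IsMildSolution r U F (quotientInhomogeneity r S h G₁ G₂ F m₁ m₂)
      (h⁻¹ • (S.toD ν₂ - S.toD ν₁)) (fun t => h⁻¹ • (S.toD (m₂ t) - S.toD (m₁ t))) := by
  have c₁ := h₁.isCurve hG₁ hM
  have c₂ := h₂.isCurve hG₂ hM
  refine ⟨fun f => ((c₂.2.sub c₁.2).const_smul h⁻¹).clm_apply continuousOn_const,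
    fun t ht f => ?_⟩
  rw [smul_apply, toD_sub_eq_integral hG₁ hG₂ hM h₁ h₂ ht f, smul_add, smul_apply,
    H.U_eq 0 t le_rfl ht.1 ht.2]
  congr 1
  rw [← intervalIntegral.integral_smul]
  refine intervalIntegral.integral_congr fun s hs => ?_
  rw [uIcc_of_le ht.1] at hs
  simp only [quotientInhomogeneity, clamp_of_mem (show s ∈ Icc 0 r from ⟨hs.1, hs.2.trans ht.2⟩),
    H.U_eq s t hs.1 hs.2 ht.2, sub_apply, smul_apply, ContinuousLinearMap.comp_apply]
  ring

variable [CompleteSpace D] [CompleteSpace E]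

/-- Differentiability of the nonlinear solutions with respect to the parameter. -/
theorem exists_parameter_derivative (hM : S.IsStateSpace M) (hI : I.OrdConnected) (hr : 0 ≤ r)
    (hG : ∀ α ∈ I, (G α).Admissible S r M) (hA' : ParameterAssumptions S M I G A')
    {μ₀ : ℝ → StrongDual ℝ B} {m : ℝ → ℝ → StrongDual ℝ B}
    (hm : ∀ β ∈ I, (G β).IsNonlinearSolution S r M (μ₀ β) (m β)) {α : ℝ} (hα : α ∈ I)
    {ξ₀ : StrongDual ℝ D} (hn : HasNormDeriv S I μ₀ α ξ₀) (hw : HasWeakStarDeriv S I μ₀ α ξ₀) :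
    ∃ ξ : ℝ → StrongDual ℝ D, (G α).IsLinearizedEvolution S r (A' α) (m α) ξ₀ ξ ∧
      ∀ t ∈ Icc 0 r, HasWeakStarDeriv S I (fun β => m β t) α (ξ t) ∧
        ((G α).FBoundedOnE S M → HasNormDeriv S I (fun β => m β t) α (ξ t)) := by
  have hcur : S.IsCurve r M (m α) := (hm α hα).isCurve (hG α hα) hM
  obtain ⟨U, Φ, F, H⟩ := exists_isPerturbedExtension (hG α hα) hr hcur
  have he₀ := continuous_inhomogeneity hM hr hcur (hA'.continuousOn_apply hα hcur)
  obtain ⟨ξ, hξ, hξm⟩ := exists_isLinearizedEvolution (hG α hα) hcur hr H he₀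
    (fun s hs f => by simp only [inhomogeneity, clamp_of_mem hs]; rfl) ξ₀
  refine ⟨ξ, hξ, ?_⟩
  set l := 𝓝[I \ {α}] α
  have hx : ∀ f, Tendsto (fun β => ((β - α)⁻¹ • (S.toD (μ₀ β) - S.toD (μ₀ α))) f) l
      (𝓝 (ξ₀ f)) := fun f => by
    refine (hasDerivWithinAt_iff_tendsto_slope.1 (hw f)).congr fun β => ?_
    rw [slope_def_module]; rfl
  have hxE : Tendsto (fun β => S.toE ((β - α)⁻¹ • (S.toD (μ₀ β) - S.toD (μ₀ α)))) l
      (𝓝 (S.toE ξ₀)) := by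
    refine (hasDerivWithinAt_iff_tendsto_slope.1 hn).congr fun β => ?_
    rw [slope_def_module]; rfl
  have hmem : ∀ᶠ β in l, β ∈ I \ {α} := eventually_mem_nhdsWithin
  -- Weak-⋆ convergence of the initial quotients makes them bounded in the norm of `D⋆`.
  obtain ⟨C₀, hC₀0, hC₀⟩ := exists_eventually_norm_le hx
  obtain ⟨C₁, hC₁0, hC₁⟩ := exists_parameter_stability hM hI hG hA' hr hα
  have hC : ∀ᶠ β in l, ∀ t ∈ Icc 0 r,
      ‖S.toD (m β t) - S.toD (m α t)‖ ≤ C₁ * (C₀ + 1) * |β - α| := by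
    filter_upwards [hC₀, hmem] with β hβ hβI t ht
    have hk : 0 < |β - α| := abs_pos.2 (sub_ne_zero.2 hβI.2)
    rw [norm_smul, norm_inv, Real.norm_eq_abs, inv_mul_le_iff₀ hk] at hβ
    refine (hC₁ _ _ (hm α hα) β hβI.1 _ _ (hm β hβI.1) t ht).trans ?_
    rw [mul_assoc]
    refine mul_le_mul_of_nonneg_left ?_ hC₁0
    linarith
  obtain ⟨⟨C', hC'⟩, hε⟩ := eventually_inhomogeneity_close hM hI hG hA' hm hα (by positivity)
    hC H
  have he : ∀ᶠ β in l, ∀ f, Continuous fun s =>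
      quotientInhomogeneity r S (β - α) (G α) (G β) F (m α) (m β) s f :=
    hmem.mono fun β hβ f => continuous_quotientInhomogeneity hM hr (hG α hα) (hG β hβ.1) _ hcur
      ((hm β hβ.1).isCurve (hG β hβ.1) hM) H f
  have hθ : ∀ᶠ β in l, IsMildSolution r U F
      (quotientInhomogeneity r S (β - α) (G α) (G β) F (m α) (m β))
      ((β - α)⁻¹ • (S.toD (μ₀ β) - S.toD (μ₀ α)))
      (fun t => (β - α)⁻¹ • (S.toD (m β t) - S.toD (m α t))) :=
    hmem.mono fun β hβ => isMildSolution_quotient hM (hG α hα) (hG β hβ.1) _ (hm α hα)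
      (hm β hβ.1) H
  refine fun t ht => ⟨fun f => ?_, fun hFE => ?_⟩
  · refine hasDerivWithinAt_iff_tendsto_slope.2 ?_
    refine (tendsto_mild_solution H he he₀ hθ hξm hx hC' hε ht f).congr fun β => ?_
    rw [slope_def_module]; rfl
  · refine hasDerivWithinAt_iff_tendsto_slope.2 ?_
    refine (tendsto_toE_mild_solution (hG α hα) hcur H hFE he he₀ hθ hξm hxE hε ht).congr
      fun β => ?_
    rw [slope_def_module]; rfl

end Parameter

end Sensitivity

end

/-! ### The nonlinear flow and its derivatives -/

theorem mainTheorem2 {B D E : Type*}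
    [NormedAddCommGroup B] [NormedSpace ℝ B] [CompleteSpace B]
    [NormedAddCommGroup D] [NormedSpace ℝ D] [CompleteSpace D]
    [NormedAddCommGroup E] [NormedSpace ℝ E] [CompleteSpace E]
    (S : Sensitivity.BanachTriple B D E) (r : ℝ) (hr : 0 < r)
    (M : Set (StrongDual ℝ B)) (hM : S.IsStateSpace M)
    (I : Set ℝ) (hI : I.OrdConnected)
    (G : ℝ → Sensitivity.Model B D E) (hG : ∀ α ∈ I, (G α).Admissible S r M)
    (A' : ℝ → StrongDual ℝ B → (D →L[ℝ] B))
    (hA' : Sensitivity.ParameterAssumptions S M I G A') :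
    -- `T α ν t` is the nonlinear evolution at time `t` with parameter `α` started from `ν`
    ∃ T : ℝ → StrongDual ℝ B → ℝ → StrongDual ℝ B,
      (∀ α ∈ I, ∀ ν ∈ M, (G α).IsNonlinearSolution S r M ν (T α ν) ∧
        ∀ ν', (G α).IsNonlinearSolution S r M ν ν' → Set.EqOn ν' (T α ν) (Set.Icc 0 r)) ∧
      -- differentiability with respect to the parameter
      (∀ μ₀ : ℝ → StrongDual ℝ B, (∀ α ∈ I, μ₀ α ∈ M) →
        ∀ α ∈ I, ∀ ξ₀ : StrongDual ℝ B,
          Sensitivity.HasNormDeriv S I μ₀ α (S.toD ξ₀) →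
          Sensitivity.HasWeakStarDeriv S I μ₀ α (S.toD ξ₀) →
          ∃ ξ : ℝ → StrongDual ℝ D,
            (G α).IsLinearizedEvolution S r (A' α) (T α (μ₀ α)) (S.toD ξ₀) ξ ∧
            ∀ t ∈ Set.Icc 0 r,
              Sensitivity.HasWeakStarDeriv S I (fun β => T β (μ₀ β) t) α (ξ t) ∧
              ((G α).FBoundedOnE S M →
                Sensitivity.HasNormDeriv S I (fun β => T β (μ₀ β) t) α (ξ t))) ∧
      -- Gateaux differentiability with respect to the initial data
      (∀ α ∈ I, ∀ ν ∈ M, ∀ ξ₀ : StrongDual ℝ B, (∀ᶠ s : ℝ in nhdsWithin 0 (Set.Ioi 0), ν + s • ξ₀ ∈ M) →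
          ∃ ξ : ℝ → StrongDual ℝ D,
            (G α).IsLinearizedEvolution S r (fun _ => 0) (T α ν) (S.toD ξ₀) ξ ∧
            ∀ t ∈ Set.Icc 0 r,
              Sensitivity.HasWeakStarDeriv S (Set.Ici 0) (fun s => T α (ν + s • ξ₀) t) 0 (ξ t) ∧
              ((G α).FBoundedOnE S M →
                Sensitivity.HasNormDeriv S (Set.Ici 0) (fun s => T α (ν + s • ξ₀) t) 0 (ξ t))) := by
  have hr0 : (0 : ℝ) ≤ r := hr.le
  have hex : ∀ α ν, ∃ m, α ∈ I → ν ∈ M → (G α).IsNonlinearSolution S r M ν m := by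
    intro α ν
    by_cases h : α ∈ I ∧ ν ∈ M
    · obtain ⟨m, hm⟩ := Sensitivity.exists_nonlinear_solution (hG α h.1) hM hr0 h.2
      exact ⟨m, fun _ _ => hm⟩
    · exact ⟨fun _ => 0, fun h1 h2 => absurd ⟨h1, h2⟩ h⟩
  choose T hT using hex
  refine ⟨T, fun α hα ν hν => ⟨hT α ν hα hν, fun ν' hν' =>
    Sensitivity.nonlinear_solution_unique (hG α hα) hM hν' (hT α ν hα hν)⟩, ?_, ?_⟩
  · intro μ₀ hμ₀ α hα ξ₀ hn hw
    exact Sensitivity.exists_parameter_derivative hM hI hr0 hG hA'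
      (m := fun β => T β (μ₀ β)) (fun β hβ => hT β _ hβ (hμ₀ β hβ)) hα hn hw
  · intro α hα ν hν ξ₀ hs
    -- The initial value becomes the parameter, with range `[0,∞)`; off a neighbourhood of `0`
    -- the line `ν + s ξ₀` may leave `M` and is replaced by `ν`.
    classical
    set μ₀ : ℝ → StrongDual ℝ B := fun s => if ν + s • ξ₀ ∈ M then ν + s • ξ₀ else ν with hμ₀
    have hmem : ∀ s, μ₀ s ∈ M := by
      intro s
      by_cases h : ν + s • ξ₀ ∈ M
      · simpa only [hμ₀, if_pos h] using h
      · simpa only [hμ₀, if_neg h] using hν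
    have h0 : μ₀ 0 = ν := by simp [hμ₀]
    have hev : ∀ᶠ s in 𝓝[Ici 0] (0 : ℝ), μ₀ s = ν + s • ξ₀ := by
      rw [← Ioi_insert, nhdsWithin_insert]
      refine eventually_sup.2 ⟨by simp [h0], hs.mono fun s h => ?_⟩
      simp only [hμ₀, if_pos h]
    have hline : ∀ s : ℝ, S.toD (ν + s • ξ₀) = S.toD ν + s • S.toD ξ₀ := fun s => rfl
    have hd : HasDerivWithinAt (fun s => S.toD (μ₀ s)) (S.toD ξ₀) (Ici 0) 0 := by
      have h1 : HasDerivWithinAt (fun s : ℝ => S.toD ν + s • S.toD ξ₀) (S.toD ξ₀) (Ici 0) 0 := by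
        simpa using ((hasDerivWithinAt_id (0 : ℝ) (Ici 0)).smul_const (S.toD ξ₀)).const_add
          (S.toD ν)
      refine h1.congr_of_eventuallyEq (hev.mono fun s h => ?_) ?_
      · simp only [h, hline]
      · simp only [h0, zero_smul, add_zero]
    have hn : Sensitivity.HasNormDeriv S (Ici 0) μ₀ 0 (S.toD ξ₀) :=
      ((ContinuousLinearMap.compL ℝ E D ℝ).flip S.κ).hasFDerivAt.comp_hasDerivWithinAt 0 hd
    have hw : Sensitivity.HasWeakStarDeriv S (Ici 0) μ₀ 0 (S.toD ξ₀) := fun g =>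
      (ContinuousLinearMap.apply ℝ ℝ g).hasFDerivAt.comp_hasDerivWithinAt 0 hd
    obtain ⟨ξ, hξ, hξd⟩ := Sensitivity.exists_parameter_derivative (I := Ici 0) hM ordConnected_Ici
      hr0 (fun _ _ => hG α hα) (Sensitivity.ParameterAssumptions.const (G α)) (μ₀ := μ₀)
      (m := fun s => T α (μ₀ s)) (fun s _ => hT α _ hα (hmem s)) self_mem_Ici hn hw
    simp only [h0] at hξ
    refine ⟨ξ, hξ, fun t ht => ⟨fun g => ?_, fun hF => ?_⟩⟩
    · refine ((hξd t ht).1 g).congr_of_eventuallyEq (hev.mono fun s h => by simp only [h]) ?_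
      simp only [h0, zero_smul, add_zero]
    · refine ((hξd t ht).2 hF).congr_of_eventuallyEq (hev.mono fun s h => by simp only [h]) ?_
      simp only [h0, zero_smul, add_zero]
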